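/- **Setting.** Let $\nu$ be a Borel probability measure on $\mathbb R$ with finite second moment, $Y\sim\nu$; let $b:\mathbb R\to[0,\infty)$ be Borel with $\mathbb E[b(Y)]<\infty$; let $h:[0,\infty)\to\mathbb R$ be Borel and bounded; let $\psi:\mathbb R\to[0,\infty)$ be $L$-Lipschitz (not necessarily bounded). Let $P$ be a Poisson random measure on $\mathbb R_+\times\mathbb R_+\times\mathbb R$ with intensity $dt\,d\theta\,\nu(dy)$, and $\mathcal F_t=\sigma(P(A): A\subset(0,t]\times\mathbb R_+\times\mathbb R \text{ Borel})$. For a horizon $T>0$ the marked Hawkes risk is $$R_t=\int_{(0,t]\times\mathbb R_+\times\mathbb R}y\,\mathbf 1_{\theta\le\lambda_s}P(ds,d\theta,dy),\qquad \lambda_t=\psi\Big(\int_{[0,t)\times\mathbb R_+\times\mathbb R}h(t-s)\,b(y)\,\mathbf 1_{\theta\le\lambda_s}P(ds,d\theta,dy)\Big),\quad t\in[0,T],$$ with $\lambda$ predictable and $P(\{0<s\le T,\ \theta\le\lambda_s\})<\infty$ almost surely. For an integer $M\ge1$ put $\Delta=T/M$, $(t)_\Delta=\lfloor t/\Delta\rfloor\Delta$,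 $X_0=0$ and, for $1\le n\le M$, $$l_n=\psi\Big(\sum_{k=1}^{n-1}h((n-k)\Delta)X_k\Big),\qquad X_n=\int_{((n-1)\Delta,n\Delta]\times\mathbb R_+\times\mathbb R}b(y)\mathbf 1_{\theta\le l_n}P(ds,d\theta,dy);$$ the discrete-time risk, built from the same $P$, is $R^\Delta_t=\sum_{k=1}^{\lfloor t/\Delta\rfloor}\int_{((k-1)\Delta,k\Delta]\times\mathbb R_+\times\mathbb R}y\,\mathbf 1_{\theta\le l_k}P(ds,d\theta,dy)$. Put $$\rho_h=L\,\mathbb E[b(Y)]\int_0^T|h(t)|\,dt,\qquad \rho_{h,\Delta}=L\,\mathbb E[b(Y)]\sum_{k=1}^M|h(k\Delta)|\Delta,$$ $$C_R(h,\Delta)=\int_0^\Delta|h(y)|dy+\sup_{\epsilon\in[0,\Delta]}\int_0^{T-\Delta}|h(y+\epsilon)-h(y)|dy+\int_0^{T-\Delta}|h(y)-h((y)_\Delta+\Delta)|dy,$$ and, on $[0,T]$, $$d_S(f,g)=\inf_\mu\Big\{\sup_{0\le t\le T}|t-\mu(t)|\vee\sup_{0\le t\le T}|f(t)-g(\mu(t))|\Big\},$$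 the infimum being over the strictly increasing continuous $\mu:[0,T]\to[0,T]$ with $\mu(0)=0$, $\mu(T)=T$. The *grid condition* on $h$ at horizon $T$ is $\int_0^{T-\Delta}|h(y)-h((y)_\Delta+\Delta)|dy\to0$ as $\Delta=T/M\to0$. Write $\|h\|_\infty=\sup_{[0,T]}|h|$ and $\|h\|_{p\text{-var}}=\big(\sup\sum_i|h(t_{i+1})-h(t_i)|^p\big)^{1/p}$, the supremum being over subdivisions of $[0,T]$. **Theorem.** Let $\rho<1$. There is a constant $K>0$ depending only on $L$, $\psi(0)$, $\nu$, $b$, $h$ and $\rho$ (in particular not on $T$ or $\Delta$) such that, for every $T>0$ with $\rho_h\le\rho$: 1. For every $M\ge1$ with $\rho_{h,\Delta}\le\rho$, $$\mathbb E\,d_S(R,R^\Delta)\le K\Big(\sqrt\Delta\,(1+T^{3/2})+\sqrt{T\,C_R(h,\Delta)}+T\,C_R(h,\Delta)\Big).\tag{$*$}$$ 2. If the grid condition holds at horizon $T$, there is $\Delta_0>0$ such that $(*)$ holds, with the same $K$, for every $M\ge1$ with $\Delta=T/M\le\Delta_0$. 3. If $p\ge1$ and $h$ has finite $p$-variation on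 $[0,T]$, then the grid condition holds at horizon $T$, and $$\mathbb E\,d_S(R,R^\Delta)\le K\Big(\sqrt\Delta\,(1+T^{3/2})+T\Delta+\sqrt{\|h\|_{p\text{-var}}T^{\frac{2p-1}p}\Delta^{\frac1p}+T\Delta\|h\|_\infty}+\|h\|_{p\text{-var}}T^{\frac{2p-1}p}\Delta^{\frac1p}\Big)$$ for every $M\ge1$ with $\rho_{h,\Delta}\le\rho$, and also for every $M\ge 1$ with $\Delta=T/M$ small enough. -/

import Mathlib

open MeasureTheory ProbabilityTheory Filter Topology Set
open scoped NNReal ENNReal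

universe u

noncomputable section

/-! ### Poisson random measures -/

/-- `P` is a Poisson random measure with intensity `μ` on the probability space `(Ω, Pr)`:
`P A` is Poisson distributed with mean `μ A` whenever `μ A < ∞`, the values of `P` on pairwise
disjoint sets are independent, and almost surely `P` is a (finite or infinite) countable sum of
Dirac masses. -/
structure IsPoissonRandomMeasure {Ω E : Type*} [MeasurableSpace Ω] [MeasurableSpace E]
    (Pr : Measure Ω) (P : Ω → Measure E) (μ : Measure E) : Prop where
  measurable : Measurable P
  law : ∀ A : Set E, MeasurableSet A → μ A ≠ ∞ →
    Pr.map (fun ω => P ω A) =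
      (poissonMeasure (μ A).toNNReal).map (fun n : ℕ => (n : ℝ≥0∞))
  indep : ∀ (n : ℕ) (A : Fin n → Set E), (∀ i, MeasurableSet (A i)) →
    Pairwise (fun i j => Disjoint (A i) (A j)) → iIndepFun (fun i ω => P ω (A i)) Pr
  point : ∀ᵐ ω ∂Pr, ∃ (I : Set ℕ) (x : ℕ → E),
    P ω = Measure.sum (fun i : I => Measure.dirac (x i))

/-- The intensity `dt × dθ × ν(dy)` on `ℝ₊ × ℝ₊ × ℝ`, as a measure on `ℝ × ℝ × ℝ`. -/
def hawkesBaseMeasure (ν : Measure ℝ) : Measure (ℝ × ℝ × ℝ) :=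
  (volume.restrict (Ioi (0 : ℝ))).prod ((volume.restrict (Ioi (0 : ℝ))).prod ν)

/-- The filtration `𝓕_t = σ(P(A) : A ⊆ (0,t] × ℝ₊ × ℝ Borel)`. -/
def pointFiltration {Ω : Type*} [mΩ : MeasurableSpace Ω] (P : Ω → Measure (ℝ × ℝ × ℝ))
    (hP : Measurable P) : Filtration ℝ≥0 mΩ where
  seq t := ⨆ A : {A : Set (ℝ × ℝ × ℝ) // MeasurableSet A ∧
      A ⊆ Ioc (0 : ℝ) (t : ℝ) ×ˢ (Ici (0 : ℝ) ×ˢ (univ : Set ℝ))},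
    MeasurableSpace.comap (fun ω => P ω A.1) inferInstance
  mono' s t hst := by
    refine iSup_le fun A => ?_
    have hst' : (s : ℝ) ≤ (t : ℝ) := by exact_mod_cast hst
    exact le_iSup (fun A : {A : Set (ℝ × ℝ × ℝ) // MeasurableSet A ∧
      A ⊆ Ioc (0 : ℝ) (t : ℝ) ×ˢ (Ici (0 : ℝ) ×ˢ (univ : Set ℝ))} =>
        MeasurableSpace.comap (fun ω => P ω A.1) inferInstance)
      ⟨A.1, A.2.1, A.2.2.trans (prod_mono (Ioc_subset_Ioc_right hst') subset_rfl)⟩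
  le' t := iSup_le fun A =>
    ((Measure.measurable_coe A.2.1).comp hP).comap_le

/-! ### The continuous-time marked Hawkes process -/

/-- Points `(s, θ, y)` with `s ∈ J` and `0 ≤ θ ≤ ℓ s`: the points with time in `J` that are
accepted under the curve `ℓ`. -/
def acceptedPoints (J : Set ℝ) (ℓ : ℝ → ℝ) : Set (ℝ × ℝ × ℝ) :=
  {p | p.1 ∈ J ∧ 0 ≤ p.2.1 ∧ p.2.1 ≤ ℓ p.1}

/-- `lam` (where `lam t ω` is the value at time `t`) is the intensity on `[0,T]` of the marked
Hawkes process with kernel `h`, jump rate `ψ` and marks modulation `b`, thinned from `P`: it is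
predictable, only finitely many points are accepted on `(0,T]`, and pathwise
`λ_t = ψ (∫_{[0,t) × ℝ₊ × ℝ} h(t-s) 1_{θ ≤ λ_s} b(y) P(ds,dθ,dy))` for all `t ∈ [0,T]`. -/
structure IsHawkesIntensity {Ω : Type*} [MeasurableSpace Ω] (Pr : Measure Ω)
    (P : Ω → Measure (ℝ × ℝ × ℝ)) (hP : Measurable P) (h ψ b : ℝ → ℝ) (T : ℝ)
    (lam : ℝ → Ω → ℝ) : Prop where
  predictable : IsStronglyPredictable (pointFiltration P hP) (fun (t : ℝ≥0) ω => lam (t : ℝ) ω)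
  finite : ∀ᵐ ω ∂Pr, P ω (acceptedPoints (Ioc 0 T) (fun s => lam s ω)) < ∞
  eq : ∀ᵐ ω ∂Pr, ∀ t ∈ Icc (0 : ℝ) T,
    lam t ω = ψ (∫ p in acceptedPoints (Ico 0 t) (fun s => lam s ω), h (t - p.1) * b p.2.2 ∂(P ω))

/-- The risk `R_t = ∫_{(0,t] × ℝ₊ × ℝ} y 1_{θ ≤ λ_s} P(ds,dθ,dy)` on one path, where `Q` is the
realisation of the point measure and `ℓ` the path of the intensity. -/
def hawkesRisk (Q : Measure (ℝ × ℝ × ℝ)) (ℓ : ℝ → ℝ) (t : ℝ) : ℝ :=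
  ∫ p in acceptedPoints (Ioc 0 t) ℓ, p.2.2 ∂Q

/-! ### The discrete-time marked Hawkes process -/

/-- The `n`-th time bin `((n-1)Δ, nΔ]`. -/
def timeBin (Δ : ℝ) (n : ℕ) : Set ℝ := Ioc (((n : ℝ) - 1) * Δ) ((n : ℝ) * Δ)

/-- The sequence `X_n`: `X_0 = 0` and
`X_n = ∫_{((n-1)Δ,nΔ] × ℝ₊ × ℝ} b(y) 1_{θ ≤ l_n} P(ds,dθ,dy)` for `n ≥ 1`, where
`l_n = ψ (∑_{k=1}^{n-1} h((n-k)Δ) X_k)`. -/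
def discreteX (Q : Measure (ℝ × ℝ × ℝ)) (h ψ b : ℝ → ℝ) (Δ : ℝ) : ℕ → ℝ
  | 0 => 0
  | n + 1 =>
    ∫ p in acceptedPoints (timeBin Δ (n + 1)) (fun _ =>
        ψ (∑ k : Fin n, h (((n : ℝ) - ((k : ℕ) : ℝ)) * Δ) * discreteX Q h ψ b Δ ((k : ℕ) + 1))),
      b p.2.2 ∂Q
termination_by n => n
decreasing_by have := k.2; omega

/-- The discrete intensity `l_n = ψ (∑_{k=1}^{n-1} h((n-k)Δ) X_k)`. -/
def discreteIntensity (Q : Measure (ℝ × ℝ × ℝ)) (h ψ b : ℝ → ℝ) (Δ : ℝ) (n : ℕ) : ℝ :=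
  ψ (∑ k ∈ Finset.Ico 1 n, h (((n : ℝ) - (k : ℝ)) * Δ) * discreteX Q h ψ b Δ k)

theorem discreteX_zero (Q : Measure (ℝ × ℝ × ℝ)) (h ψ b : ℝ → ℝ) (Δ : ℝ) :
    discreteX Q h ψ b Δ 0 = 0 := by
  rw [discreteX]

/-- The defining recursion of `X` in terms of the discrete intensity. -/
theorem discreteX_succ (Q : Measure (ℝ × ℝ × ℝ)) (h ψ b : ℝ → ℝ) (Δ : ℝ) (n : ℕ) :
    discreteX Q h ψ b Δ (n + 1) =
      ∫ p in acceptedPoints (timeBin Δ (n + 1)) (fun _ => discreteIntensity Q h ψ b Δ (n + 1)),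
        b p.2.2 ∂Q := by
  have key : (∑ k : Fin n, h (((n : ℝ) - ((k : ℕ) : ℝ)) * Δ) * discreteX Q h ψ b Δ ((k : ℕ) + 1)) =
      ∑ k ∈ Finset.Ico 1 (n + 1),
        h ((((n + 1 : ℕ) : ℝ) - (k : ℝ)) * Δ) * discreteX Q h ψ b Δ k := by
    rw [Finset.sum_Ico_eq_sum_range, Finset.sum_range]
    refine Finset.sum_congr (by simp) fun k _ => ?_
    have e : ((n : ℝ) - ((k : ℕ) : ℝ)) = ((n + 1 : ℕ) : ℝ) - ((1 + (k : ℕ) : ℕ) : ℝ) := by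
      push_cast; ring
    rw [e, Nat.add_comm 1 (k : ℕ)]
  rw [discreteX, key, discreteIntensity]

/-- The discrete-time risk, embedded as a piecewise constant function of time:
`R^Δ_t = ∑_{k=1}^{⌊t/Δ⌋} ∫_{((k-1)Δ,kΔ] × ℝ₊ × ℝ} y 1_{θ ≤ l_k} P(ds,dθ,dy)`. -/
def discreteRisk (Q : Measure (ℝ × ℝ × ℝ)) (h ψ b : ℝ → ℝ) (Δ : ℝ) (t : ℝ) : ℝ :=
  ∑ k ∈ Finset.Icc 1 ⌊t / Δ⌋₊,
    ∫ p in acceptedPoints (timeBin Δ k) (fun _ => discreteIntensity Q h ψ b Δ k), p.2.2 ∂Q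

/-! ### Stability constants, regularity of the kernel -/

/-- `ρ_h = L ‖h‖_{L¹([0,T])} E[b(Y)]`. -/
def stabilityConst (L : ℝ) (ν : Measure ℝ) (b h : ℝ → ℝ) (T : ℝ) : ℝ :=
  L * (∫ t in (0 : ℝ)..T, |h t|) * ∫ y, b y ∂ν

/-- `ρ_{h,Δ} = L ∑_{k=1}^M |h(kΔ)| Δ E[b(Y)]`, with `Δ = T / M`. -/
def discreteStabilityConst (L : ℝ) (ν : Measure ℝ) (b h : ℝ → ℝ) (T : ℝ) (M : ℕ) : ℝ :=
  L * (∑ k ∈ Finset.Icc 1 M, |h ((k : ℝ) * (T / M))| * (T / M)) * ∫ y, b y ∂ν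

/-- `∫_0^{T-Δ} |h(y) - h((y)_Δ + Δ)| dy` with `(y)_Δ = ⌊y/Δ⌋ Δ`. -/
def gridError (h : ℝ → ℝ) (T Δ : ℝ) : ℝ :=
  ∫ y in (0 : ℝ)..(T - Δ), |h y - h ((⌊y / Δ⌋ : ℝ) * Δ + Δ)|

/-- The constant `C_R(h,Δ)`. -/
def kernelRegularity (h : ℝ → ℝ) (T Δ : ℝ) : ℝ :=
  (∫ y in (0 : ℝ)..Δ, |h y|)
    + (⨆ ε : Icc (0 : ℝ) Δ, ∫ y in (0 : ℝ)..(T - Δ), |h (y + ε) - h y|)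
    + gridError h T Δ

/-- The grid error of the kernel tends to zero with the step `Δ = T / M`. -/
def GridErrorTendsToZero (h : ℝ → ℝ) (T : ℝ) : Prop :=
  Tendsto (fun M : ℕ => gridError h T (T / M)) atTop (𝓝 0)

/-- The `p`-variation of `h` on `[0,T]`,
`(sup ∑ |h(t_{i+1}) - h(t_i)|^p)^{1/p}` over subdivisions `t_0 ≤ ⋯ ≤ t_n` of `[0,T]`. -/
def pVariation (p : ℝ) (h : ℝ → ℝ) (T : ℝ) : ℝ≥0∞ :=
  (⨆ q : ℕ × {t : ℕ → ℝ // Monotone t ∧ ∀ i, t i ∈ Icc (0 : ℝ) T},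
    ∑ i ∈ Finset.range q.1, ENNReal.ofReal (|h (q.2.1 (i + 1)) - h (q.2.1 i)| ^ p)) ^ (1 / p)

/-- `‖h‖_∞ = sup_{0 ≤ t ≤ T} |h(t)|`. -/
def supNormOn (h : ℝ → ℝ) (T : ℝ) : ℝ := ⨆ t : Icc (0 : ℝ) T, |h t|

/-! ### The Skorokhod distance -/

/-- Strictly increasing continuous maps of `[0,T]` onto itself fixing the end points. -/
structure IsTimeChange (T : ℝ) (μ : ℝ → ℝ) : Prop where
  strictMono : StrictMonoOn μ (Icc 0 T)
  continuous : ContinuousOn μ (Icc 0 T)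
  map_zero : μ 0 = 0
  map_end : μ T = T

/-- The Skorokhod distance
`d_S(f,g) = inf_μ max (sup_{t ≤ T} |t - μ(t)|) (sup_{t ≤ T} |f(t) - g(μ(t))|)` on `[0,T]`. -/
def skorokhodDist (T : ℝ) (f g : ℝ → ℝ) : ℝ≥0∞ :=
  ⨅ (μ : ℝ → ℝ) (_ : IsTimeChange T μ),
    max (⨆ t ∈ Icc (0 : ℝ) T, ENNReal.ofReal |t - μ t|)
      (⨆ t ∈ Icc (0 : ℝ) T, ENNReal.ofReal |f t - g (μ t)|)

/-- `E d_S(R, R^Δ) ≤ B` with `Δ = T / M`, for the continuous- and discrete-time risks thinned from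
one Poisson random measure with intensity `dt dθ ν(dy)`, on any probability space. -/
def MeanSkorokhodErrorLE (ν : Measure ℝ) (h ψ b : ℝ → ℝ) (T : ℝ) (M : ℕ) (B : ℝ) : Prop :=
  ∀ (Ω : Type u) [MeasurableSpace Ω] (Pr : Measure Ω) [IsProbabilityMeasure Pr]
    (P : Ω → Measure (ℝ × ℝ × ℝ)) (hP : IsPoissonRandomMeasure Pr P (hawkesBaseMeasure ν))
    (lam : ℝ → Ω → ℝ), IsHawkesIntensity Pr P hP.measurable h ψ b T lam →
    ∫⁻ ω, skorokhodDist T (hawkesRisk (P ω) (fun s => lam s ω))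
      (discreteRisk (P ω) h ψ b (T / M)) ∂Pr ≤ ENNReal.ofReal B

/-- The bound `K (√Δ (1 + T^{3/2}) + √(T C_R(h,Δ)) + T C_R(h,Δ))` with `Δ = T / M`. -/
def riskBound (K : ℝ) (h : ℝ → ℝ) (T : ℝ) (M : ℕ) : ℝ :=
  K * (√(T / M) * (1 + T ^ (3 / 2 : ℝ)) + √(T * kernelRegularity h T (T / M))
    + T * kernelRegularity h T (T / M))

/-- The bound for kernels of finite `p`-variation,
`K (√Δ (1 + T^{3/2}) + T Δ + √(‖h‖_{p-var} T^{(2p-1)/p} Δ^{1/p} + T Δ ‖h‖_∞)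
  + ‖h‖_{p-var} T^{(2p-1)/p} Δ^{1/p})` with `Δ = T / M`. -/
def riskBoundPVar (K p : ℝ) (h : ℝ → ℝ) (T : ℝ) (M : ℕ) : ℝ :=
  K * (√(T / M) * (1 + T ^ (3 / 2 : ℝ)) + T * (T / M)
    + √((pVariation p h T).toReal * T ^ ((2 * p - 1) / p) * (T / M) ^ (1 / p)
        + T * (T / M) * supNormOn h T)
    + (pVariation p h T).toReal * T ^ ((2 * p - 1) / p) * (T / M) ^ (1 / p))

end

set_option linter.unusedSectionVars false

/-! ### Moments and tails of the Poisson distribution -/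

/-! Both processes thin the same Poisson random measure, so a point is accepted by exactly one of
them only if its height lies between the two intensities. By the compensation formula for
predictable integrands (`IsCompensatedProcess.lintegral_lintegral`) the mean total absolute mark of
such points is at most `E|Y|` times the L¹ distance `D` of the intensities. What remains is the cost
of moving the jumps of the discrete process to the grid.

Distance of the intensities. Lipschitz continuity and compensation turn the Hawkes equations into
linear convolution inequalities between means. Since `ρ < 1` they close: the mean intensities are at
most `ψ(0)/(1-ρ)`, and `D` is at most a constant times `T C_R(h,Δ)` plus `ρ D`. The source term
compares `h(s-u)` with `laggedKernel`, the value of `h` at the distance of the bins of `s` and `u`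
(`lintegral_sub_laggedKernel_le`); the feedback term carries the lagged kernel, whose integral is
the Riemann sum in `ρ_{h,Δ}`. Absorbing `ρ D` requires finiteness beforehand. It comes from a
truncation at a nondecreasing predictable majorant for the continuous process, and from induction on
the bins for the discrete one.

Time change. If a bin contains at most one point accepted by the discrete process, a piecewise
linear time change moves that point to the grid at a displacement of at most `2Δ`. This fails only
in bins with two points, and in the last bin because `T` is fixed. At a given time only the current
bin contributes, so the error is a maximum of total absolute marks `S_k` over the unmatched bins. It
is bounded through `S ≤ x + S²/x` with `x = √Δ U_k`, where `U_k` majorises the intensity `l_k` and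
is known when bin `k` begins. The square `S_k²` is dominated by sums over ordered pairs of points,
in which the sum over the earlier point is predictable. Compensation yields `Δ²` and two
intensities, one of which is cancelled by `U_k`; a first moment of `l_k` therefore suffices, as it
must since `b(Y)` has only a mean. Summation over `T/Δ` bins gives `√Δ T`.

The result is a bound of order `√Δ (1 + T^{3/2}) + T C_R`. Under the grid condition the Riemann sum
of `|h|` exceeds the integral by a vanishing amount, so the discrete process is stable at a level
slightly above `ρ`. For finite `p`-variation, Hölder's inequality along each translate of the grid
bounds the displacement integrals in `C_R`. -/

theorem lintegral_poissonMeasure_id (r : ℝ≥0) :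
    ∫⁻ n : ℕ, (n : ℝ≥0∞) ∂(poissonMeasure r) = r := by
  have hint : ∀ f : ℕ → ℝ≥0∞, ∫⁻ n, f n ∂(poissonMeasure r) =
      ∑' n : ℕ, ENNReal.ofReal (Real.exp (-r) * (r : ℝ) ^ n / n.factorial) * f n := fun f => by
    rw [poissonMeasure, lintegral_sum_measure]
    simp
  rw [hint, tsum_eq_zero_add' ENNReal.summable]
  have hone := hint (fun _ => 1)
  simp only [lintegral_const, measure_univ, mul_one] at hone
  calc _ = ∑' n : ℕ, (r : ℝ≥0∞) *
        ENNReal.ofReal (Real.exp (-r) * (r : ℝ) ^ n / n.factorial) := by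
        simp only [Nat.cast_zero, mul_zero, zero_add]
        refine tsum_congr fun n => ?_
        rw [← ENNReal.ofReal_natCast, ← ENNReal.ofReal_coe_nnreal,
          ← ENNReal.ofReal_mul (by positivity), ← ENNReal.ofReal_mul (by positivity)]
        congr 1
        rw [Nat.factorial_succ]
        push_cast
        field_simp
        ring
    _ = r := by rw [ENNReal.tsum_mul_left, ← hone, mul_one]

/-- Since `e^{-r} ≥ 1 - r`, one has `1 - e^{-r}(1 + r) ≤ 1 - (1 - r)(1 + r) = r²`. -/
theorem poissonMeasure_one_lt_le (r : ℝ≥0) :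
    poissonMeasure r {n : ℕ | 1 < n} ≤ (r : ℝ≥0∞) ^ 2 := by
  have h1 : {n : ℕ | 1 < n} = ({0, 1} : Set ℕ)ᶜ := by
    ext n; simp only [mem_ofPred_eq, mem_compl_iff, mem_insert_iff, mem_singleton_iff]; omega
  have h2 : (poissonMeasure r).real ({0, 1} : Set ℕ) = Real.exp (-r) + Real.exp (-r) * r := by
    have : ({0, 1} : Set ℕ) = {0} ∪ {1} := rfl
    rw [this, measureReal_union (by simp) (by simp), poissonMeasure_real_singleton,
      poissonMeasure_real_singleton]
    simp
  have h3 : (poissonMeasure r).real {n : ℕ | 1 < n} ≤ (r : ℝ) ^ 2 := by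
    rw [h1, measureReal_compl (by simp), h2]
    have := Real.add_one_le_exp (-(r : ℝ))
    simp only [probReal_univ]
    nlinarith [r.2]
  calc poissonMeasure r {n : ℕ | 1 < n}
      = ENNReal.ofReal ((poissonMeasure r).real {n : ℕ | 1 < n}) := by simp
    _ ≤ ENNReal.ofReal ((r : ℝ) ^ 2) := ENNReal.ofReal_le_ofReal h3
    _ = (r : ℝ≥0∞) ^ 2 := by
      rw [ENNReal.ofReal_pow (NNReal.coe_nonneg r)]; simp

/-! ### Means, null sets and independence for Poisson random measures -/

namespace IsPoissonRandomMeasure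

variable {Ω E : Type*} [MeasurableSpace Ω] [MeasurableSpace E] {Pr : Measure Ω}
  {P : Ω → Measure E} {μ : Measure E}

theorem measurable_apply (hP : IsPoissonRandomMeasure Pr P μ) {A : Set E} (hA : MeasurableSet A) :
    Measurable (fun ω => P ω A) :=
  (Measure.measurable_coe hA).comp hP.measurable

theorem lintegral_apply (hP : IsPoissonRandomMeasure Pr P μ) {A : Set E} (hA : MeasurableSet A)
    (hμ : μ A ≠ ∞) : ∫⁻ ω, P ω A ∂Pr = μ A := by
  have h1 : ∫⁻ ω, P ω A ∂Pr = ∫⁻ x, x ∂(Pr.map (fun ω => P ω A)) := by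
    rw [lintegral_map (f := fun x => x) measurable_id (hP.measurable_apply hA)]
  rw [h1, hP.law A hA hμ, lintegral_map (f := fun x => x) measurable_id .of_discrete,
    lintegral_poissonMeasure_id, ENNReal.coe_toNNReal hμ]

theorem measure_one_lt_le (hP : IsPoissonRandomMeasure Pr P μ) {A : Set E} (hA : MeasurableSet A)
    (hμ : μ A ≠ ∞) : Pr {ω | 1 < P ω A} ≤ μ A ^ 2 := by
  have h1 : Pr {ω | 1 < P ω A} = Pr.map (fun ω => P ω A) (Ioi 1) := by
    rw [Measure.map_apply (hP.measurable_apply hA) measurableSet_Ioi]; rfl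
  rw [h1, hP.law A hA hμ, Measure.map_apply .of_discrete measurableSet_Ioi]
  have h2 : (fun n : ℕ => (n : ℝ≥0∞)) ⁻¹' Ioi 1 = {n : ℕ | 1 < n} := by
    ext n; simp
  rw [h2]
  refine (poissonMeasure_one_lt_le _).trans_eq ?_
  rw [ENNReal.coe_toNNReal hμ]

theorem ae_lt_top (hP : IsPoissonRandomMeasure Pr P μ) {A : Set E} (hA : MeasurableSet A)
    (hμ : μ A ≠ ∞) : ∀ᵐ ω ∂Pr, P ω A < ∞ :=
  MeasureTheory.ae_lt_top (hP.measurable_apply hA) (by rw [hP.lintegral_apply hA hμ]; exact hμ)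

theorem ae_eq_zero (hP : IsPoissonRandomMeasure Pr P μ) {A : Set E} (hA : MeasurableSet A)
    (hμ : μ A = 0) : ∀ᵐ ω ∂Pr, P ω A = 0 := by
  have := hP.lintegral_apply hA (by simp [hμ])
  rw [hμ, lintegral_eq_zero_iff (hP.measurable_apply hA)] at this
  exact this

/-- The values of a Poisson random measure on subsets of `B` are jointly independent of its value
on a set disjoint from `B`. -/
theorem indep_iSup_comap [IsProbabilityMeasure Pr] (hP : IsPoissonRandomMeasure Pr P μ)
    {B D : Set E} (hD : MeasurableSet D) (hBD : Disjoint B D) :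
    Indep (⨆ A : {A : Set E // MeasurableSet A ∧ A ⊆ B},
        MeasurableSpace.comap (fun ω => P ω A.1) inferInstance)
      (MeasurableSpace.comap (fun ω => P ω D) inferInstance) Pr := by
  classical
  -- The σ-algebra is a directed supremum of those generated by finitely many values, so
  -- independence need only be shown for a finite family `S`.
  rw [iSup_eq_iSup_finset]
  have hle : ∀ A : {A : Set E // MeasurableSet A ∧ A ⊆ B},
      MeasurableSpace.comap (fun ω => P ω A.1) inferInstance ≤ (inferInstance : MeasurableSpace Ω) :=
    fun A => (hP.measurable_apply A.2.1).comap_le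
  refine indep_iSup_of_directed_le (fun S => ?_) (fun S => iSup₂_le fun A _ => hle A)
    (hP.measurable_apply hD).comap_le ?_
  swap
  · exact Monotone.directed_le fun S S' hSS' => biSup_mono fun A hA => Finset.mem_of_subset hSS' hA
  -- the partition of `⋃ S` into atoms, together with `D`
  let f : Option (S → Bool) → Set E := fun o => o.elim D
    (fun g => {p | (∃ A : S, p ∈ A.1.1) ∧ ∀ A : S, (p ∈ A.1.1 ↔ g A = true)})
  have hfm : ∀ o, MeasurableSet (f o) := by
    rintro (_ | g)
    · exact hD
    · have : f (some g) = (⋃ A : S, A.1.1) ∩ ⋂ A : S, {p | p ∈ A.1.1 ↔ g A = true} := by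
        ext p; simp [f]
      rw [this]
      refine (MeasurableSet.iUnion fun A => A.1.2.1).inter (MeasurableSet.iInter fun A => ?_)
      by_cases hg : g A = true
      · simpa [hg] using A.1.2.1
      · have : {p | p ∈ A.1.1 ↔ g A = true} = (A.1.1)ᶜ := by ext p; simp [hg]
        rw [this]; exact A.1.2.1.compl
  have hfd : Pairwise (fun i j => Disjoint (f i) (f j)) := by
    have aux : ∀ g, Disjoint (f (some g)) D := fun g =>
      hBD.mono_left (fun p hp => by obtain ⟨⟨A, hA⟩, -⟩ := hp; exact A.1.2.2 hA)
    rintro (_ | g) (_ | g') hne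
    · exact (hne rfl).elim
    · exact (aux g').symm
    · exact aux g
    · refine Set.disjoint_left.2 fun p hp hp' => hne ?_
      congr 1; funext A
      have := (hp.2 A).symm.trans (hp'.2 A)
      exact Bool.eq_iff_iff.2 this
  let e := Fintype.equivFin (Option (S → Bool))
  have hind : iIndepFun (fun o ω => P ω (f o)) Pr := by
    have h0 := hP.indep _ (fun i => f (e.symm i)) (fun i => hfm _)
      (fun i j hij => hfd (fun h => hij (e.symm.injective h)))
    have h1 := h0.precomp (g := e) e.injective
    simpa using h1
  have hind' := indep_iSup_of_disjoint (S := range some) (T := {none})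
    (fun o => (hP.measurable_apply (hfm o)).comap_le) hind.iIndep (by simp)
  refine indep_of_indep_of_le_left (indep_of_indep_of_le_right hind' ?_) ?_
  · exact le_iSup₂_of_le none rfl le_rfl
  · refine iSup₂_le fun A hA => ?_
    rw [← measurable_iff_comap_le]
    -- The value on a member of `S` is the sum of the values on the atoms it contains. The atoms and
    -- `D` are pairwise disjoint, hence their values are jointly independent.
    have hsum : ∀ ω, P ω A.1 = ∑ g ∈ Finset.univ.filter (fun g : S → Bool => g ⟨A, hA⟩ = true),
        P ω (f (some g)) := by
      intro ω
      rw [← measure_biUnion_finset (fun g _ g' _ hne => hfd (by simpa using hne))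
        (fun g _ => hfm _)]
      congr 1
      ext p
      simp only [Finset.mem_filter, Finset.mem_univ, true_and, mem_iUnion, exists_prop]
      constructor
      · intro hp
        refine ⟨fun A' => decide (p ∈ A'.1.1), by simpa using hp, ⟨⟨A, hA⟩, hp⟩, fun A' => by simp⟩
      · rintro ⟨g, hg, hp⟩
        exact (hp.2 ⟨A, hA⟩).2 hg
    simp_rw [hsum]
    refine Finset.measurable_fun_sum _ fun g _ => ?_
    rw [measurable_iff_comap_le]
    exact le_iSup₂_of_le (some g) ⟨g, rfl⟩ le_rfl

end IsPoissonRandomMeasure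

/-! ### A regular version of the Poisson random measure -/

/-- The bounded window `(0,N] × [0,N] × ℝ`. -/
def window (N : ℕ) : Set (ℝ × ℝ × ℝ) := Ioc (0 : ℝ) N ×ˢ (Icc (0 : ℝ) N ×ˢ univ)

/-- The quadrant `(0,∞) × [0,∞) × ℝ`. -/
def quadrant : Set (ℝ × ℝ × ℝ) := Ioi (0 : ℝ) ×ˢ (Ici (0 : ℝ) ×ˢ univ)

theorem measurableSet_window (N : ℕ) : MeasurableSet (window N) :=
  measurableSet_Ioc.prod (measurableSet_Icc.prod MeasurableSet.univ)

theorem measurableSet_quadrant : MeasurableSet quadrant :=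
  measurableSet_Ioi.prod (measurableSet_Ici.prod MeasurableSet.univ)

theorem window_mono {N N' : ℕ} (h : N ≤ N') : window N ⊆ window N' := by
  have : (N : ℝ) ≤ N' := by exact_mod_cast h
  exact prod_mono (Ioc_subset_Ioc_right this)
    (prod_mono (Icc_subset_Icc_right this) subset_rfl)

theorem iUnion_window : ⋃ N, window N = quadrant := by
  ext p
  simp only [window, quadrant, mem_iUnion, mem_prod, mem_Ioc, mem_Icc, mem_univ, and_true,
    mem_Ioi, mem_Ici]
  constructor
  · rintro ⟨N, ⟨h1, -⟩, h2, -⟩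
    exact ⟨h1, h2⟩
  · rintro ⟨h1, h2⟩
    obtain ⟨N, hN⟩ := exists_nat_ge (max p.1 p.2.1)
    exact ⟨N, ⟨h1, (le_max_left _ _).trans hN⟩, h2, (le_max_right _ _).trans hN⟩

/-- A locally finite sum of Dirac masses on the quadrant, no two of them at the same time. -/
structure IsSimpleConfiguration (Q : Measure (ℝ × ℝ × ℝ)) : Prop where
  atoms : ∃ (I : Set ℕ) (x : ℕ → ℝ × ℝ × ℝ), Q = Measure.sum (fun i : I => Measure.dirac (x i))
  window_lt_top : ∀ N, Q (window N) < ∞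
  compl_quadrant : Q quadrantᶜ = 0
  time_le_one : ∀ t : ℝ, Q {p | p.1 = t} ≤ 1

/-- A random simple configuration that is adapted to `𝓖` and whose increments after time `s` have
mean `dt dθ ν(dy)` conditionally on `𝓖 s`. -/
structure IsCompensatedProcess {Ω : Type*} [mΩ : MeasurableSpace Ω] (Pr : Measure Ω)
    (𝓖 : Filtration ℝ≥0 mΩ) (κ : Ω → Measure (ℝ × ℝ × ℝ)) (ν : Measure ℝ) : Prop where
  simple : ∀ ω, IsSimpleConfiguration (κ ω)
  adapted : ∀ (t : ℝ≥0) (A : Set (ℝ × ℝ × ℝ)), MeasurableSet A →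
    Measurable[𝓖 t] (fun ω => κ ω (A ∩ {p | p.1 ≤ t}))
  compensated : ∀ (s : ℝ≥0) (N : ℕ) (D : Set (ℝ × ℝ × ℝ)), MeasurableSet D →
    ∀ A, MeasurableSet[𝓖 s] A →
      ∫⁻ ω in A, κ ω (D ∩ {p | (s : ℝ) < p.1} ∩ window N) ∂Pr =
        Pr A * hawkesBaseMeasure ν (D ∩ {p | (s : ℝ) < p.1} ∩ window N)

/-- Integrality of the mass is what later turns `Q A < 2` into "at most one point". -/
theorem measure_sum_dirac_eq_natCast {E : Type*} [MeasurableSpace E] {I : Set ℕ} {x : ℕ → E}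
    {A : Set E} (hA : MeasurableSet A)
    (hfin : Measure.sum (fun i : I => Measure.dirac (x i)) A ≠ ∞) :
    ∃ n : ℕ, Measure.sum (fun i : I => Measure.dirac (x i)) A = n := by
  rw [Measure.sum_apply _ hA] at hfin ⊢
  have h1 : ∀ i : I, Measure.dirac (x i) A = A.indicator 1 (x i) := fun i =>
    Measure.dirac_apply' _ hA
  simp_rw [h1] at hfin ⊢
  have hf : {i : I | x i ∈ A}.Finite := by
    refine (ENNReal.finite_const_le_of_tsum_ne_top hfin (one_ne_zero)).subset fun i hi => ?_
    have hi' : x i ∈ A := hi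
    simp [hi']
  refine ⟨hf.toFinset.card, ?_⟩
  rw [tsum_eq_sum (s := hf.toFinset)]
  · rw [Finset.sum_congr rfl (g := fun _ => 1)]
    · simp
    · intro i hi
      have : x i ∈ A := by simpa using hi
      simp [this]
  · intro i hi
    have : x i ∉ A := by simpa using hi
    simp [this]

theorem IsSimpleConfiguration.exists_natCast {Q : Measure (ℝ × ℝ × ℝ)}
    (hQ : IsSimpleConfiguration Q) {A : Set (ℝ × ℝ × ℝ)} (hA : MeasurableSet A) (hfin : Q A ≠ ∞) :
    ∃ n : ℕ, Q A = n := by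
  obtain ⟨I, x, rfl⟩ := hQ.atoms
  exact measure_sum_dirac_eq_natCast hA hfin

/-- The zero measure is the default value of the regular version on the exceptional null set. -/
theorem isSimpleConfiguration_zero : IsSimpleConfiguration 0 where
  atoms := ⟨∅, fun _ => 0, by simp⟩
  window_lt_top := by simp
  compl_quadrant := by simp
  time_le_one := by simp

/-! ### The intensity measure on slabs and windows -/

section Base

variable (ν : Measure ℝ) [IsProbabilityMeasure ν]

instance : SFinite (hawkesBaseMeasure ν) := by unfold hawkesBaseMeasure; infer_instance

theorem hawkesBaseMeasure_prod (a b : Set ℝ) (c : Set ℝ) (ha : MeasurableSet a)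
    (hb : MeasurableSet b) : hawkesBaseMeasure ν (a ×ˢ (b ×ˢ c)) =
      volume (a ∩ Ioi 0) * (volume (b ∩ Ioi 0) * ν c) := by
  rw [hawkesBaseMeasure, Measure.prod_prod, Measure.prod_prod, Measure.restrict_apply ha,
    Measure.restrict_apply hb]

theorem hawkesBaseMeasure_slab_le (a b c : ℝ) :
    hawkesBaseMeasure ν (Ioc a b ×ˢ (Icc 0 c ×ˢ univ)) ≤
      ENNReal.ofReal (b - a) * ENNReal.ofReal c := by
  rw [hawkesBaseMeasure_prod _ _ _ _ measurableSet_Ioc measurableSet_Icc, measure_univ, mul_one]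
  refine mul_le_mul' ?_ ?_
  · exact (measure_mono inter_subset_left).trans_eq (by simp)
  · exact (measure_mono inter_subset_left).trans_eq (by simp)

theorem hawkesBaseMeasure_window_lt_top (N : ℕ) : hawkesBaseMeasure ν (window N) < ∞ :=
  (hawkesBaseMeasure_slab_le ν _ _ _).trans_lt (by finiteness)

theorem hawkesBaseMeasure_compl_quadrant : hawkesBaseMeasure ν quadrantᶜ = 0 := by
  have : (quadrantᶜ : Set (ℝ × ℝ × ℝ)) ⊆
      (Iic (0 : ℝ) ×ˢ (univ ×ˢ univ)) ∪ (univ ×ˢ (Iio (0 : ℝ) ×ˢ univ)) := by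
    intro p hp
    by_contra hcon
    simp only [mem_union, mem_prod, mem_univ, and_true, true_and, mem_Iic, mem_Iio, not_or,
      not_le, not_lt] at hcon
    exact hp ⟨hcon.1, hcon.2, trivial⟩
  refine measure_mono_null this (measure_union_null ?_ ?_)
  · rw [hawkesBaseMeasure_prod _ _ _ _ measurableSet_Iic MeasurableSet.univ]
    have : Iic (0 : ℝ) ∩ Ioi 0 = ∅ := by ext; simp
    simp [this]
  · rw [hawkesBaseMeasure_prod _ _ _ _ MeasurableSet.univ measurableSet_Iio]
    have : Iio (0 : ℝ) ∩ Ioi 0 = ∅ := by ext x; simp; intro h; exact h.le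
    simp [this]

end Base

section Version

variable {Ω : Type*} [mΩ : MeasurableSpace Ω] {Pr : Measure Ω}
  {P : Ω → Measure (ℝ × ℝ × ℝ)} {ν : Measure ℝ} [IsProbabilityMeasure ν]

/-- Two points at one time share a cell of every partition of `(0,N]` into `N(m+1)` intervals. Each
cell has mass at most `N/(m+1)`, hence two points with probability at most the square of this; the
union bound is `N³/(m+1)`, which vanishes as `m` grows. -/
theorem IsPoissonRandomMeasure.ae_time_le_one_window
    (hP : IsPoissonRandomMeasure Pr P (hawkesBaseMeasure ν)) (N : ℕ) :
    ∀ᵐ ω ∂Pr, ∀ t : ℝ, P ω ({p | p.1 = t} ∩ window N) ≤ 1 := by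
  rw [ae_iff]
  set bad := {ω | ¬ ∀ t : ℝ, P ω ({p | p.1 = t} ∩ window N) ≤ 1} with hbad
  let cell : ℕ → ℕ → Set (ℝ × ℝ × ℝ) := fun m j =>
    Ioc ((j : ℝ) / (m + 1)) (((j : ℝ) + 1) / (m + 1)) ×ˢ (Icc (0 : ℝ) N ×ˢ univ)
  have hcell : ∀ m j, MeasurableSet (cell m j) := fun m j =>
    measurableSet_Ioc.prod (measurableSet_Icc.prod MeasurableSet.univ)
  have hcellμ : ∀ m j, hawkesBaseMeasure ν (cell m j) ≤ ENNReal.ofReal ((N : ℝ) / (m + 1)) := by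
    intro m j
    refine (hawkesBaseMeasure_slab_le ν _ _ _).trans_eq ?_
    rw [← ENNReal.ofReal_mul' (by positivity)]
    congr 1
    field_simp
    ring
  have hle : ∀ m : ℕ, Pr bad ≤ ENNReal.ofReal ((N : ℝ) ^ 3 / (m + 1)) := by
    intro m
    have hsub : bad ⊆ ⋃ j ∈ Finset.range (N * (m + 1)), {ω | 1 < P ω (cell m j)} := by
      intro ω hω
      simp only [hbad, mem_ofPred_eq, not_forall, not_le] at hω
      obtain ⟨t, ht⟩ := hω
      have htpos : 0 < t ∧ t ≤ N := by
        by_contra hcon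
        have : {p : ℝ × ℝ × ℝ | p.1 = t} ∩ window N = ∅ := by
          ext p
          simp only [window, mem_inter_iff, mem_ofPred_eq, mem_prod, mem_Ioc, mem_empty_iff_false,
            iff_false]
          rintro ⟨rfl, h, -⟩
          exact hcon h
        rw [this] at ht
        simp at ht
      set j := ⌈t * (m + 1)⌉₊ - 1 with hj
      have hc1 : 1 ≤ ⌈t * (m + 1)⌉₊ := Nat.one_le_ceil_iff.2 (by have := htpos.1; positivity)
      have hj1 : ((j : ℝ) + 1) = ⌈t * (m + 1)⌉₊ := by
        have : j + 1 = ⌈t * (m + 1)⌉₊ := by omega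
        exact_mod_cast this
      have hlt : (⌈t * (m + 1)⌉₊ : ℝ) < t * (m + 1) + 1 :=
        Nat.ceil_lt_add_one (by have := htpos.1; positivity)
      have hge : t * (m + 1) ≤ (⌈t * (m + 1)⌉₊ : ℝ) := Nat.le_ceil _
      simp only [mem_iUnion, Finset.mem_range, mem_ofPred_eq, exists_prop]
      refine ⟨j, ?_, ht.trans_le (measure_mono ?_)⟩
      · have : ⌈t * (m + 1)⌉₊ ≤ N * (m + 1) := by
          refine Nat.ceil_le.2 ?_
          push_cast
          exact mul_le_mul_of_nonneg_right htpos.2 (by positivity)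
        omega
      · rintro p ⟨hp, hpw⟩
        have hp' : p.1 = t := hp
        refine ⟨?_, hpw.2⟩
        rw [hp', mem_Ioc, div_lt_iff₀ (by positivity), le_div_iff₀ (by positivity)]
        constructor <;> linarith
    calc Pr bad ≤ ∑ j ∈ Finset.range (N * (m + 1)), Pr {ω | 1 < P ω (cell m j)} :=
          (measure_mono hsub).trans (measure_biUnion_finset_le _ _)
      _ ≤ ∑ j ∈ Finset.range (N * (m + 1)), ENNReal.ofReal ((N : ℝ) / (m + 1)) ^ 2 := by
          refine Finset.sum_le_sum fun j _ => ?_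
          refine (hP.measure_one_lt_le (hcell m j) ((hcellμ m j).trans_lt (by finiteness)).ne).trans ?_
          gcongr
          exact hcellμ m j
      _ = ENNReal.ofReal ((N : ℝ) ^ 3 / (m + 1)) := by
          rw [Finset.sum_const, Finset.card_range, nsmul_eq_mul, ← ENNReal.ofReal_natCast,
            ← ENNReal.ofReal_pow (by positivity), ← ENNReal.ofReal_mul (by positivity)]
          congr 1
          push_cast
          field_simp
  have hlim : Tendsto (fun m : ℕ => ENNReal.ofReal ((N : ℝ) ^ 3 / (m + 1))) atTop (𝓝 0) := by
    rw [← ENNReal.ofReal_zero]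
    exact ENNReal.tendsto_ofReal
      (tendsto_const_nhds.div_atTop (tendsto_natCast_atTop_atTop.atTop_add tendsto_const_nhds))
  exact le_antisymm (ge_of_tendsto' hlim hle) zero_le

theorem IsPoissonRandomMeasure.ae_isSimpleConfiguration
    (hP : IsPoissonRandomMeasure Pr P (hawkesBaseMeasure ν)) :
    ∀ᵐ ω ∂Pr, IsSimpleConfiguration (P ω) := by
  have h2 : ∀ᵐ ω ∂Pr, ∀ N, P ω (window N) < ∞ := ae_all_iff.2 fun N =>
    hP.ae_lt_top (measurableSet_window N) (hawkesBaseMeasure_window_lt_top ν N).ne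
  have h3 := hP.ae_eq_zero measurableSet_quadrant.compl (hawkesBaseMeasure_compl_quadrant ν)
  have h4 := ae_all_iff.2 hP.ae_time_le_one_window
  filter_upwards [hP.point, h2, h3, h4] with ω h1 h2 h3 h4
  refine ⟨h1, h2, h3, fun t => ?_⟩
  have : P ω {p | p.1 = t} ≤ P ω (⋃ N, {p | p.1 = t} ∩ window N) + P ω quadrantᶜ := by
    refine (measure_mono ?_).trans (measure_union_le _ _)
    rw [← inter_iUnion, iUnion_window]
    intro p hp
    by_cases hq : p ∈ quadrant
    · exact Or.inl ⟨hp, hq⟩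
    · exact Or.inr hq
  rw [h3, add_zero] at this
  refine this.trans ?_
  rw [Monotone.measure_iUnion
    (fun N N' hN => inter_subset_inter_right _ (window_mono hN))]
  exact iSup_le fun N => h4 N t

/-- Every filtration can be enlarged by the measurable sets of the form `null ∪ adapted`. -/
def completedFiltration (Pr : Measure Ω) (𝓕 : Filtration ℝ≥0 mΩ) : Filtration ℝ≥0 mΩ where
  -- The completion contains every subset of a null set; the meet with the ambient σ-algebra keeps
  -- only measurable sets.
  seq t := eventuallyMeasurableSpace (𝓕 t) (ae Pr) ⊓ mΩ
  mono' _ _ hst := inf_le_inf_right _ fun _ ⟨B, hB, h⟩ => ⟨B, 𝓕.mono hst _ hB, h⟩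
  le' _ := inf_le_right

theorem measurableSet_completedFiltration {𝓕 : Filtration ℝ≥0 mΩ} {t : ℝ≥0} {A : Set Ω} :
    MeasurableSet[completedFiltration Pr 𝓕 t] A ↔
      (∃ B, MeasurableSet[𝓕 t] B ∧ A =ᵐ[Pr] B) ∧ MeasurableSet A :=
  MeasurableSpace.measurableSet_inf

theorem le_completedFiltration (𝓕 : Filtration ℝ≥0 mΩ) (t : ℝ≥0) :
    𝓕 t ≤ completedFiltration Pr 𝓕 t :=
  le_inf le_eventuallyMeasurableSpace (𝓕.le t)

/-- Lets an intensity that is predictable for the point filtration be used with the completed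
filtration. -/
theorem predictable_mono {𝓕 𝓖 : Filtration ℝ≥0 mΩ} (h : ∀ t, 𝓕 t ≤ 𝓖 t) :
    𝓕.predictable ≤ 𝓖.predictable :=
  measurableSpace_le_predictable_of_measurableSet
    (fun _ hA => measurableSet_predictable_singleton_bot_prod (h _ _ hA))
    (fun _ _ hA => measurableSet_predictable_Ioi_prod (h _ _ hA))

/-- `κ` is `P` off a measurable null set and zero on it. The modification need not be adapted to the
original filtration, whence the completion. The conditional mean of the increments survives: a set
of the completion differs from a set of `𝓕 s` by a null set, and the increments after `s` are
independent of `𝓕 s`. -/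
theorem IsPoissonRandomMeasure.exists_isCompensatedProcess [IsProbabilityMeasure Pr]
    (hP : IsPoissonRandomMeasure Pr P (hawkesBaseMeasure ν)) :
    ∃ κ : Ω → Measure (ℝ × ℝ × ℝ), (∀ᵐ ω ∂Pr, P ω = κ ω) ∧
      IsCompensatedProcess Pr (completedFiltration Pr (pointFiltration P hP.measurable)) κ ν := by
  classical
  set 𝓕 := pointFiltration P hP.measurable with h𝓕
  set G : Set Ω := (toMeasurable Pr {ω | ¬ IsSimpleConfiguration (P ω)})ᶜ with hG
  have hGm : MeasurableSet G := (measurableSet_toMeasurable _ _).compl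
  have hG0 : Pr Gᶜ = 0 := by
    rw [hG, compl_compl, measure_toMeasurable]
    exact hP.ae_isSimpleConfiguration
  have hGs : ∀ ω ∈ G, IsSimpleConfiguration (P ω) := fun ω hω => by
    by_contra hcon
    exact hω (subset_toMeasurable _ _ hcon)
  have hGae : ∀ᵐ ω ∂Pr, ω ∈ G := by rw [ae_iff]; exact hG0
  let κ : Ω → Measure (ℝ × ℝ × ℝ) := fun ω => if ω ∈ G then P ω else 0
  have hκ : ∀ᵐ ω ∂Pr, P ω = κ ω := by
    filter_upwards [hGae] with ω hω
    simp [κ, hω]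
  have hκs : ∀ ω, IsSimpleConfiguration (κ ω) := fun ω => by
    by_cases hω : ω ∈ G
    · simpa [κ, hω] using hGs ω hω
    · simpa [κ, hω] using isSimpleConfiguration_zero
  refine ⟨κ, hκ, hκs, fun t A hA => ?_, fun s N D hD A hA => ?_⟩
  · have hset : MeasurableSet ({p : ℝ × ℝ × ℝ | p.1 ≤ t}) := measurable_fst measurableSet_Iic
    -- The filtration only sees subsets of `(0,t] × ℝ₊ × ℝ`, so the set is first cut with the
    -- quadrant, which carries all the mass of `κ`.
    have hF : Measurable[𝓕 t] (fun ω => P ω (A ∩ {p | p.1 ≤ t} ∩ quadrant)) := by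
      rw [measurable_iff_comap_le]
      refine le_iSup (fun A : {A : Set (ℝ × ℝ × ℝ) // MeasurableSet A ∧
        A ⊆ Ioc (0 : ℝ) (t : ℝ) ×ˢ (Ici (0 : ℝ) ×ˢ (univ : Set ℝ))} =>
          MeasurableSpace.comap (fun ω => P ω A.1) inferInstance)
        ⟨A ∩ {p | p.1 ≤ t} ∩ quadrant, (hA.inter hset).inter measurableSet_quadrant, ?_⟩
      rintro p ⟨⟨-, hp⟩, hq⟩
      exact ⟨⟨hq.1, hp⟩, hq.2⟩
    have hcongr : ∀ ω, κ ω (A ∩ {p | p.1 ≤ t}) = κ ω (A ∩ {p | p.1 ≤ t} ∩ quadrant) := fun ω => by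
      refine le_antisymm ?_ (measure_mono inter_subset_left)
      have h0 : κ ω ((A ∩ {p | p.1 ≤ t}) \ quadrant) = 0 :=
        measure_mono_null (fun p hp => hp.2) (hκs ω).compl_quadrant
      rw [← measure_inter_add_sdiff (A ∩ {p | p.1 ≤ t}) measurableSet_quadrant, h0, add_zero]
    intro S hS
    rw [measurableSet_completedFiltration]
    refine ⟨⟨_, hF hS, ?_⟩, ?_⟩
    · rw [eventuallyEq_set]
      filter_upwards [hκ] with ω hω
      have : κ ω (A ∩ {p | p.1 ≤ t}) = P ω (A ∩ {p | p.1 ≤ t} ∩ quadrant) := by rw [hcongr, hω]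
      rw [mem_preimage, mem_preimage, this]
    · have : Measurable (fun ω => κ ω (A ∩ {p | p.1 ≤ t})) := by
        have : (fun ω => κ ω (A ∩ {p | p.1 ≤ t})) =
            G.indicator (fun ω => P ω (A ∩ {p | p.1 ≤ t})) := by
          ext ω
          by_cases hω : ω ∈ G <;> simp [κ, hω]
        rw [this]
        exact (hP.measurable_apply (hA.inter hset)).indicator hGm
      exact this hS
  · obtain ⟨⟨B, hB, hAB⟩, hAm⟩ := measurableSet_completedFiltration.1 hA
    set D' := D ∩ {p | (s : ℝ) < p.1} ∩ window N with hD'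
    have hD'm : MeasurableSet D' :=
      (hD.inter (measurable_fst measurableSet_Ioi)).inter (measurableSet_window N)
    have hBm : MeasurableSet B := 𝓕.le s _ hB
    have hfin : hawkesBaseMeasure ν D' ≠ ∞ :=
      ((measure_mono inter_subset_right).trans_lt (hawkesBaseMeasure_window_lt_top ν N)).ne
    have hind := hP.indep_iSup_comap (B := Ioc (0 : ℝ) (s : ℝ) ×ˢ (Ici (0 : ℝ) ×ˢ (univ : Set ℝ)))
      hD'm (Set.disjoint_left.2 fun p hp hp' => not_lt.2 hp.1.2 hp'.1.2)
    have hmul := lintegral_mul_eq_lintegral_mul_lintegral_of_independent_measurableSpace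
      (f := B.indicator 1) (g := fun ω => P ω D') (𝓕.le s)
      (hP.measurable_apply hD'm).comap_le hind
      (Measurable.indicator (m := 𝓕 s) (@measurable_const ℝ≥0∞ Ω _ (𝓕 s) 1) hB) (comap_measurable _)
    rw [lintegral_indicator_one hBm, hP.lintegral_apply hD'm hfin] at hmul
    rw [measure_congr hAB, ← hmul, setLIntegral_congr hAB, ← lintegral_indicator hBm]
    refine lintegral_congr_ae ?_
    filter_upwards [hκ] with ω hω
    by_cases hωB : ω ∈ B <;> simp [hωB, hω]

end Version

/-! ### Kernels of locally finite measures -/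

section Kernel

theorem lintegral_eq_iSup_window {Q : Measure (ℝ × ℝ × ℝ)} (hc : Q quadrantᶜ = 0)
    (f : ℝ × ℝ × ℝ → ℝ≥0∞) : ∫⁻ p, f p ∂Q = ⨆ N, ∫⁻ p in window N, f p ∂Q := by
  rw [← setLIntegral_iUnion_of_directed f
    (Monotone.directed_le fun N N' h => window_mono h), iUnion_window, Measure.restrict_eq_self_of_ae_mem]
  exact measure_mono_null (fun _ h => h) hc

theorem measure_eq_iSup_window {Q : Measure (ℝ × ℝ × ℝ)} (hc : Q quadrantᶜ = 0)
    (A : Set (ℝ × ℝ × ℝ)) : Q A = ⨆ N, Q (A ∩ window N) := by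
  rw [← Monotone.measure_iUnion fun N N' h => inter_subset_inter_right _ (window_mono h),
    ← inter_iUnion, iUnion_window]
  refine le_antisymm ?_ (measure_mono inter_subset_left)
  have h0 : Q (A \ quadrant) = 0 := measure_mono_null (fun p hp => hp.2) hc
  rw [← measure_inter_add_sdiff A measurableSet_quadrant, h0, add_zero]

variable {Ω : Type*} [mΩ : MeasurableSpace Ω]

/-- The mass of a window is finite for each `ω` but not bounded in `ω`. Cutting each difference of
consecutive windows according to the integer part of its random mass gives countably many kernels of
bounded mass. -/
theorem isSFiniteKernel_of_window (Q : Kernel Ω (ℝ × ℝ × ℝ))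
    (hf : ∀ ω N, Q ω (window N) < ∞) (hc : ∀ ω, Q ω quadrantᶜ = 0) : IsSFiniteKernel Q := by
  classical
  let ring : ℕ → Set (ℝ × ℝ × ℝ) := disjointed window
  have hring : ∀ N, MeasurableSet (ring N) := fun N =>
    MeasurableSet.disjointed measurableSet_window N
  have hlev : ∀ N n : ℕ, MeasurableSet {ω | Q ω (ring N) ∈ Ico (n : ℝ≥0∞) (n + 1)} := fun N n =>
    (Q.measurable_coe (hring N)) measurableSet_Ico
  let R : ℕ × ℕ → Kernel Ω (ℝ × ℝ × ℝ) := fun i =>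
    Kernel.piecewise (hlev i.1 i.2) (Q.restrict (hring i.1)) 0
  have hR : ∀ i, IsFiniteKernel (R i) := fun i => by
    refine ⟨⟨(i.2 : ℝ≥0∞) + 1, by finiteness, fun ω => ?_⟩⟩
    simp only [R, Kernel.piecewise_apply]
    split_ifs with h
    · rw [Kernel.restrict_apply, Measure.restrict_apply_univ]
      exact h.2.le
    · simp
  have hsum : Q = Kernel.sum R := by
    ext ω A hA
    rw [Kernel.sum_apply' _ _ hA, ENNReal.tsum_prod (f := fun N n => R (N, n) ω A)]
    have h1 : ∀ N, ∑' n, R (N, n) ω A = Q ω (A ∩ ring N) := by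
      intro N
      have hfin : Q ω (ring N) < ∞ := (measure_mono (disjointed_subset _ _)).trans_lt (hf ω N)
      have hn : ∀ n : ℕ, Q ω (ring N) ∈ Ico (n : ℝ≥0∞) (n + 1) ↔ n = ⌊(Q ω (ring N)).toReal⌋₊ := by
        intro n
        rw [eq_comm, Nat.floor_eq_iff ENNReal.toReal_nonneg, mem_Ico,
          ← ENNReal.ofReal_toReal hfin.ne, ENNReal.toReal_ofReal ENNReal.toReal_nonneg]
        have e : ((n : ℝ≥0∞) + 1) = ENNReal.ofReal ((n : ℝ) + 1) := by
          rw [ENNReal.ofReal_add (by positivity) zero_le_one]; simp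
        rw [e, ENNReal.ofReal_lt_ofReal_iff (by positivity), ← ENNReal.ofReal_natCast n,
          ENNReal.ofReal_le_ofReal_iff ENNReal.toReal_nonneg]
      rw [tsum_eq_single ⌊(Q ω (ring N)).toReal⌋₊]
      · simp only [R, Kernel.piecewise_apply]
        have : ω ∈ {ω' | Q ω' (ring N) ∈
            Ico ((⌊(Q ω (ring N)).toReal⌋₊ : ℕ) : ℝ≥0∞) ((⌊(Q ω (ring N)).toReal⌋₊ : ℕ) + 1)} :=
          (hn _).2 rfl
        rw [if_pos this, Kernel.restrict_apply, Measure.restrict_apply hA]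
      · intro n hne
        simp only [R, Kernel.piecewise_apply]
        have : ω ∉ {ω | Q ω (ring N) ∈ Ico (n : ℝ≥0∞) (n + 1)} := fun h => hne ((hn n).1 h)
        rw [if_neg this]
        simp
    simp_rw [h1]
    rw [← measure_iUnion
      (fun i j hij => (disjoint_disjointed window hij).mono inter_subset_right inter_subset_right)
      (fun N => hA.inter (hring N)), ← inter_iUnion, iUnion_disjointed, iUnion_window]
    refine le_antisymm ?_ (measure_mono inter_subset_left)
    have h0 : Q ω (A \ quadrant) = 0 := measure_mono_null (fun p hp => hp.2) (hc ω)
    rw [← measure_inter_add_sdiff A measurableSet_quadrant, h0, add_zero]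
  rw [hsum]
  infer_instance

end Kernel

/-! ### The predictable σ-algebra on outcomes and points -/

section Predictable

variable {Ω : Type*} [mΩ : MeasurableSpace Ω]

/-- The predictable `σ`-algebra on `Ω × (ℝ × ℝ × ℝ)`, the first real coordinate being time. -/
@[reducible]
def predictablePoints (𝓖 : Filtration ℝ≥0 mΩ) : MeasurableSpace (Ω × (ℝ × ℝ × ℝ)) :=
  MeasurableSpace.generateFrom
    ({S | ∃ (s : ℝ≥0) (A : Set Ω) (D : Set (ℝ × ℝ × ℝ)), MeasurableSet[𝓖 s] A ∧ MeasurableSet D ∧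
        S = A ×ˢ (D ∩ {p | (s : ℝ) < p.1})} ∪
      {S | ∃ (A : Set Ω) (D : Set (ℝ × ℝ × ℝ)), MeasurableSet[𝓖 0] A ∧ MeasurableSet D ∧
        S = A ×ˢ (D ∩ {p | p.1 ≤ 0})})

variable {𝓖 : Filtration ℝ≥0 mΩ}

theorem predictablePoints_le : predictablePoints 𝓖 ≤ Prod.instMeasurableSpace := by
  refine MeasurableSpace.generateFrom_le ?_
  rintro S (⟨s, A, D, hA, hD, rfl⟩ | ⟨A, D, hA, hD, rfl⟩)
  · exact (𝓖.le s _ hA).prod (hD.inter (measurable_fst measurableSet_Ioi))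
  · exact (𝓖.le 0 _ hA).prod (hD.inter (measurable_fst measurableSet_Iic))

theorem measurable_predictablePoints_snd :
    Measurable[predictablePoints 𝓖] (fun x : Ω × (ℝ × ℝ × ℝ) => x.2) := by
  intro D hD
  have : (fun x : Ω × (ℝ × ℝ × ℝ) => x.2) ⁻¹' D =
      univ ×ˢ (D ∩ {p | ((0 : ℝ≥0) : ℝ) < p.1}) ∪ univ ×ˢ (D ∩ {p | p.1 ≤ 0}) := by
    ext x
    simp only [mem_preimage, mem_union, mem_prod, mem_univ, true_and, mem_inter_iff,
      mem_ofPred_eq, NNReal.coe_zero]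
    have := lt_or_ge (0 : ℝ) x.2.1
    tauto
  rw [this]
  refine @MeasurableSet.union _ (predictablePoints 𝓖) _ _ ?_ ?_
  · exact MeasurableSpace.measurableSet_generateFrom
      (Or.inl ⟨0, univ, D, MeasurableSet.univ, hD, rfl⟩)
  · exact MeasurableSpace.measurableSet_generateFrom
      (Or.inr ⟨univ, D, MeasurableSet.univ, hD, rfl⟩)

theorem measurable_predictablePoints_time :
    Measurable[predictablePoints 𝓖] (fun x : Ω × (ℝ × ℝ × ℝ) => x.2.1) :=
  measurable_fst.comp measurable_predictablePoints_snd

/-- A `𝓖 s`-measurable variable, used after time `s` only, is predictable. -/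
theorem measurable_predictablePoints_indicator {β : Type*} [MeasurableSpace β] [Zero β] {s : ℝ≥0}
    {g : Ω → β} (hg : Measurable[𝓖 s] g) :
    Measurable[predictablePoints 𝓖]
      ({x : Ω × (ℝ × ℝ × ℝ) | (s : ℝ) < x.2.1}.indicator (fun x => g x.1)) := by
  have hR : MeasurableSet[predictablePoints 𝓖] {x : Ω × (ℝ × ℝ × ℝ) | (s : ℝ) < x.2.1} :=
    measurable_predictablePoints_time measurableSet_Ioi
  intro B hB
  rw [indicator_preimage, Set.ite]
  refine @MeasurableSet.union _ (predictablePoints 𝓖) _ _ ?_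
    (@MeasurableSet.diff _ (predictablePoints 𝓖) _ _
      (@measurable_const β _ _ (predictablePoints 𝓖) 0 _ hB) hR)
  refine MeasurableSpace.measurableSet_generateFrom
    (Or.inl ⟨s, g ⁻¹' B, univ, hg hB, MeasurableSet.univ, ?_⟩)
  ext x; simp

/-- The generators on `ℝ≥0 × Ω` pull back to generators of `predictablePoints`. Since `toNNReal`
sends all nonpositive times to 0, the generators at time 0 pull back to the second family, which
exists for this purpose. -/
theorem IsStronglyPredictable.measurable_predictablePoints {u : ℝ≥0 → Ω → ℝ}
    (hu : IsStronglyPredictable 𝓖 u) :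
    Measurable[predictablePoints 𝓖] (fun x : Ω × (ℝ × ℝ × ℝ) => u x.2.1.toNNReal x.1) := by
  have h1 : @Measurable _ _ (predictablePoints 𝓖) 𝓖.predictable
      (fun x : Ω × (ℝ × ℝ × ℝ) => (x.2.1.toNNReal, x.1)) := by
    refine @measurable_generateFrom _ _ (predictablePoints 𝓖) _ _ ?_
    rintro S (⟨A, hA, rfl⟩ | ⟨s, A, hA, rfl⟩)
    · refine MeasurableSpace.measurableSet_generateFrom
        (Or.inr ⟨A, univ, hA, MeasurableSet.univ, ?_⟩)
      ext x; simp [and_comm]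
    · refine MeasurableSpace.measurableSet_generateFrom
        (Or.inl ⟨s, A, univ, hA, MeasurableSet.univ, ?_⟩)
      ext x
      simp [and_comm, Real.lt_toNNReal_iff_coe_lt]
  have hu' : StronglyMeasurable[𝓖.predictable] (Function.uncurry u) := hu
  exact hu'.measurable.comp h1

/-- Predictable sets are progressively measurable: a generator starting at `s ≥ r` has no points up
to time `r`, and the others involve `𝓖 s` with `s ≤ r` only. -/
theorem measurableSet_inter_le_of_predictablePoints (r : ℝ≥0) {S : Set (Ω × (ℝ × ℝ × ℝ))}
    (hS : MeasurableSet[predictablePoints 𝓖] S) :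
    MeasurableSet[@Prod.instMeasurableSpace _ _ (𝓖 r) _] (S ∩ {x | x.2.1 ≤ r}) := by
  let _ : MeasurableSpace Ω := 𝓖 r
  have hR : MeasurableSet {x : Ω × (ℝ × ℝ × ℝ) | x.2.1 ≤ r} :=
    (measurable_fst.comp measurable_snd) measurableSet_Iic
  induction S, hS using MeasurableSpace.generateFrom_induction with
  | hC S hS _ =>
    rcases hS with ⟨s, A, D, hA, hD, rfl⟩ | ⟨A, D, hA, hD, rfl⟩
    · rcases le_or_gt r s with hrs | hsr
      · convert! MeasurableSet.empty
        ext x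
        simp only [mem_inter_iff, mem_prod, mem_ofPred_eq, mem_empty_iff_false, iff_false]
        rintro ⟨⟨-, -, h1⟩, h2⟩
        exact absurd (h1.trans_le h2) (not_lt.2 (by exact_mod_cast hrs))
      · have hA' : MeasurableSet A := 𝓖.mono hsr.le _ hA
        exact (hA'.prod (hD.inter (measurable_fst measurableSet_Ioi))).inter hR
    · have hA' : MeasurableSet A := 𝓖.mono zero_le _ hA
      exact (hA'.prod (hD.inter (measurable_fst measurableSet_Iic))).inter hR
  | empty => simp
  | compl S _ ih =>
    have : Sᶜ ∩ {x : Ω × (ℝ × ℝ × ℝ) | x.2.1 ≤ r} = {x : Ω × (ℝ × ℝ × ℝ) | x.2.1 ≤ r} \ (S ∩ {x | x.2.1 ≤ r}) := by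
      ext x; simp only [mem_inter_iff, mem_compl_iff, Set.mem_sdiff]; tauto
    rw [this]
    exact hR.diff ih
  | iUnion f _ ih =>
    rw [iUnion_inter]
    exact MeasurableSet.iUnion ih

theorem measurable_indicator_le_of_predictablePoints (r : ℝ≥0) {f : Ω × (ℝ × ℝ × ℝ) → ℝ≥0∞}
    (hf : Measurable[predictablePoints 𝓖] f) :
    Measurable[@Prod.instMeasurableSpace _ _ (𝓖 r) _] ({x | x.2.1 ≤ (r : ℝ)}.indicator f) := by
  have hS := fun B hB => measurableSet_inter_le_of_predictablePoints r (hf (t := B) hB)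
  let _ : MeasurableSpace Ω := 𝓖 r
  have hR : MeasurableSet {x : Ω × (ℝ × ℝ × ℝ) | x.2.1 ≤ r} :=
    (measurable_fst.comp measurable_snd) measurableSet_Iic
  intro B hB
  rw [indicator_preimage, Set.ite]
  exact (hS B hB).union
    ((measurable_const hB).diff hR)

end Predictable

/-! ### Measurability of integrals against the random measure -/

namespace IsCompensatedProcess

variable {Ω : Type*} [mΩ : MeasurableSpace Ω] {Pr : Measure Ω} {𝓖 : Filtration ℝ≥0 mΩ}
  {κ : Ω → Measure (ℝ × ℝ × ℝ)} {ν : Measure ℝ}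

/-- Adaptedness speaks of finite horizons only; the whole space is reached by a supremum over
windows. -/
theorem measurable_apply (hκ : IsCompensatedProcess Pr 𝓖 κ ν) {A : Set (ℝ × ℝ × ℝ)}
    (hA : MeasurableSet A) : Measurable (fun ω => κ ω A) := by
  have : ∀ ω, κ ω A = ⨆ N : ℕ, κ ω (A ∩ window N ∩ {p | p.1 ≤ (N : ℝ≥0)}) := fun ω => by
    rw [measure_eq_iSup_window (hκ.simple ω).compl_quadrant A]
    congr 1; ext N; congr 1; ext p
    simp only [window, mem_inter_iff, mem_prod, mem_Ioc, mem_ofPred_eq, NNReal.coe_natCast]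
    tauto
  simp_rw [this]
  exact Measurable.iSup fun N =>
    ((hκ.adapted N _ (hA.inter (measurableSet_window N))).mono (𝓖.le _) le_rfl)

/-- The random measure as a transition kernel. -/
noncomputable def kernel (hκ : IsCompensatedProcess Pr 𝓖 κ ν) : Kernel Ω (ℝ × ℝ × ℝ) where
  toFun := κ
  measurable' := Measure.measurable_of_measurable_coe _ fun _ hA => hκ.measurable_apply hA

theorem kernel_apply (hκ : IsCompensatedProcess Pr 𝓖 κ ν) (ω : Ω) : hκ.kernel ω = κ ω := rfl

theorem isSFiniteKernel (hκ : IsCompensatedProcess Pr 𝓖 κ ν) : IsSFiniteKernel hκ.kernel :=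
  isSFiniteKernel_of_window _ (fun ω N => (hκ.simple ω).window_lt_top N)
    (fun ω => (hκ.simple ω).compl_quadrant)

theorem measurable_lintegral (hκ : IsCompensatedProcess Pr 𝓖 κ ν) {f : Ω × (ℝ × ℝ × ℝ) → ℝ≥0∞}
    (hf : Measurable f) : Measurable (fun ω => ∫⁻ p, f (ω, p) ∂(κ ω)) := by
  have := hκ.isSFiniteKernel
  exact Measurable.lintegral_kernel_prod_right (κ := hκ.kernel) (f := fun ω p => f (ω, p)) hf

/-- Restricted to times up to `t`, the random measure is an s-finite kernel from `(Ω, 𝓖 t)`, so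
measurability of kernel integrals applies with `𝓖 t` as the source σ-algebra. -/
theorem measurable_lintegral_le (hκ : IsCompensatedProcess Pr 𝓖 κ ν) (t : ℝ≥0)
    {f : Ω × (ℝ × ℝ × ℝ) → ℝ≥0∞} (hf : Measurable[@Prod.instMeasurableSpace _ _ (𝓖 t) _] f) :
    Measurable[𝓖 t] (fun ω => ∫⁻ p in {p | p.1 ≤ (t : ℝ)}, f (ω, p) ∂(κ ω)) := by
  have had := hκ.adapted t
  have hs := hκ.simple
  let _ : MeasurableSpace Ω := 𝓖 t
  let Q : Kernel Ω (ℝ × ℝ × ℝ) :=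
    { toFun := fun ω => (κ ω).restrict {p | p.1 ≤ (t : ℝ)}
      measurable' := Measure.measurable_of_measurable_coe _ fun A hA => by
        simp_rw [Measure.restrict_apply hA]
        exact had A hA }
  have hle : ∀ ω, Q ω ≤ κ ω := fun ω => Measure.restrict_le_self
  have : IsSFiniteKernel Q := isSFiniteKernel_of_window _
    (fun ω N => (hle ω _).trans_lt ((hs ω).window_lt_top N))
    (fun ω => le_antisymm ((hle ω _).trans_eq (hs ω).compl_quadrant) zero_le)
  exact Measurable.lintegral_kernel_prod_right (κ := Q) (f := fun ω p => f (ω, p)) hf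

/-- The integral of a predictable integrand up to time `t` is adapted. -/
theorem measurable_lintegral_le_of_predictable (hκ : IsCompensatedProcess Pr 𝓖 κ ν) (t : ℝ≥0)
    {f : Ω × (ℝ × ℝ × ℝ) → ℝ≥0∞} (hf : Measurable[predictablePoints 𝓖] f) :
    Measurable[𝓖 t] (fun ω => ∫⁻ p in {p | p.1 ≤ (t : ℝ)}, f (ω, p) ∂(κ ω)) := by
  have h := hκ.measurable_lintegral_le t (measurable_indicator_le_of_predictablePoints t hf)
  have hset : MeasurableSet ({p : ℝ × ℝ × ℝ | p.1 ≤ t}) := measurable_fst measurableSet_Iic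
  convert! h using 2 with ω
  refine setLIntegral_congr_fun hset fun p hp => ?_
  symm
  exact indicator_of_mem (s := {x : Ω × (ℝ × ℝ × ℝ) | x.2.1 ≤ (t : ℝ)}) hp f

/-- The integral of a predictable integrand over the past of `t`, strictly before `t`, is
predictable. -/
theorem measurable_lintegral_lt (hκ : IsCompensatedProcess Pr 𝓖 κ ν)
    {f : Ω × (ℝ × ℝ × ℝ) → ℝ≥0∞} (hf : Measurable[predictablePoints 𝓖] f) :
    Measurable[predictablePoints 𝓖]
      (fun x : Ω × (ℝ × ℝ × ℝ) => ∫⁻ q in {q | q.1 < x.2.1}, f (x.1, q) ∂(κ x.1)) := by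
  -- The strict past of a time is the union of the pasts up to smaller rationals `r`. The integral
  -- up to `r` is `𝓖 r`-measurable and is used only after `r`, hence predictable. Nonnegative
  -- rationals suffice because the points have positive times.
  have key : (fun x : Ω × (ℝ × ℝ × ℝ) => ∫⁻ q in {q | q.1 < x.2.1}, f (x.1, q) ∂(κ x.1)) =
      fun x => ⨆ r : ℚ≥0, ({x : Ω × (ℝ × ℝ × ℝ) | ((r : ℝ≥0) : ℝ) < x.2.1}.indicator
        (fun x => ∫⁻ q in {q | q.1 ≤ ((r : ℝ≥0) : ℝ)}, f (x.1, q) ∂(κ x.1))) x := by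
    ext x
    refine le_antisymm ?_ (iSup_le fun r => ?_)
    · have h1 : ∫⁻ q in {q | q.1 < x.2.1}, f (x.1, q) ∂(κ x.1) =
          ∫⁻ q in ⋃ r : {r : ℚ≥0 // ((r : ℝ≥0) : ℝ) < x.2.1}, {q | q.1 ≤ ((r.1 : ℝ≥0) : ℝ)},
            f (x.1, q) ∂(κ x.1) := by
        refine setLIntegral_congr ?_
        have h0 : ∀ᵐ q ∂(κ x.1), q ∈ quadrant := (hκ.simple x.1).compl_quadrant
        rw [eventuallyEq_set]
        filter_upwards [h0] with q hq
        simp only [mem_ofPred_eq, mem_iUnion]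
        constructor
        · intro hlt
          obtain ⟨r, hr1, hr2⟩ := exists_rat_btwn hlt
          have hr0 : (0 : ℝ) < r := lt_trans hq.1 hr1
          have hr0' : (0 : ℚ) ≤ r := by exact_mod_cast hr0.le
          refine ⟨⟨⟨r, hr0'⟩, ?_⟩, ?_⟩
          · exact hr2
          · exact hr1.le
        · rintro ⟨r, hr⟩
          exact hr.trans_lt r.2
      rw [h1, setLIntegral_iUnion_of_directed]
      · refine iSup_le fun r => le_iSup_of_le r.1 ?_
        have : x ∈ {x : Ω × (ℝ × ℝ × ℝ) | ((r.1 : ℝ≥0) : ℝ) < x.2.1} := r.2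
        rw [indicator_of_mem this]
      · refine Monotone.directed_le fun r r' hrr' => ?_
        intro q hq
        have h2 : ((r.1 : ℝ≥0) : ℝ) ≤ ((r'.1 : ℝ≥0) : ℝ) := by
          have : r.1 ≤ r'.1 := hrr'
          exact_mod_cast this
        exact le_trans (show q.1 ≤ ((r.1 : ℝ≥0) : ℝ) from hq) h2
    · by_cases hx : x ∈ {x : Ω × (ℝ × ℝ × ℝ) | ((r : ℝ≥0) : ℝ) < x.2.1}
      · rw [indicator_of_mem hx]
        exact lintegral_mono_set fun q (hq : q.1 ≤ _) => hq.trans_lt hx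
      · rw [indicator_of_notMem hx]; exact zero_le
  rw [key]
  exact Measurable.iSup fun r => measurable_predictablePoints_indicator
    (hκ.measurable_lintegral_le_of_predictable (r : ℝ≥0) hf)

end IsCompensatedProcess

theorem isPiSystem_predictablePoints {Ω : Type*} [mΩ : MeasurableSpace Ω]
    (𝓖 : Filtration ℝ≥0 mΩ) :
    IsPiSystem ({S | ∃ (s : ℝ≥0) (A : Set Ω) (D : Set (ℝ × ℝ × ℝ)), MeasurableSet[𝓖 s] A ∧
        MeasurableSet D ∧ S = A ×ˢ (D ∩ {p | (s : ℝ) < p.1})} ∪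
      {S | ∃ (A : Set Ω) (D : Set (ℝ × ℝ × ℝ)), MeasurableSet[𝓖 0] A ∧ MeasurableSet D ∧
        S = A ×ˢ (D ∩ {p | p.1 ≤ 0})}) := by
  rintro S (⟨s, A, D, hA, hD, rfl⟩ | ⟨A, D, hA, hD, rfl⟩) S'
    (⟨s', A', D', hA', hD', rfl⟩ | ⟨A', D', hA', hD', rfl⟩) -
  · left
    refine ⟨max s s', A ∩ A', D ∩ D', ?_, hD.inter hD', ?_⟩
    · exact @MeasurableSet.inter _ (𝓖 _) _ _ (𝓖.mono (le_max_left _ _) _ hA)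
        (𝓖.mono (le_max_right _ _) _ hA')
    · ext x
      simp only [mem_inter_iff, mem_prod, mem_ofPred_eq, NNReal.coe_max, max_lt_iff]
      tauto
  · left
    refine ⟨s, A, ∅, hA, MeasurableSet.empty, ?_⟩
    ext x
    simp only [mem_inter_iff, mem_prod, mem_ofPred_eq, mem_empty_iff_false, false_and, and_false,
      iff_false]
    rintro ⟨⟨-, -, h1⟩, -, -, h2⟩
    exact absurd (s.2.trans_lt h1) (not_lt.2 h2)
  · left
    refine ⟨s', A', ∅, hA', MeasurableSet.empty, ?_⟩
    ext x
    simp only [mem_inter_iff, mem_prod, mem_ofPred_eq, mem_empty_iff_false, false_and, and_false,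
      iff_false]
    rintro ⟨⟨-, -, h2⟩, -, -, h1⟩
    exact absurd (s'.2.trans_lt h1) (not_lt.2 h2)
  · right
    refine ⟨A ∩ A', D ∩ D', @MeasurableSet.inter _ (𝓖 _) _ _ hA hA', hD.inter hD', ?_⟩
    ext x
    simp only [mem_inter_iff, mem_prod, mem_ofPred_eq]
    tauto

/-! ### The compensation formula -/

namespace IsCompensatedProcess

variable {Ω : Type*} [mΩ : MeasurableSpace Ω] {Pr : Measure Ω} [IsProbabilityMeasure Pr]
  {𝓖 : Filtration ℝ≥0 mΩ} {κ : Ω → Measure (ℝ × ℝ × ℝ)} {ν : Measure ℝ} [IsProbabilityMeasure ν]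

/-- The compensation formula for predictable nonnegative integrands. -/
theorem lintegral_lintegral (hκ : IsCompensatedProcess Pr 𝓖 κ ν)
    {f : Ω × (ℝ × ℝ × ℝ) → ℝ≥0∞} (hf : Measurable[predictablePoints 𝓖] f) :
    ∫⁻ ω, ∫⁻ p, f (ω, p) ∂(κ ω) ∂Pr = ∫⁻ ω, ∫⁻ p, f (ω, p) ∂(hawkesBaseMeasure ν) ∂Pr := by
  have hfm : Measurable f := hf.mono predictablePoints_le le_rfl
  have hsf := hκ.isSFiniteKernel
  -- Restriction to a window makes both measures on the product space finite, as uniqueness on a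
  -- π-system requires. The windows exhaust the quadrant, and monotone convergence removes the
  -- restriction at the end.
  have hN : ∀ N, ∫⁻ ω, ∫⁻ p in window N, f (ω, p) ∂(κ ω) ∂Pr =
      ∫⁻ ω, ∫⁻ p in window N, f (ω, p) ∂(hawkesBaseMeasure ν) ∂Pr := by
    intro N
    let κN : Kernel Ω (ℝ × ℝ × ℝ) := hκ.kernel.restrict (measurableSet_window N)
    let M1 : Measure (Ω × (ℝ × ℝ × ℝ)) := Pr ⊗ₘ κN
    let M2 : Measure (Ω × (ℝ × ℝ × ℝ)) := Pr.prod ((hawkesBaseMeasure ν).restrict (window N))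
    have hfin2 : IsFiniteMeasure ((hawkesBaseMeasure ν).restrict (window N)) :=
      ⟨by rw [Measure.restrict_apply_univ]; exact hawkesBaseMeasure_window_lt_top ν N⟩
    have hS : ∀ (s : ℝ≥0) (A : Set Ω) (D : Set (ℝ × ℝ × ℝ)), MeasurableSet[𝓖 s] A →
        MeasurableSet D →
        M1 (A ×ˢ (D ∩ {p | (s : ℝ) < p.1})) = M2 (A ×ˢ (D ∩ {p | (s : ℝ) < p.1})) := by
      intro s A D hA hD
      have hDm : MeasurableSet (D ∩ {p : ℝ × ℝ × ℝ | (s : ℝ) < p.1}) :=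
        hD.inter (measurable_fst measurableSet_Ioi)
      rw [Measure.compProd_apply_prod (𝓖.le s _ hA) hDm, Measure.prod_prod,
        Measure.restrict_apply hDm, ← hκ.compensated s N D hD A hA]
      refine lintegral_congr fun ω => ?_
      rw [Kernel.restrict_apply, Measure.restrict_apply hDm]
      rfl
    -- Generators at nonpositive times miss the window, so both sides vanish.
    have hS0 : ∀ (A : Set Ω) (D : Set (ℝ × ℝ × ℝ)), MeasurableSet[𝓖 0] A → MeasurableSet D →
        M1 (A ×ˢ (D ∩ {p | p.1 ≤ 0})) = M2 (A ×ˢ (D ∩ {p | p.1 ≤ 0})) := by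
      intro A D hA hD
      have hDm : MeasurableSet (D ∩ {p : ℝ × ℝ × ℝ | p.1 ≤ 0}) :=
        hD.inter (measurable_fst measurableSet_Iic)
      have hemp : D ∩ {p : ℝ × ℝ × ℝ | p.1 ≤ 0} ∩ window N = ∅ := by
        ext p
        simp only [window, mem_inter_iff, mem_ofPred_eq, mem_prod, mem_Ioc, mem_empty_iff_false,
          iff_false]
        rintro ⟨⟨-, h1⟩, ⟨h2, -⟩, -⟩
        exact absurd h2 (not_lt.2 h1)
      rw [Measure.compProd_apply_prod (𝓖.le 0 _ hA) hDm, Measure.prod_prod,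
        Measure.restrict_apply hDm, hemp]
      simp only [κN, Kernel.restrict_apply, Measure.restrict_apply hDm, hemp]
      simp
    have huniv : M1 univ = M2 univ := by
      have hu : (univ : Set (Ω × (ℝ × ℝ × ℝ))) =
          univ ×ˢ (univ ∩ {p | ((0 : ℝ≥0) : ℝ) < p.1}) ∪ univ ×ˢ (univ ∩ {p | p.1 ≤ 0}) := by
        ext x
        simp only [mem_univ, univ_inter, mem_union, mem_prod, mem_ofPred_eq, true_and,
          NNReal.coe_zero, true_iff]
        exact lt_or_ge _ _
      have hd : Disjoint
          ((univ : Set Ω) ×ˢ (univ ∩ {p : ℝ × ℝ × ℝ | ((0 : ℝ≥0) : ℝ) < p.1}))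
          (univ ×ˢ (univ ∩ {p | p.1 ≤ 0})) := by
        refine Set.disjoint_left.2 fun x hx hx' => ?_
        exact absurd (show ((0 : ℝ≥0) : ℝ) < x.2.1 from hx.2.2)
          (not_lt.2 (show x.2.1 ≤ 0 from hx'.2.2))
      have hm : MeasurableSet ((univ : Set Ω) ×ˢ (univ ∩ {p : ℝ × ℝ × ℝ | p.1 ≤ 0})) :=
        MeasurableSet.univ.prod (MeasurableSet.univ.inter (measurable_fst measurableSet_Iic))
      rw [hu, measure_union hd hm, measure_union hd hm,
        hS 0 univ univ MeasurableSet.univ MeasurableSet.univ,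
        hS0 univ univ MeasurableSet.univ MeasurableSet.univ]
    have hM2fin : IsFiniteMeasure M2 := inferInstance
    have hM1fin : IsFiniteMeasure M1 := ⟨by rw [huniv]; exact measure_lt_top _ _⟩
    -- The two measures need agree only on the predictable σ-algebra, hence the trimming; a
    -- predictable integrand sees nothing more.
    have htrim : M1.trim predictablePoints_le = M2.trim (predictablePoints_le (𝓖 := 𝓖)) := by
      refine @ext_of_generate_finite _ (predictablePoints 𝓖) _ _ _ rfl
        (isPiSystem_predictablePoints 𝓖) (isFiniteMeasure_trim _) (fun S hSm => ?_) ?_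
      · have hSm' : MeasurableSet[predictablePoints 𝓖] S :=
          MeasurableSpace.measurableSet_generateFrom hSm
        rw [trim_measurableSet_eq _ hSm', trim_measurableSet_eq _ hSm']
        rcases hSm with ⟨s, A, D, hA, hD, rfl⟩ | ⟨A, D, hA, hD, rfl⟩
        · exact hS s A D hA hD
        · exact hS0 A D hA hD
      · rw [trim_measurableSet_eq _ MeasurableSet.univ, trim_measurableSet_eq _ MeasurableSet.univ,
          huniv]
    have h12 : ∫⁻ x, f x ∂M1 = ∫⁻ x, f x ∂M2 := by
      rw [← lintegral_trim predictablePoints_le hf, ← lintegral_trim predictablePoints_le hf, htrim]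
    rw [Measure.lintegral_compProd hfm, lintegral_prod _ hfm.aemeasurable] at h12
    simpa only [κN, Kernel.restrict_apply, hκ.kernel_apply] using h12
  have hmono : ∀ (Q : Ω → Measure (ℝ × ℝ × ℝ)) (ω : Ω),
      Monotone fun N => ∫⁻ p in window N, f (ω, p) ∂(Q ω) := fun Q ω N N' h =>
    lintegral_mono_set (window_mono h)
  simp_rw [fun ω => lintegral_eq_iSup_window (hκ.simple ω).compl_quadrant (fun p => f (ω, p)),
    fun ω => lintegral_eq_iSup_window (hawkesBaseMeasure_compl_quadrant ν) (fun p => f (ω, p))]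
  rw [lintegral_iSup, lintegral_iSup]
  · simp_rw [hN]
  · intro N
    exact hfm.lintegral_prod_right'
  · exact fun N N' h ω => hmono (fun _ => hawkesBaseMeasure ν) ω h
  · intro N
    have : ∀ ω, ∫⁻ p in window N, f (ω, p) ∂(κ ω) =
        ∫⁻ p, (univ ×ˢ window N).indicator f (ω, p) ∂(κ ω) := fun ω => by
      rw [← lintegral_indicator (measurableSet_window N)]
      refine lintegral_congr fun p => ?_
      by_cases hp : p ∈ window N <;> simp [hp]
    simp_rw [this]
    exact hκ.measurable_lintegral (hfm.indicator (MeasurableSet.univ.prod (measurableSet_window N)))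
  · exact fun N N' h ω => hmono κ ω h

/-- The compensation formula for integrands whose dependence on the mark factors out. -/
theorem lintegral_lintegral_mul_mark (hκ : IsCompensatedProcess Pr 𝓖 κ ν)
    {f : Ω → ℝ → ℝ → ℝ≥0∞}
    (hf : Measurable[predictablePoints 𝓖] fun x : Ω × (ℝ × ℝ × ℝ) => f x.1 x.2.1 x.2.2.1)
    {g : ℝ → ℝ≥0∞} (hg : Measurable g) :
    ∫⁻ ω, ∫⁻ p, f ω p.1 p.2.1 * g p.2.2 ∂(κ ω) ∂Pr =
      (∫⁻ s in Ioi 0, ∫⁻ ω, (∫⁻ θ in Ioi 0, f ω s θ) ∂Pr) * ∫⁻ y, g y ∂ν := by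
  have hfm : Measurable fun x : Ω × (ℝ × ℝ × ℝ) => f x.1 x.2.1 x.2.2.1 :=
    hf.mono predictablePoints_le le_rfl
  have hfm' : Measurable fun x : (Ω × ℝ) × ℝ => f x.1.1 x.1.2 x.2 :=
    hfm.comp (by fun_prop : Measurable fun x : (Ω × ℝ) × ℝ => (x.1.1, (x.1.2, (x.2, (0 : ℝ)))))
  have hg' : Measurable[predictablePoints 𝓖] fun x : Ω × (ℝ × ℝ × ℝ) => g x.2.2.2 :=
    (hg.comp (measurable_snd.comp measurable_snd)).comp measurable_predictablePoints_snd
  rw [hκ.lintegral_lintegral (f := fun x => f x.1 x.2.1 x.2.2.1 * g x.2.2.2) (hf.mul hg')]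
  have h1 : ∀ ω, ∫⁻ p, f ω p.1 p.2.1 * g p.2.2 ∂(hawkesBaseMeasure ν) =
      (∫⁻ s in Ioi 0, ∫⁻ θ in Ioi 0, f ω s θ) * ∫⁻ y, g y ∂ν := by
    intro ω
    have hω : Measurable fun q : ℝ × ℝ => f ω q.1 q.2 :=
      hfm'.comp (by fun_prop : Measurable fun q : ℝ × ℝ => ((ω, q.1), q.2))
    have hω1 : ∀ s, Measurable fun θ => f ω s θ := fun s => hω.comp measurable_prodMk_left
    rw [hawkesBaseMeasure, lintegral_prod]
    · have h2 : ∀ s : ℝ, ∫⁻ q, f ω s q.1 * g q.2 ∂((volume.restrict (Ioi (0 : ℝ))).prod ν) =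
          (∫⁻ θ in Ioi 0, f ω s θ) * ∫⁻ y, g y ∂ν := fun s =>
        lintegral_prod_mul (hω1 s).aemeasurable hg.aemeasurable
      simp_rw [h2]
      rw [lintegral_mul_const]
      exact hω.lintegral_prod_right'
    · refine Measurable.aemeasurable ?_
      exact (hω.comp (by fun_prop : Measurable fun p : ℝ × ℝ × ℝ => (p.1, p.2.1))).mul
        (hg.comp (measurable_snd.comp measurable_snd))
  simp_rw [h1]
  have h3 : Measurable fun x : Ω × ℝ => ∫⁻ θ in Ioi 0, f x.1 x.2 θ := hfm'.lintegral_prod_right'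
  rw [lintegral_mul_const _ (h3.lintegral_prod_right'), lintegral_lintegral_swap]
  exact h3.aemeasurable

end IsCompensatedProcess

/-! ### Acceptance under a level -/

/-- Indicator of the acceptance of height `θ` under the level `a`. -/
noncomputable def acceptance (a θ : ℝ) : ℝ≥0∞ := (Icc 0 a).indicator 1 θ

/-- Indicator of the heights accepted under exactly one of the levels `a` and `c`. -/
noncomputable def discrepancy (a c θ : ℝ) : ℝ≥0∞ := (symmDiff (Icc 0 a) (Icc 0 c)).indicator 1 θ

theorem lintegral_acceptance (a : ℝ) : ∫⁻ θ in Ioi 0, acceptance a θ = ENNReal.ofReal a := by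
  simp only [acceptance]
  rw [lintegral_indicator_one measurableSet_Icc, Measure.restrict_apply measurableSet_Icc]
  have : Icc 0 a ∩ Ioi 0 = Ioc 0 a := by
    ext x; simp only [mem_inter_iff, mem_Icc, mem_Ioi, mem_Ioc]
    constructor
    · exact fun h => ⟨h.2, h.1.2⟩
    · exact fun h => ⟨⟨h.1.le, h.2⟩, h.1⟩
  rw [this, Real.volume_Ioc, sub_zero]

/-- The heights in question lie in `(min a c, max a c]`. Equality can fail, since a negative level
accepts nothing. -/
theorem lintegral_discrepancy_le (a c : ℝ) :
    ∫⁻ θ in Ioi 0, discrepancy a c θ ≤ ENNReal.ofReal |a - c| := by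
  simp only [discrepancy]
  have hm : MeasurableSet (symmDiff (Icc 0 a) (Icc 0 c)) := measurableSet_Icc.symmDiff measurableSet_Icc
  rw [lintegral_indicator_one hm]
  refine (Measure.restrict_le_self _).trans ?_
  have : symmDiff (Icc 0 a) (Icc 0 c) ⊆ Ioc (min a c) (max a c) := by
    intro x hx
    rw [Set.mem_symmDiff] at hx
    simp only [mem_Icc, mem_Ioc, min_lt_iff, le_max_iff] at hx ⊢
    rcases hx with ⟨⟨h1, h2⟩, h3⟩ | ⟨⟨h1, h2⟩, h3⟩
    · exact ⟨Or.inr (not_le.1 fun h => h3 ⟨h1, h⟩), Or.inl h2⟩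
    · exact ⟨Or.inl (not_le.1 fun h => h3 ⟨h1, h⟩), Or.inr h2⟩
  refine (measure_mono this).trans_eq ?_
  rw [Real.volume_Ioc, max_sub_min_eq_abs']

theorem measurable_acceptance {α : Type*} {m : MeasurableSpace α} {a θ : α → ℝ} (ha : Measurable a)
    (hθ : Measurable θ) : Measurable fun x => acceptance (a x) (θ x) := by
  have : (fun x => acceptance (a x) (θ x)) = ({x | 0 ≤ θ x} ∩ {x | θ x ≤ a x}).indicator 1 := by
    ext x; simp only [acceptance, indicator]; rfl
  rw [this]
  exact measurable_one.indicator
    ((measurableSet_le measurable_const hθ).inter (measurableSet_le hθ ha))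

theorem discrepancy_eq (a c θ : ℝ) : discrepancy a c θ =
    (acceptance a θ - acceptance c θ) + (acceptance c θ - acceptance a θ) := by
  simp only [discrepancy, acceptance, indicator, Set.mem_symmDiff]
  by_cases h1 : θ ∈ Icc 0 a <;> by_cases h2 : θ ∈ Icc 0 c <;> simp [h1, h2]

theorem measurable_discrepancy {α : Type*} {m : MeasurableSpace α} {a c θ : α → ℝ}
    (ha : Measurable a) (hc : Measurable c) (hθ : Measurable θ) :
    Measurable fun x => discrepancy (a x) (c x) (θ x) := by
  simp_rw [discrepancy_eq]
  exact ((measurable_acceptance ha hθ).sub (measurable_acceptance hc hθ)).add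
    ((measurable_acceptance hc hθ).sub (measurable_acceptance ha hθ))

namespace IsCompensatedProcess

variable {Ω : Type*} [mΩ : MeasurableSpace Ω] {Pr : Measure Ω} [IsProbabilityMeasure Pr]
  {𝓖 : Filtration ℝ≥0 mΩ} {κ : Ω → Measure (ℝ × ℝ × ℝ)} {ν : Measure ℝ} [IsProbabilityMeasure ν]

/-- Mean of an integral over the points accepted under a predictable level `a`, with a predictable
weight `w` and a function `g` of the mark. -/
theorem lintegral_acceptance_eq (hκ : IsCompensatedProcess Pr 𝓖 κ ν) {w : Ω → ℝ → ℝ≥0∞}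
    {a : Ω → ℝ → ℝ}
    (hw : Measurable[predictablePoints 𝓖] fun x : Ω × (ℝ × ℝ × ℝ) => w x.1 x.2.1)
    (ha : Measurable[predictablePoints 𝓖] fun x : Ω × (ℝ × ℝ × ℝ) => a x.1 x.2.1)
    {g : ℝ → ℝ≥0∞} (hg : Measurable g) :
    ∫⁻ ω, ∫⁻ p, w ω p.1 * acceptance (a ω p.1) p.2.1 * g p.2.2 ∂(κ ω) ∂Pr =
      (∫⁻ s in Ioi 0, ∫⁻ ω, w ω s * ENNReal.ofReal (a ω s) ∂Pr) * ∫⁻ y, g y ∂ν := by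
  have hθ : Measurable[predictablePoints 𝓖] fun x : Ω × (ℝ × ℝ × ℝ) => x.2.2.1 :=
    (measurable_fst.comp measurable_snd).comp measurable_predictablePoints_snd
  rw [hκ.lintegral_lintegral_mul_mark (f := fun ω s θ => w ω s * acceptance (a ω s) θ)
    (hw.mul (measurable_acceptance ha hθ)) hg]
  congr 1
  refine lintegral_congr fun s => lintegral_congr fun ω => ?_
  rw [lintegral_const_mul _ (measurable_acceptance measurable_const measurable_id'),
    lintegral_acceptance]

/-- The coupling inequality: a point accepted under only one of two predictable levels has its
height between them, so the mean number of such points is controlled by the L¹ distance of the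
levels. -/
theorem lintegral_discrepancy_le (hκ : IsCompensatedProcess Pr 𝓖 κ ν) {w : Ω → ℝ → ℝ≥0∞}
    {a c : Ω → ℝ → ℝ}
    (hw : Measurable[predictablePoints 𝓖] fun x : Ω × (ℝ × ℝ × ℝ) => w x.1 x.2.1)
    (ha : Measurable[predictablePoints 𝓖] fun x : Ω × (ℝ × ℝ × ℝ) => a x.1 x.2.1)
    (hc : Measurable[predictablePoints 𝓖] fun x : Ω × (ℝ × ℝ × ℝ) => c x.1 x.2.1)
    {g : ℝ → ℝ≥0∞} (hg : Measurable g) :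
    ∫⁻ ω, ∫⁻ p, w ω p.1 * discrepancy (a ω p.1) (c ω p.1) p.2.1 * g p.2.2 ∂(κ ω) ∂Pr ≤
      (∫⁻ s in Ioi 0, ∫⁻ ω, w ω s * ENNReal.ofReal |a ω s - c ω s| ∂Pr) * ∫⁻ y, g y ∂ν := by
  have hθ : Measurable[predictablePoints 𝓖] fun x : Ω × (ℝ × ℝ × ℝ) => x.2.2.1 :=
    (measurable_fst.comp measurable_snd).comp measurable_predictablePoints_snd
  rw [hκ.lintegral_lintegral_mul_mark (f := fun ω s θ => w ω s * discrepancy (a ω s) (c ω s) θ)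
    (hw.mul (measurable_discrepancy ha hc hθ)) hg]
  gcongr with s ω
  rw [lintegral_const_mul _ (measurable_discrepancy measurable_const measurable_const measurable_id')]
  gcongr
  exact _root_.lintegral_discrepancy_le _ _

end IsCompensatedProcess

/-! ### Integrals over accepted points -/

theorem measurableSet_acceptedPoints {J : Set ℝ} (hJ : MeasurableSet J) {ℓ : ℝ → ℝ}
    (hℓ : Measurable ℓ) : MeasurableSet (acceptedPoints J ℓ) := by
  have hθ : Measurable fun p : ℝ × ℝ × ℝ => p.2.1 := by fun_prop
  exact (measurable_fst hJ).inter ((measurableSet_le measurable_const hθ).inter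
    (measurableSet_le hθ (hℓ.comp measurable_fst)))

/-- Turns a random domain of integration into a product of factors in time, height and mark, the
form to which the compensation formula applies. -/
theorem acceptance_eq_indicator {J : Set ℝ} {ℓ : ℝ → ℝ} (f : ℝ × ℝ × ℝ → ℝ≥0∞)
    (p : ℝ × ℝ × ℝ) : J.indicator 1 p.1 * acceptance (ℓ p.1) p.2.1 * f p =
      (acceptedPoints J ℓ).indicator f p := by
  by_cases hJ : p.1 ∈ J <;> by_cases hθ : p.2.1 ∈ Icc 0 (ℓ p.1)
  · have : p ∈ acceptedPoints J ℓ := ⟨hJ, hθ.1, hθ.2⟩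
    simp [acceptance, hJ, hθ, this]
  · have : p ∉ acceptedPoints J ℓ := fun h => hθ ⟨h.2.1, h.2.2⟩
    simp [acceptance, hθ, this]
  · have : p ∉ acceptedPoints J ℓ := fun h => hJ h.1
    simp [hJ, this]
  · have : p ∉ acceptedPoints J ℓ := fun h => hJ h.1
    simp [hJ, this]

theorem setLIntegral_acceptedPoints {Q : Measure (ℝ × ℝ × ℝ)} {J : Set ℝ} (hJ : MeasurableSet J)
    {ℓ : ℝ → ℝ} (hℓ : Measurable ℓ) (f : ℝ × ℝ × ℝ → ℝ≥0∞) :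
    ∫⁻ p in acceptedPoints J ℓ, f p ∂Q =
      ∫⁻ p, J.indicator 1 p.1 * acceptance (ℓ p.1) p.2.1 * f p ∂Q := by
  rw [← lintegral_indicator (measurableSet_acceptedPoints hJ hℓ)]
  exact lintegral_congr fun p => (acceptance_eq_indicator f p).symm

theorem setLIntegral_time_lt {Q : Measure (ℝ × ℝ × ℝ)} (t : ℝ) (f : ℝ × ℝ × ℝ → ℝ≥0∞) :
    ∫⁻ p in {p | p.1 < t}, f p ∂Q = ∫⁻ p, {p : ℝ × ℝ × ℝ | p.1 < t}.indicator f p ∂Q :=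
  (lintegral_indicator (measurable_fst measurableSet_Iio) f).symm

/-- Finite mass means finitely many atoms, so no integrability of `f` against the intensity measure
is needed. -/
theorem IsSimpleConfiguration.setLIntegral_lt_top {Q : Measure (ℝ × ℝ × ℝ)}
    (hQ : IsSimpleConfiguration Q) {S : Set (ℝ × ℝ × ℝ)} (hS : MeasurableSet S) (hfin : Q S < ∞)
    {f : ℝ × ℝ × ℝ → ℝ≥0∞} (hf : Measurable f) (hf' : ∀ p, f p < ∞) :
    ∫⁻ p in S, f p ∂Q < ∞ := by
  obtain ⟨I, x, rfl⟩ := hQ.atoms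
  rw [Measure.sum_apply _ hS] at hfin
  have h1 : ∀ i : I, Measure.dirac (x i) S = S.indicator 1 (x i) := fun i =>
    Measure.dirac_apply' _ hS
  simp_rw [h1] at hfin
  have hfinite : {i : I | x i ∈ S}.Finite := by
    refine (ENNReal.finite_const_le_of_tsum_ne_top hfin.ne (one_ne_zero)).subset fun i hi => ?_
    have hi' : x i ∈ S := hi
    simp [hi']
  rw [← lintegral_indicator hS, lintegral_sum_measure]
  simp_rw [lintegral_dirac' _ (hf.indicator hS)]
  rw [tsum_eq_sum (s := hfinite.toFinset)]
  · refine ENNReal.sum_lt_top.2 fun i _ => ?_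
    refine lt_of_le_of_lt (indicator_le_self' (fun _ _ => zero_le) _) (hf' _)
  · intro i hi
    have : x i ∉ S := by simpa using hi
    simp [this]

/-- Integrals of real functions over finitely many atoms converge absolutely. -/
theorem IsSimpleConfiguration.integrableOn {Q : Measure (ℝ × ℝ × ℝ)}
    (hQ : IsSimpleConfiguration Q) {S : Set (ℝ × ℝ × ℝ)} (hS : MeasurableSet S) (hfin : Q S < ∞)
    {f : ℝ × ℝ × ℝ → ℝ} (hf : Measurable f) : IntegrableOn f S Q :=
  ⟨hf.aestronglyMeasurable, hQ.setLIntegral_lt_top hS hfin hf.enorm fun _ => enorm_lt_top⟩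

theorem LipschitzWith.ofReal_abs_sub_le {L : ℝ≥0} {ψ : ℝ → ℝ} (hψ : LipschitzWith L ψ) (x y : ℝ) :
    ENNReal.ofReal |ψ x - ψ y| ≤ L * ENNReal.ofReal |x - y| := by
  have := hψ x y
  rwa [edist_dist, edist_dist, Real.dist_eq, Real.dist_eq] at this

/-- Absorption of the feedback term, which is legitimate only for finite `S`. The truncations and
crude bounds further down serve to provide `S ≠ ∞`. -/
theorem ENNReal.le_div_of_le_add_mul {S c : ℝ≥0∞} {ρ : ℝ} (hρ0 : 0 ≤ ρ) (hρ : ρ < 1) (hS : S ≠ ∞)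
    (h : S ≤ c + ENNReal.ofReal ρ * S) : S ≤ c / ENNReal.ofReal (1 - ρ) := by
  have hpos : 0 < 1 - ρ := by linarith
  rw [ENNReal.le_div_iff_mul_le (Or.inl (by simpa using hpos)) (Or.inl (by simp))]
  have h1 : S * ENNReal.ofReal (1 - ρ) + ENNReal.ofReal ρ * S = S := by
    rw [mul_comm (ENNReal.ofReal ρ), ← mul_add, ← ENNReal.ofReal_add hpos.le hρ0]
    simp
  have h2 : ENNReal.ofReal ρ * S ≠ ∞ := ENNReal.mul_ne_top (by simp) hS
  rw [← h1] at h
  nth_rewrite 2 [h1] at h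
  exact (ENNReal.add_le_add_iff_right h2).1 h

/-! ### The mean intensity of the Hawkes process -/

/-- A predictable level `a` that solves the Hawkes equation driven by `κ` on `[0,T]`. -/
structure IsThinnedHawkes {Ω : Type*} [mΩ : MeasurableSpace Ω] (Pr : Measure Ω)
    (𝓖 : Filtration ℝ≥0 mΩ) (κ : Ω → Measure (ℝ × ℝ × ℝ)) (h ψ b : ℝ → ℝ) (T : ℝ)
    (a : Ω → ℝ → ℝ) : Prop where
  measurable : Measurable[predictablePoints 𝓖] fun x : Ω × (ℝ × ℝ × ℝ) => a x.1 x.2.1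
  finite : ∀ᵐ ω ∂Pr, κ ω (acceptedPoints (Ioc 0 T) (a ω)) < ∞
  eq : ∀ᵐ ω ∂Pr, ∀ t ∈ Icc (0 : ℝ) T,
    a ω t = ψ (∫ p in acceptedPoints (Ico 0 t) (a ω), h (t - p.1) * b p.2.2 ∂(κ ω))

section Mean

variable {Ω : Type*} [mΩ : MeasurableSpace Ω] {Pr : Measure Ω} [IsProbabilityMeasure Pr]
  {𝓖 : Filtration ℝ≥0 mΩ} {κ : Ω → Measure (ℝ × ℝ × ℝ)} {ν : Measure ℝ} [IsProbabilityMeasure ν]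
  {h ψ b : ℝ → ℝ} {T : ℝ} {a : Ω → ℝ → ℝ} {L : ℝ≥0}

theorem measurable_section_of_predictablePoints {β : Type*} [MeasurableSpace β] {a : Ω → ℝ → β}
    (ha : Measurable[predictablePoints 𝓖] fun x : Ω × (ℝ × ℝ × ℝ) => a x.1 x.2.1) :
    Measurable (fun x : Ω × ℝ => a x.1 x.2) :=
  (ha.mono predictablePoints_le le_rfl).comp
    (by fun_prop : Measurable fun x : Ω × ℝ => (x.1, (x.2, ((0 : ℝ), (0 : ℝ)))))

/-- The Hawkes equation integrates over `[0,t)` while finiteness is known on `(0,T]`; points of the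
quadrant have positive times, so the end point 0 is harmless. -/
theorem acceptedPoints_Ico_subset {t T : ℝ} (ℓ : ℝ → ℝ) (ht : t ≤ T) :
    acceptedPoints (Ico 0 t) ℓ ∩ quadrant ⊆ acceptedPoints (Ioc 0 T) ℓ :=
  fun _ hp => ⟨⟨hp.2.1, hp.1.1.2.le.trans ht⟩, hp.1.2⟩

/-- Comparing `ψ` with its value at 0 linearises the Hawkes equation, at the price of replacing `h`
by `|h|`. -/
theorem IsThinnedHawkes.ofReal_le (hψ : LipschitzWith L ψ) (hb : ∀ y, 0 ≤ b y)
    (ha : IsThinnedHawkes Pr 𝓖 κ h ψ b T a) :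
    ∀ᵐ ω ∂Pr, ∀ t ∈ Icc (0 : ℝ) T, ENNReal.ofReal (a ω t) ≤ ENNReal.ofReal (ψ 0) +
      L * ∫⁻ p in {p | p.1 < t}, ENNReal.ofReal |h (t - p.1)| *
        acceptance (a ω p.1) p.2.1 * ENNReal.ofReal (b p.2.2) ∂(κ ω) := by
  filter_upwards [ha.eq] with ω hω t ht
  set x := ∫ p in acceptedPoints (Ico 0 t) (a ω), h (t - p.1) * b p.2.2 ∂(κ ω) with hx
  have hℓ : Measurable (a ω) :=
    (measurable_section_of_predictablePoints ha.measurable).comp measurable_prodMk_left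
  have h1 : ENNReal.ofReal (a ω t) ≤ ENNReal.ofReal (ψ 0) + ENNReal.ofReal |ψ x - ψ 0| := by
    rw [hω t ht, ← hx]
    calc ENNReal.ofReal (ψ x) ≤ ENNReal.ofReal (ψ 0 + |ψ x - ψ 0|) :=
          ENNReal.ofReal_le_ofReal (by linarith [le_abs_self (ψ x - ψ 0)])
      _ ≤ _ := ENNReal.ofReal_add_le
  refine h1.trans (add_le_add le_rfl ((hψ.ofReal_abs_sub_le x 0).trans ?_))
  gcongr
  rw [sub_zero, ← Real.enorm_eq_ofReal_abs, hx]
  refine (enorm_integral_le_lintegral_enorm _).trans ?_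
  rw [setLIntegral_acceptedPoints measurableSet_Ico hℓ,
    setLIntegral_time_lt]
  refine lintegral_mono fun p => ?_
  by_cases hp : p ∈ {p : ℝ × ℝ × ℝ | p.1 < t}
  · rw [indicator_of_mem hp, enorm_mul, Real.enorm_eq_ofReal_abs, Real.enorm_eq_ofReal (hb _)]
    calc _ ≤ 1 * acceptance (a ω p.1) p.2.1 *
          (ENNReal.ofReal |h (t - p.1)| * ENNReal.ofReal (b p.2.2)) := by
          gcongr
          exact indicator_le_self' (fun _ _ => zero_le) _
      _ = _ := by ring
  · have : p.1 ∉ Ico 0 t := fun hp' => hp hp'.2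
    simp [this]

/-- A nondecreasing majorant of the Hawkes intensity, when `|h| ≤ H` and `c` is the value at `0`
of the jump rate. -/
noncomputable def hawkesMajorant (κ : Ω → Measure (ℝ × ℝ × ℝ)) (b : ℝ → ℝ) (a : Ω → ℝ → ℝ)
    (L : ℝ≥0) (c H : ℝ) (ω : Ω) (t : ℝ) : ℝ≥0∞ :=
  ENNReal.ofReal c + L * (ENNReal.ofReal H *
    ∫⁻ p in {p | p.1 < t}, acceptance (a ω p.1) p.2.1 * ENNReal.ofReal (b p.2.2) ∂(κ ω))

theorem measurable_hawkesMajorant (hκ : IsCompensatedProcess Pr 𝓖 κ ν) (hb_meas : Measurable b)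
    (ha : Measurable[predictablePoints 𝓖] fun x : Ω × (ℝ × ℝ × ℝ) => a x.1 x.2.1) (c H : ℝ) :
    Measurable[predictablePoints 𝓖] fun x : Ω × (ℝ × ℝ × ℝ) =>
      hawkesMajorant κ b a L c H x.1 x.2.1 := by
  have hθ : Measurable[predictablePoints 𝓖] fun x : Ω × (ℝ × ℝ × ℝ) => x.2.2.1 :=
    (measurable_fst.comp measurable_snd).comp measurable_predictablePoints_snd
  have hy : Measurable[predictablePoints 𝓖] fun x : Ω × (ℝ × ℝ × ℝ) => x.2.2.2 :=
    (measurable_snd.comp measurable_snd).comp measurable_predictablePoints_snd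
  exact ((hκ.measurable_lintegral_lt ((measurable_acceptance ha hθ).mul
    (hb_meas.ennreal_ofReal.comp hy))).const_mul _ |>.const_mul _).const_add _

theorem hawkesMajorant_mono (c H : ℝ) (ω : Ω) : Monotone (hawkesMajorant κ b a L c H ω) :=
  fun t t' htt' => by
    simp only [hawkesMajorant]
    gcongr

/-- Only finitely many points are accepted up to `T`, so the majorant is finite along almost every
path although nothing is known yet about its mean. -/
theorem IsThinnedHawkes.hawkesMajorant_lt_top (hκ : IsCompensatedProcess Pr 𝓖 κ ν)
    (hb_meas : Measurable b) (ha : IsThinnedHawkes Pr 𝓖 κ h ψ b T a) (c H : ℝ) :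
    ∀ᵐ ω ∂Pr, ∀ t ≤ T, hawkesMajorant κ b a L c H ω t < ∞ := by
  filter_upwards [ha.finite] with ω hω t ht
  have hℓ : Measurable (a ω) :=
    (measurable_section_of_predictablePoints ha.measurable).comp measurable_prodMk_left
  have h1 : ∫⁻ p in {p | p.1 < t}, acceptance (a ω p.1) p.2.1 * ENNReal.ofReal (b p.2.2) ∂(κ ω)
      ≤ ∫⁻ p in acceptedPoints (Ioc 0 T) (a ω), ENNReal.ofReal (b p.2.2) ∂(κ ω) := by
    rw [setLIntegral_acceptedPoints measurableSet_Ioc hℓ, setLIntegral_time_lt]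
    have h0 : ∀ᵐ q ∂(κ ω), q ∈ quadrant := (hκ.simple ω).compl_quadrant
    refine lintegral_mono_ae ?_
    filter_upwards [h0] with p hp
    by_cases hpt : p ∈ {p : ℝ × ℝ × ℝ | p.1 < t}
    · have : p.1 ∈ Ioc 0 T := ⟨hp.1, (show p.1 < t from hpt).le.trans ht⟩
      rw [indicator_of_mem hpt]
      simp [this]
    · rw [indicator_of_notMem hpt]; exact zero_le
  have h2 : ∫⁻ p in acceptedPoints (Ioc 0 T) (a ω), ENNReal.ofReal (b p.2.2) ∂(κ ω) < ∞ :=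
    (hκ.simple ω).setLIntegral_lt_top (measurableSet_acceptedPoints measurableSet_Ioc hℓ) hω
      (by fun_prop) (fun _ => ENNReal.ofReal_lt_top)
  have h3 := (h1.trans_lt h2).ne
  simp only [hawkesMajorant]
  finiteness

theorem IsThinnedHawkes.ofReal_le_hawkesMajorant (hψ : LipschitzWith L ψ) (hb : ∀ y, 0 ≤ b y)
    {H : ℝ} (hH : ∀ t, 0 ≤ t → |h t| ≤ H) (ha : IsThinnedHawkes Pr 𝓖 κ h ψ b T a) :
    ∀ᵐ ω ∂Pr, ∀ t ∈ Icc (0 : ℝ) T,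
      ENNReal.ofReal (a ω t) ≤ hawkesMajorant κ b a L (ψ 0) H ω t := by
  filter_upwards [ha.ofReal_le hψ hb] with ω hω t ht
  refine (hω t ht).trans ?_
  simp only [hawkesMajorant]
  gcongr
  rw [← lintegral_const_mul' _ _ (by simp)]
  refine setLIntegral_mono' (measurable_fst measurableSet_Iio) fun p hp => ?_
  have hp' : p.1 < t := hp
  rw [mul_assoc]
  gcongr
  exact hH _ (by linarith)

/-- The mean of the intensity on the event that the majorant `B` is at most `n`. -/
noncomputable def truncatedMean (Pr : Measure Ω) (a : Ω → ℝ → ℝ) (B : Ω → ℝ → ℝ≥0∞) (n : ℕ)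
    (t : ℝ) : ℝ≥0∞ :=
  ∫⁻ ω, {ω | B ω t ≤ n}.indicator 1 ω * ENNReal.ofReal (a ω t) ∂Pr

theorem measurable_truncation {B : Ω → ℝ → ℝ≥0∞}
    (hB : Measurable[predictablePoints 𝓖] fun x : Ω × (ℝ × ℝ × ℝ) => B x.1 x.2.1) (n : ℕ) :
    Measurable[predictablePoints 𝓖] fun x : Ω × (ℝ × ℝ × ℝ) =>
      {ω | B ω x.2.1 ≤ n}.indicator (1 : Ω → ℝ≥0∞) x.1 := by
  have h1 : MeasurableSet[predictablePoints 𝓖] {x : Ω × (ℝ × ℝ × ℝ) | B x.1 x.2.1 ≤ n} :=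
    hB measurableSet_Iic
  exact Measurable.indicator (@measurable_const ℝ≥0∞ _ _ (predictablePoints 𝓖) 1) h1

/-- On the event `B ω t ≤ n` the intensity itself is at most `n`; this is the a priori bound that
makes absorption possible. -/
theorem truncatedMean_le {B : Ω → ℝ → ℝ≥0∞} (n : ℕ) {t : ℝ}
    (h : ∀ᵐ ω ∂Pr, ENNReal.ofReal (a ω t) ≤ B ω t) : truncatedMean Pr a B n t ≤ n := by
  calc truncatedMean Pr a B n t ≤ ∫⁻ _, (n : ℝ≥0∞) ∂Pr := by
        refine lintegral_mono_ae ?_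
        filter_upwards [h] with ω hω
        by_cases hB : ω ∈ {ω | B ω t ≤ n}
        · rw [indicator_of_mem hB]
          simpa using hω.trans hB
        · rw [indicator_of_notMem hB]; simp
    _ = n := by simp

theorem iSup_truncatedMean
    (ha : Measurable[predictablePoints 𝓖] fun x : Ω × (ℝ × ℝ × ℝ) => a x.1 x.2.1)
    {B : Ω → ℝ → ℝ≥0∞}
    (hB : Measurable[predictablePoints 𝓖] fun x : Ω × (ℝ × ℝ × ℝ) => B x.1 x.2.1) {t : ℝ}
    (h : ∀ᵐ ω ∂Pr, B ω t < ∞) :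
    ∫⁻ ω, ENNReal.ofReal (a ω t) ∂Pr = ⨆ n, truncatedMean Pr a B n t := by
  simp only [truncatedMean]
  rw [← lintegral_iSup]
  · refine lintegral_congr_ae ?_
    filter_upwards [h] with ω hω
    obtain ⟨n, hn⟩ := ENNReal.exists_nat_gt hω.ne
    refine le_antisymm (le_iSup_of_le n ?_) (iSup_le fun n => ?_)
    · have : ω ∈ {ω | B ω t ≤ n} := hn.le
      rw [indicator_of_mem this]; simp
    · calc _ ≤ 1 * ENNReal.ofReal (a ω t) := by
            gcongr
            exact indicator_le_self' (fun _ _ => zero_le) _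
        _ = _ := one_mul _
  · intro n
    have h1 : Measurable fun ω => {ω | B ω t ≤ n}.indicator (1 : Ω → ℝ≥0∞) ω :=
      ((measurable_truncation hB n).mono predictablePoints_le le_rfl).comp
        (by fun_prop : Measurable fun ω : Ω => (ω, (t, ((0 : ℝ), (0 : ℝ)))))
    exact h1.mul ((measurable_section_of_predictablePoints ha).comp
      measurable_prodMk_right).ennreal_ofReal
  · intro n n' hn ω
    refine mul_le_mul_left (indicator_le_indicator_of_subset ?_ (fun _ => zero_le) _) _
    exact fun ω' (h : B ω' t ≤ n) => h.trans (by exact_mod_cast hn)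

/-- Convolution of `f` on `(0,t)` against a bounded function. -/
theorem lintegral_convolution_le {f : ℝ → ℝ≥0∞} (hf : Measurable f) {m : ℝ → ℝ≥0∞} {t T : ℝ}
    (ht : t ≤ T) {S : ℝ≥0∞} (hm : ∀ u ∈ Ioo 0 t, m u ≤ S) :
    ∫⁻ u in Ioo 0 t, f (t - u) * m u ≤ (∫⁻ u in Ioc 0 T, f u) * S := by
  have h1 : ∫⁻ u, (Ioo 0 t).indicator f (t - u) ≤ ∫⁻ u in Ioc 0 T, f u := by
    rw [lintegral_sub_left_eq_self (fun u => (Ioo 0 t).indicator f u) t,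
      lintegral_indicator measurableSet_Ioo]
    exact lintegral_mono_set fun u hu => ⟨hu.1, hu.2.le.trans ht⟩
  have hm' : Measurable fun u => (Ioo 0 t).indicator f (t - u) :=
    (hf.indicator measurableSet_Ioo).comp (by fun_prop : Measurable fun u : ℝ => t - u)
  refine le_trans ?_ (mul_le_mul_left h1 S)
  rw [← lintegral_mul_const _ hm', ← lintegral_indicator measurableSet_Ioo]
  refine lintegral_mono fun u => ?_
  by_cases hu : u ∈ Ioo 0 t
  · have hu' : t - u ∈ Ioo 0 t := ⟨by linarith [hu.2], by linarith [hu.1]⟩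
    rw [indicator_of_mem hu, indicator_of_mem hu']
    gcongr
    exact hm u hu
  · rw [indicator_of_notMem hu]; exact zero_le

/-- As `B` is nondecreasing, `B ω t ≤ n` implies `B ω u ≤ n` at every earlier `u`. The truncation at
`t` can therefore be moved inside the integral over the past as a predictable weight, and the
truncated means satisfy the same convolution inequality as the means would. -/
theorem IsThinnedHawkes.truncatedMean_le_add (hκ : IsCompensatedProcess Pr 𝓖 κ ν)
    (hψ : LipschitzWith L ψ) (hb_meas : Measurable b) (hb : ∀ y, 0 ≤ b y)
    (hh : Measurable h) (ha : IsThinnedHawkes Pr 𝓖 κ h ψ b T a) {B : Ω → ℝ → ℝ≥0∞}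
    (hBm : Measurable[predictablePoints 𝓖] fun x : Ω × (ℝ × ℝ × ℝ) => B x.1 x.2.1)
    (hBmono : ∀ ω, Monotone (B ω)) (n : ℕ) {t : ℝ} (ht : t ∈ Ioc 0 T) :
    truncatedMean Pr a B n t ≤ ENNReal.ofReal (ψ 0) +
      (L * (∫⁻ t in Ioc 0 T, ENNReal.ofReal |h t|) * ∫⁻ y, ENNReal.ofReal (b y) ∂ν) *
        ⨆ u ∈ Ioc 0 T, truncatedMean Pr a B n u := by
  set S := ⨆ u ∈ Ioc 0 T, truncatedMean Pr a B n u with hS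
  let w : Ω → ℝ → ℝ≥0∞ := fun ω u => (Iio t).indicator (fun u => ENNReal.ofReal |h (t - u)|) u *
    {ω | B ω u ≤ n}.indicator 1 ω
  have hk : Measurable ((Iio t).indicator (fun u => ENNReal.ofReal |h (t - u)|)) :=
    (Measurable.ennreal_ofReal (by fun_prop)).indicator measurableSet_Iio
  have hwm : Measurable[predictablePoints 𝓖] fun x : Ω × (ℝ × ℝ × ℝ) => w x.1 x.2.1 :=
    (hk.comp measurable_predictablePoints_time).mul (measurable_truncation hBm n)
  have hconv : ∫⁻ u in Ioi 0, ∫⁻ ω, w ω u * ENNReal.ofReal (a ω u) ∂Pr ≤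
      (∫⁻ u in Ioc 0 T, ENNReal.ofReal |h u|) * S := by
    refine le_trans ?_ (lintegral_convolution_le (f := fun u => ENNReal.ofReal |h u|)
      (Measurable.ennreal_ofReal (by fun_prop)) ht.2 (m := truncatedMean Pr a B n) (S := S) ?_)
    · rw [← lintegral_indicator measurableSet_Ioi, ← lintegral_indicator measurableSet_Ioo]
      refine lintegral_mono fun u => ?_
      by_cases hu0 : u ∈ Ioi (0 : ℝ)
      · rw [indicator_of_mem hu0]
        by_cases hut : u ∈ Iio t
        · rw [indicator_of_mem (show u ∈ Ioo 0 t from ⟨hu0, hut⟩)]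
          simp only [w, indicator_of_mem hut, mul_assoc]
          rw [lintegral_const_mul' _ _ (by simp)]
          exact le_rfl
        · simp [w, indicator_of_notMem hut]
      · rw [indicator_of_notMem hu0]; exact zero_le
    · exact fun u hu => le_iSup₂_of_le (f := fun u (_ : u ∈ Ioc 0 T) => truncatedMean Pr a B n u) u
        ⟨hu.1, hu.2.le.trans ht.2⟩ le_rfl
  calc truncatedMean Pr a B n t ≤ ∫⁻ ω, (ENNReal.ofReal (ψ 0) + L * ∫⁻ p, w ω p.1 *
        acceptance (a ω p.1) p.2.1 * ENNReal.ofReal (b p.2.2) ∂(κ ω)) ∂Pr := by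
        refine lintegral_mono_ae ?_
        filter_upwards [ha.ofReal_le hψ hb] with ω hω
        by_cases hB : ω ∈ {ω | B ω t ≤ n}
        · rw [indicator_of_mem hB, Pi.one_apply, one_mul]
          refine (hω t ⟨ht.1.le, ht.2⟩).trans ?_
          rw [setLIntegral_time_lt]
          gcongr with p
          by_cases hp : p ∈ {p : ℝ × ℝ × ℝ | p.1 < t}
          · have hp' : p.1 ∈ Iio t := hp
            have hBp : ω ∈ {ω | B ω p.1 ≤ n} :=
              (hBmono ω (show p.1 ≤ t from le_of_lt hp)).trans hB
            simp [w, indicator_of_mem hp, hp', indicator_of_mem hBp]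
          · rw [indicator_of_notMem hp]; exact zero_le
        · rw [indicator_of_notMem hB]; simp
    _ = ENNReal.ofReal (ψ 0) + L * ((∫⁻ u in Ioi 0, ∫⁻ ω, w ω u * ENNReal.ofReal (a ω u) ∂Pr) *
          ∫⁻ y, ENNReal.ofReal (b y) ∂ν) := by
        rw [lintegral_add_left measurable_const, lintegral_const_mul' _ _ (by simp),
          hκ.lintegral_acceptance_eq hwm ha.measurable hb_meas.ennreal_ofReal]
        simp
    _ ≤ ENNReal.ofReal (ψ 0) + L * (((∫⁻ u in Ioc 0 T, ENNReal.ofReal |h u|) * S) *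
          ∫⁻ y, ENNReal.ofReal (b y) ∂ν) := by gcongr
    _ = _ := by ring

/-- The mean intensity of a stable Hawkes process is at most `ψ(0) / (1 - ρ)`. -/
theorem IsThinnedHawkes.lintegral_le (hκ : IsCompensatedProcess Pr 𝓖 κ ν)
    (hψ : LipschitzWith L ψ) (hb_meas : Measurable b) (hb : ∀ y, 0 ≤ b y)
    (hh : Measurable h) {H : ℝ} (hH : ∀ t, 0 ≤ t → |h t| ≤ H) {ρ : ℝ} (hρ0 : 0 ≤ ρ) (hρ : ρ < 1)
    (hstab : L * (∫⁻ t in Ioc 0 T, ENNReal.ofReal |h t|) * ∫⁻ y, ENNReal.ofReal (b y) ∂ν ≤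
      ENNReal.ofReal ρ)
    (ha : IsThinnedHawkes Pr 𝓖 κ h ψ b T a) {s : ℝ} (hs : s ∈ Ioc 0 T) :
    ∫⁻ ω, ENNReal.ofReal (a ω s) ∂Pr ≤ ENNReal.ofReal (ψ 0) / ENNReal.ofReal (1 - ρ) := by
  set B := hawkesMajorant κ b a L (ψ 0) H with hBdef
  have hBm : Measurable[predictablePoints 𝓖] fun x : Ω × (ℝ × ℝ × ℝ) => B x.1 x.2.1 :=
    measurable_hawkesMajorant hκ hb_meas ha.measurable _ _
  have haB := ha.ofReal_le_hawkesMajorant hψ hb hH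
  have hBfin : ∀ᵐ ω ∂Pr, B ω s < ∞ := by
    filter_upwards [ha.hawkesMajorant_lt_top hκ hb_meas (L := L) (ψ 0) H] with ω hω
    exact hω s hs.2
  rw [iSup_truncatedMean ha.measurable hBm hBfin]
  refine iSup_le fun n => ?_
  have hle : ∀ t ∈ Ioc 0 T, truncatedMean Pr a B n t ≤ n := fun t ht => truncatedMean_le n (by
    filter_upwards [haB] with ω hω
    exact hω t ⟨ht.1.le, ht.2⟩)
  -- Finite for each `n`, so the feedback is absorbed with a bound free of `n`; the supremum over
  -- `n` has already replaced the mean, by monotone convergence.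
  have hSfin : ⨆ u ∈ Ioc 0 T, truncatedMean Pr a B n u ≠ ∞ :=
    ((iSup₂_le hle).trans_lt (ENNReal.natCast_lt_top n)).ne
  refine (le_iSup₂_of_le (f := fun u (_ : u ∈ Ioc 0 T) => truncatedMean Pr a B n u) s hs
    le_rfl).trans (ENNReal.le_div_of_le_add_mul hρ0 hρ hSfin (iSup₂_le fun t ht => ?_))
  refine (ha.truncatedMean_le_add hκ hψ hb_meas hb hh hBm (hawkesMajorant_mono _ _) n ht).trans ?_
  gcongr

end Mean

/-! ### Time bins -/

theorem measurableSet_timeBin (Δ : ℝ) (n : ℕ) : MeasurableSet (timeBin Δ n) := measurableSet_Ioc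

theorem volume_timeBin (Δ : ℝ) (n : ℕ) : volume (timeBin Δ n) = ENNReal.ofReal Δ := by
  rw [timeBin, Real.volume_Ioc]
  congr 1
  ring

/-- Bins closed on the right correspond to ceilings, whereas `gridError` is written with floors;
`ae_ceil_eq_floor_add_one` reconciles the two. -/
theorem mem_timeBin_iff {Δ : ℝ} (hΔ : 0 < Δ) {n : ℕ} {s : ℝ} :
    s ∈ timeBin Δ n ↔ ⌈s / Δ⌉ = n := by
  rw [timeBin, mem_Ioc, Int.ceil_eq_iff, lt_div_iff₀ hΔ, div_le_iff₀ hΔ]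
  simp

theorem disjoint_timeBin {Δ : ℝ} (hΔ : 0 < Δ) {m n : ℕ} (h : m ≠ n) :
    Disjoint (timeBin Δ m) (timeBin Δ n) :=
  Set.disjoint_left.2 fun s hs hs' => h (by
    rw [mem_timeBin_iff hΔ] at hs hs'
    exact_mod_cast hs.symm.trans hs')

theorem exists_mem_timeBin {Δ : ℝ} (hΔ : 0 < Δ) {M : ℕ} {s : ℝ} (hs : s ∈ Ioc 0 (M * Δ)) :
    ∃ n ∈ Finset.Icc 1 M, s ∈ timeBin Δ n := by
  have h1 : 0 < ⌈s / Δ⌉ := Int.ceil_pos.2 (div_pos hs.1 hΔ)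
  have h2 : ⌈s / Δ⌉ ≤ M := Int.ceil_le.2 (by rw [div_le_iff₀ hΔ]; exact_mod_cast hs.2)
  refine ⟨⌈s / Δ⌉.toNat, Finset.mem_Icc.2 ⟨by omega, by omega⟩, ?_⟩
  rw [mem_timeBin_iff hΔ]
  omega

theorem timeBin_subset {Δ : ℝ} (hΔ : 0 < Δ) {M n : ℕ} (hn : n ∈ Finset.Icc 1 M) :
    timeBin Δ n ⊆ Ioc 0 (M * Δ) := by
  intro s hs
  have h1 : (1 : ℝ) ≤ n := by exact_mod_cast (Finset.mem_Icc.1 hn).1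
  have h2 : (n : ℝ) ≤ M := by exact_mod_cast (Finset.mem_Icc.1 hn).2
  exact ⟨lt_of_le_of_lt (mul_nonneg (by linarith) hΔ.le) hs.1, hs.2.trans (by gcongr)⟩

/-! ### The discrete-time process -/

/-- The discrete intensity as a function of continuous time on `(0, MΔ]`. -/
noncomputable def stepIntensity (Q : Measure (ℝ × ℝ × ℝ)) (h ψ b : ℝ → ℝ) (Δ : ℝ) (M : ℕ)
    (s : ℝ) : ℝ :=
  ∑ k ∈ Finset.Icc 1 M, (timeBin Δ k).indicator (fun _ => discreteIntensity Q h ψ b Δ k) s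

theorem stepIntensity_of_mem {Q : Measure (ℝ × ℝ × ℝ)} {h ψ b : ℝ → ℝ} {Δ : ℝ} (hΔ : 0 < Δ)
    {M n : ℕ} (hn : n ∈ Finset.Icc 1 M) {s : ℝ} (hs : s ∈ timeBin Δ n) :
    stepIntensity Q h ψ b Δ M s = discreteIntensity Q h ψ b Δ n := by
  rw [stepIntensity, Finset.sum_eq_single_of_mem n hn]
  · rw [indicator_of_mem hs]
  · intro k _ hk
    exact indicator_of_notMem (fun hs' => Set.disjoint_left.1 (disjoint_timeBin hΔ hk) hs' hs) _

theorem measurable_stepIntensity (Q : Measure (ℝ × ℝ × ℝ)) (h ψ b : ℝ → ℝ) (Δ : ℝ) (M : ℕ) :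
    Measurable (stepIntensity Q h ψ b Δ M) :=
  Finset.measurable_fun_sum _ fun k _ => measurable_const.indicator (measurableSet_timeBin Δ k)

section Discrete

variable {Q : Measure (ℝ × ℝ × ℝ)} {h ψ b : ℝ → ℝ} {Δ : ℝ}

/-- Within the quadrant, a constant level over times bounded above fits into a window. The discrete
process thus needs no finiteness assumption. -/
theorem IsSimpleConfiguration.acceptedPoints_const_lt_top (hQ : IsSimpleConfiguration Q)
    {J : Set ℝ} {B : ℝ} (hJ : J ⊆ Iic B) (l : ℝ) : Q (acceptedPoints J fun _ => l) < ∞ := by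
  obtain ⟨N, hN⟩ := exists_nat_ge (max B l)
  have hsub : acceptedPoints J (fun _ => l) ⊆ window N ∪ quadrantᶜ := by
    intro p hp
    by_cases hq : p ∈ quadrant
    · exact Or.inl ⟨⟨hq.1, (hJ hp.1).trans ((le_max_left _ _).trans hN)⟩,
        ⟨hp.2.1, hp.2.2.trans ((le_max_right _ _).trans hN)⟩, trivial⟩
    · exact Or.inr hq
  calc Q (acceptedPoints J fun _ => l) ≤ Q (window N) + Q quadrantᶜ :=
        (measure_mono hsub).trans (measure_union_le _ _)
    _ < ∞ := by rw [hQ.compl_quadrant, add_zero]; exact hQ.window_lt_top N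

theorem timeBin_subset_Iic (Δ : ℝ) (n : ℕ) : timeBin Δ n ⊆ Iic (n * Δ) := fun _ hs => hs.2

theorem discreteX_nonneg (hb : ∀ y, 0 ≤ b y) (n : ℕ) : 0 ≤ discreteX Q h ψ b Δ n := by
  cases n with
  | zero => rw [discreteX_zero]
  | succ n => rw [discreteX_succ]; exact integral_nonneg fun p => hb _

theorem discreteIntensity_nonneg (hψ : ∀ x, 0 ≤ ψ x) (n : ℕ) :
    0 ≤ discreteIntensity Q h ψ b Δ n := hψ _

theorem discreteX_eq {n : ℕ} (hn : 1 ≤ n) : discreteX Q h ψ b Δ n =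
    ∫ p in acceptedPoints (timeBin Δ n) (fun _ => discreteIntensity Q h ψ b Δ n), b p.2.2 ∂Q := by
  obtain ⟨n, rfl⟩ := Nat.exists_eq_add_of_le' hn
  exact discreteX_succ ..

theorem ofReal_discreteX (hQ : IsSimpleConfiguration Q) (hb_meas : Measurable b)
    (hb : ∀ y, 0 ≤ b y) {n : ℕ} (hn : 1 ≤ n) : ENNReal.ofReal (discreteX Q h ψ b Δ n) =
      ∫⁻ p, (timeBin Δ n).indicator 1 p.1 * acceptance (discreteIntensity Q h ψ b Δ n) p.2.1 *
        ENNReal.ofReal (b p.2.2) ∂Q := by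
  rw [discreteX_eq hn, ofReal_integral_eq_lintegral_ofReal,
    setLIntegral_acceptedPoints (measurableSet_timeBin Δ n) measurable_const]
  · exact hQ.integrableOn (measurableSet_acceptedPoints (measurableSet_timeBin Δ n) measurable_const)
      (hQ.acceptedPoints_const_lt_top (timeBin_subset_Iic Δ n) _) (by fun_prop)
  · exact Eventually.of_forall fun p => hb _

theorem ofReal_discreteIntensity_le {L : ℝ≥0} (hψ : LipschitzWith L ψ) (hb : ∀ y, 0 ≤ b y)
    (n : ℕ) : ENNReal.ofReal (discreteIntensity Q h ψ b Δ n) ≤ ENNReal.ofReal (ψ 0) +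
      L * ∑ k ∈ Finset.Ico 1 n, ENNReal.ofReal |h (((n : ℝ) - k) * Δ)| *
        ENNReal.ofReal (discreteX Q h ψ b Δ k) := by
  set x := ∑ k ∈ Finset.Ico 1 n, h (((n : ℝ) - k) * Δ) * discreteX Q h ψ b Δ k with hx
  have h1 : ENNReal.ofReal (ψ x) ≤ ENNReal.ofReal (ψ 0) + ENNReal.ofReal |ψ x - ψ 0| :=
    (ENNReal.ofReal_le_ofReal (by linarith [le_abs_self (ψ x - ψ 0)])).trans ENNReal.ofReal_add_le
  refine h1.trans (add_le_add le_rfl ((hψ.ofReal_abs_sub_le x 0).trans ?_))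
  gcongr
  rw [sub_zero, hx]
  refine (ENNReal.ofReal_le_ofReal (Finset.abs_sum_le_sum_abs _ _)).trans ?_
  rw [ENNReal.ofReal_sum_of_nonneg fun _ _ => abs_nonneg _]
  refine Finset.sum_le_sum fun k _ => ?_
  rw [abs_mul, ENNReal.ofReal_mul (abs_nonneg _), abs_of_nonneg (discreteX_nonneg hb k)]

end Discrete

/-! ### Adaptedness and means of the discrete process -/

section Adapted

variable {Ω : Type*} [mΩ : MeasurableSpace Ω] {Pr : Measure Ω} [IsProbabilityMeasure Pr]
  {𝓖 : Filtration ℝ≥0 mΩ} {κ : Ω → Measure (ℝ × ℝ × ℝ)} {ν : Measure ℝ} [IsProbabilityMeasure ν]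
  {h ψ b : ℝ → ℝ} {Δ : ℝ} {L : ℝ≥0}

theorem measurable_predictablePoints_height :
    Measurable[predictablePoints 𝓖] fun x : Ω × (ℝ × ℝ × ℝ) => x.2.2.1 :=
  (measurable_fst.comp measurable_snd).comp measurable_predictablePoints_snd

theorem measurable_predictablePoints_mark :
    Measurable[predictablePoints 𝓖] fun x : Ω × (ℝ × ℝ × ℝ) => x.2.2.2 :=
  (measurable_snd.comp measurable_snd).comp measurable_predictablePoints_snd

/-- Integrals over the points of one bin, accepted under a level known at its beginning. -/
theorem IsCompensatedProcess.measurable_lintegral_timeBin (hκ : IsCompensatedProcess Pr 𝓖 κ ν)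
    (hΔ : 0 < Δ) (n : ℕ) {l : Ω → ℝ} (hl : Measurable[𝓖 (n * Δ).toNNReal] l) {g : ℝ → ℝ≥0∞}
    (hg : Measurable g) :
    Measurable[𝓖 ((n + 1 : ℕ) * Δ).toNNReal] fun ω =>
      ∫⁻ p, (timeBin Δ (n + 1)).indicator 1 p.1 * acceptance (l ω) p.2.1 * g p.2.2 ∂(κ ω) := by
  -- A variable known at `nΔ` becomes predictable when cut off up to that time; the bin lies
  -- strictly after it, so the cut-off changes nothing.
  have hl' := measurable_predictablePoints_indicator hl
  have hbin : Measurable ((timeBin Δ (n + 1)).indicator (1 : ℝ → ℝ≥0∞)) :=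
    measurable_one.indicator (measurableSet_timeBin Δ (n + 1))
  have hm := hκ.measurable_lintegral_le_of_predictable ((n + 1 : ℕ) * Δ).toNNReal
    (((hbin.comp measurable_predictablePoints_time).mul
      (measurable_acceptance hl' measurable_predictablePoints_height)).mul
      (hg.comp measurable_predictablePoints_mark))
  convert! hm using 2 with ω
  have hset : MeasurableSet {p : ℝ × ℝ × ℝ | p.1 ≤ (((n + 1 : ℕ) * Δ).toNNReal : ℝ)} :=
    measurable_fst measurableSet_Iic
  rw [← lintegral_indicator hset]
  refine lintegral_congr fun p => ?_
  by_cases hp : p.1 ∈ timeBin Δ (n + 1)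
  · have h1 : p ∈ {p : ℝ × ℝ × ℝ | p.1 ≤ (((n + 1 : ℕ) * Δ).toNNReal : ℝ)} := by
      rw [mem_ofPred_eq, Real.coe_toNNReal _ (by positivity)]
      exact hp.2
    have h2 : (ω, p) ∈ {x : Ω × (ℝ × ℝ × ℝ) | ((n * Δ).toNNReal : ℝ) < x.2.1} := by
      rw [mem_ofPred_eq, Real.coe_toNNReal _ (by positivity)]
      have := hp.1
      push_cast at this
      linarith
    rw [indicator_of_mem h1]
    simp only [Pi.mul_apply, Function.comp_apply, indicator_of_mem h2]
  · rw [indicator_of_notMem hp, zero_mul, zero_mul]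
    refine (indicator_apply_eq_zero.2 fun _ => ?_).symm
    simp only [Pi.mul_apply, Function.comp_apply, indicator_of_notMem hp, zero_mul]

/-- The two claims carry each other: `l_{n+1}` is a function of `X_1, …, X_n`, and `X_{n+1}`
integrates over `(nΔ,(n+1)Δ]` under a level already known at `nΔ`. -/
theorem IsCompensatedProcess.measurable_discrete (hκ : IsCompensatedProcess Pr 𝓖 κ ν)
    (hΔ : 0 < Δ) (hψ : Measurable ψ) (hb_meas : Measurable b) (hb : ∀ y, 0 ≤ b y) (n : ℕ) :
    Measurable[𝓖 (n * Δ).toNNReal] (fun ω => discreteX (κ ω) h ψ b Δ n) ∧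
      Measurable[𝓖 (n * Δ).toNNReal] (fun ω => discreteIntensity (κ ω) h ψ b Δ (n + 1)) := by
  induction n using Nat.strong_induction_on with
  | _ n ih =>
    have hX : Measurable[𝓖 (n * Δ).toNNReal] (fun ω => discreteX (κ ω) h ψ b Δ n) := by
      cases n with
      | zero => simp only [discreteX_zero]; exact measurable_const
      | succ n =>
        have h1 := (hκ.measurable_lintegral_timeBin hΔ n (ih n n.lt_succ_self).2
          hb_meas.ennreal_ofReal).ennreal_toReal
        convert! h1 using 2 with ω
        rw [← ofReal_discreteX (hκ.simple ω) hb_meas hb (Nat.le_add_left 1 n),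
          ENNReal.toReal_ofReal (discreteX_nonneg hb _)]
    refine ⟨hX, ?_⟩
    have hXk : ∀ k ∈ Finset.Ico 1 (n + 1),
        Measurable[𝓖 (n * Δ).toNNReal] (fun ω => discreteX (κ ω) h ψ b Δ k) := by
      intro k hk
      have hkn := Finset.mem_Ico.1 hk
      rcases Nat.lt_or_eq_of_le (Nat.lt_succ_iff.1 hkn.2) with hlt | rfl
      · have hle : (k : ℝ) * Δ ≤ n * Δ := by gcongr
        exact (ih k hlt).1.mono (𝓖.mono (Real.toNNReal_le_toNNReal hle)) le_rfl
      · exact hX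
    simp only [discreteIntensity]
    exact hψ.comp (Finset.measurable_fun_sum _ fun k hk => (hXk k hk).const_mul _)

theorem IsCompensatedProcess.measurable_discreteIntensity (hκ : IsCompensatedProcess Pr 𝓖 κ ν)
    (hΔ : 0 < Δ) (hψ : Measurable ψ) (hb_meas : Measurable b) (hb : ∀ y, 0 ≤ b y) {k : ℕ}
    (hk : 1 ≤ k) : Measurable (fun ω => discreteIntensity (κ ω) h ψ b Δ k) := by
  obtain ⟨n, rfl⟩ := Nat.exists_eq_add_of_le' hk
  exact (hκ.measurable_discrete hΔ hψ hb_meas hb n).2.mono (𝓖.le _) le_rfl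

theorem IsCompensatedProcess.measurable_discreteX (hκ : IsCompensatedProcess Pr 𝓖 κ ν)
    (hΔ : 0 < Δ) (hψ : Measurable ψ) (hb_meas : Measurable b) (hb : ∀ y, 0 ≤ b y) (k : ℕ) :
    Measurable (fun ω => discreteX (κ ω) h ψ b Δ k) :=
  (hκ.measurable_discrete hΔ hψ hb_meas hb k).1.mono (𝓖.le _) le_rfl

/-- The intensity of a bin is known at its left end, which the bin excludes. -/
theorem IsCompensatedProcess.predictable_stepIntensity (hκ : IsCompensatedProcess Pr 𝓖 κ ν)
    (hΔ : 0 < Δ) (hψ : Measurable ψ) (hb_meas : Measurable b) (hb : ∀ y, 0 ≤ b y) (M : ℕ) :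
    Measurable[predictablePoints 𝓖] fun x : Ω × (ℝ × ℝ × ℝ) =>
      stepIntensity (κ x.1) h ψ b Δ M x.2.1 := by
  simp only [stepIntensity]
  refine Finset.measurable_fun_sum _ fun k hk => ?_
  obtain ⟨n, rfl⟩ := Nat.exists_eq_add_of_le' (Finset.mem_Icc.1 hk).1
  have h1 := measurable_predictablePoints_indicator (hκ.measurable_discrete (h := h) hΔ hψ hb_meas hb n).2
  have h2 : MeasurableSet[predictablePoints 𝓖] {x : Ω × (ℝ × ℝ × ℝ) | x.2.1 ∈ timeBin Δ (n + 1)} :=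
    measurable_predictablePoints_time (measurableSet_timeBin Δ (n + 1))
  convert! h1.indicator h2 using 2 with x
  by_cases hx : x ∈ {x : Ω × (ℝ × ℝ × ℝ) | x.2.1 ∈ timeBin Δ (n + 1)}
  · have h3 : x ∈ {x : Ω × (ℝ × ℝ × ℝ) | ((n * Δ).toNNReal : ℝ) < x.2.1} := by
      rw [mem_ofPred_eq, Real.coe_toNNReal _ (by positivity)]
      have := (show x.2.1 ∈ timeBin Δ (n + 1) from hx).1
      push_cast at this
      linarith
    rw [indicator_of_mem hx, indicator_of_mem h3,
      indicator_of_mem (show x.2.1 ∈ timeBin Δ (n + 1) from hx)]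
  · rw [indicator_of_notMem hx,
      indicator_of_notMem (show x.2.1 ∉ timeBin Δ (n + 1) from hx)]

/-- Mean of an integral over the points of the bin `k` accepted under the discrete intensity. -/
theorem IsCompensatedProcess.lintegral_timeBin (hκ : IsCompensatedProcess Pr 𝓖 κ ν)
    (hΔ : 0 < Δ) (hψ : Measurable ψ) (hb_meas : Measurable b) (hb : ∀ y, 0 ≤ b y) {k : ℕ}
    (hk : 1 ≤ k) {g : ℝ → ℝ≥0∞} (hg : Measurable g) :
    ∫⁻ ω, ∫⁻ p, (timeBin Δ k).indicator 1 p.1 *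
        acceptance (discreteIntensity (κ ω) h ψ b Δ k) p.2.1 * g p.2.2 ∂(κ ω) ∂Pr =
      ENNReal.ofReal Δ * (∫⁻ ω, ENNReal.ofReal (discreteIntensity (κ ω) h ψ b Δ k) ∂Pr) *
        ∫⁻ y, g y ∂ν := by
  have hkM : k ∈ Finset.Icc 1 k := Finset.mem_Icc.2 ⟨hk, le_rfl⟩
  have hbin : Measurable ((timeBin Δ k).indicator (1 : ℝ → ℝ≥0∞)) :=
    measurable_one.indicator (measurableSet_timeBin Δ k)
  have h1 := hκ.lintegral_acceptance_eq (w := fun _ s => (timeBin Δ k).indicator 1 s)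
    (a := fun ω s => stepIntensity (κ ω) h ψ b Δ k s)
    (hbin.comp measurable_predictablePoints_time)
    (hκ.predictable_stepIntensity (h := h) hΔ hψ hb_meas hb k) hg
  have h2 : ∫⁻ s in Ioi 0, ∫⁻ ω, (timeBin Δ k).indicator 1 s *
      ENNReal.ofReal (stepIntensity (κ ω) h ψ b Δ k s) ∂Pr =
      ENNReal.ofReal Δ * ∫⁻ ω, ENNReal.ofReal (discreteIntensity (κ ω) h ψ b Δ k) ∂Pr := by
    rw [← volume_timeBin Δ k, mul_comm, ← setLIntegral_const,
      ← lintegral_indicator (measurableSet_timeBin Δ k), ← lintegral_indicator measurableSet_Ioi]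
    refine lintegral_congr fun s => ?_
    by_cases hs : s ∈ timeBin Δ k
    · have hs0 : s ∈ Ioi (0 : ℝ) := (timeBin_subset hΔ hkM hs).1
      rw [indicator_of_mem hs, indicator_of_mem hs0]
      refine lintegral_congr fun ω => ?_
      rw [indicator_of_mem hs, stepIntensity_of_mem hΔ hkM hs, Pi.one_apply, one_mul]
    · rw [indicator_of_notMem hs]
      by_cases hs0 : s ∈ Ioi (0 : ℝ)
      · rw [indicator_of_mem hs0]; simp [indicator_of_notMem hs]
      · rw [indicator_of_notMem hs0]
  rw [← h2, ← h1]
  refine lintegral_congr fun ω => lintegral_congr fun p => ?_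
  by_cases hp : p.1 ∈ timeBin Δ k
  · rw [stepIntensity_of_mem hΔ hkM hp]
  · simp [indicator_of_notMem hp]

theorem IsCompensatedProcess.lintegral_discreteX (hκ : IsCompensatedProcess Pr 𝓖 κ ν)
    (hΔ : 0 < Δ) (hψ : Measurable ψ) (hb_meas : Measurable b) (hb : ∀ y, 0 ≤ b y) {k : ℕ}
    (hk : 1 ≤ k) : ∫⁻ ω, ENNReal.ofReal (discreteX (κ ω) h ψ b Δ k) ∂Pr =
      ENNReal.ofReal Δ * (∫⁻ ω, ENNReal.ofReal (discreteIntensity (κ ω) h ψ b Δ k) ∂Pr) *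
        ∫⁻ y, ENNReal.ofReal (b y) ∂ν := by
  rw [← hκ.lintegral_timeBin hΔ hψ hb_meas hb hk hb_meas.ennreal_ofReal]
  exact lintegral_congr fun ω => ofReal_discreteX (hκ.simple ω) hb_meas hb hk

/-- `c/(1-ρ)` is the fixed point of `x ↦ c + ρ x`; it closes the induction on the bins. -/
theorem ENNReal.add_mul_div_one_sub {c : ℝ≥0∞} {ρ : ℝ} (hρ0 : 0 ≤ ρ) (hρ : ρ < 1) :
    c + ENNReal.ofReal ρ * (c / ENNReal.ofReal (1 - ρ)) = c / ENNReal.ofReal (1 - ρ) := by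
  have hpos : 0 < 1 - ρ := by linarith
  have h1 : c = ENNReal.ofReal (1 - ρ) * (c / ENNReal.ofReal (1 - ρ)) :=
    (ENNReal.mul_div_cancel (by simpa using hpos) (by simp)).symm
  nth_rewrite 1 [h1]
  rw [← add_mul, ← ENNReal.ofReal_add hpos.le hρ0]
  simp

/-- The mean discrete intensity of a stable process is at most `ψ(0) / (1 - ρ)`. -/
theorem IsCompensatedProcess.lintegral_discreteIntensity_le (hκ : IsCompensatedProcess Pr 𝓖 κ ν)
    (hΔ : 0 < Δ) (hψ : LipschitzWith L ψ) (hb_meas : Measurable b) (hb : ∀ y, 0 ≤ b y) {ρ : ℝ}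
    (hρ0 : 0 ≤ ρ) (hρ : ρ < 1) {M : ℕ}
    (hstab : L * (∑ k ∈ Finset.Icc 1 M, ENNReal.ofReal |h (k * Δ)| * ENNReal.ofReal Δ) *
      ∫⁻ y, ENNReal.ofReal (b y) ∂ν ≤ ENNReal.ofReal ρ) {n : ℕ} (hn : n ∈ Finset.Icc 1 M) :
    ∫⁻ ω, ENNReal.ofReal (discreteIntensity (κ ω) h ψ b Δ n) ∂Pr ≤
      ENNReal.ofReal (ψ 0) / ENNReal.ofReal (1 - ρ) := by
  have hψm := hψ.continuous.measurable
  induction n using Nat.strong_induction_on with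
  | _ n ih =>
    have hnM := Finset.mem_Icc.1 hn
    set C := ENNReal.ofReal (ψ 0) / ENNReal.ofReal (1 - ρ) with hC
    set β := ∫⁻ y, ENNReal.ofReal (b y) ∂ν with hβ
    calc ∫⁻ ω, ENNReal.ofReal (discreteIntensity (κ ω) h ψ b Δ n) ∂Pr
        ≤ ∫⁻ ω, (ENNReal.ofReal (ψ 0) + L * ∑ k ∈ Finset.Ico 1 n,
            ENNReal.ofReal |h (((n : ℝ) - k) * Δ)| *
              ENNReal.ofReal (discreteX (κ ω) h ψ b Δ k)) ∂Pr :=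
          lintegral_mono fun ω => ofReal_discreteIntensity_le hψ hb n
      _ = ENNReal.ofReal (ψ 0) + L * ∑ k ∈ Finset.Ico 1 n,
            ENNReal.ofReal |h (((n : ℝ) - k) * Δ)| *
              ∫⁻ ω, ENNReal.ofReal (discreteX (κ ω) h ψ b Δ k) ∂Pr := by
          rw [lintegral_add_left measurable_const, lintegral_const_mul' _ _ (by simp),
            lintegral_finsetSum]
          · simp_rw [lintegral_const_mul' _ _ ENNReal.ofReal_ne_top]
            simp
          · exact fun k _ =>
              (hκ.measurable_discreteX hΔ hψm hb_meas hb k).ennreal_ofReal.const_mul _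
      _ ≤ ENNReal.ofReal (ψ 0) + L * ∑ k ∈ Finset.Ico 1 n,
            ENNReal.ofReal |h (((n : ℝ) - k) * Δ)| * (ENNReal.ofReal Δ * C * β) := by
          gcongr with k hk
          have hkn := Finset.mem_Ico.1 hk
          rw [hκ.lintegral_discreteX hΔ hψm hb_meas hb hkn.1]
          gcongr
          exact ih k hkn.2 (Finset.mem_Icc.2 ⟨hkn.1, by omega⟩)
      _ = ENNReal.ofReal (ψ 0) + (L * (∑ k ∈ Finset.Ico 1 n,
            ENNReal.ofReal |h (((n : ℝ) - k) * Δ)| * ENNReal.ofReal Δ) * β) * C := by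
          simp only [← Finset.sum_mul]
          ring
      _ ≤ ENNReal.ofReal (ψ 0) + (L * (∑ k ∈ Finset.Icc 1 M,
            ENNReal.ofReal |h (k * Δ)| * ENNReal.ofReal Δ) * β) * C := by
          gcongr
          -- The reversal `k ↦ n - k` turns the convolution weights into the samples of `h` in the
          -- stability constant.
          have hre : ∑ k ∈ Finset.Ico 1 n, ENNReal.ofReal |h (((n : ℝ) - k) * Δ)| *
              ENNReal.ofReal Δ = ∑ k ∈ Finset.Ico 1 n, ENNReal.ofReal |h ((k : ℝ) * Δ)| *
              ENNReal.ofReal Δ := by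
            refine Finset.sum_bij' (fun k _ => n - k) (fun k _ => n - k) ?_ ?_ ?_ ?_ ?_
            · intro k hk; simp only [Finset.mem_Ico] at hk ⊢; omega
            · intro k hk; simp only [Finset.mem_Ico] at hk ⊢; omega
            · intro k hk; simp only [Finset.mem_Ico] at hk; omega
            · intro k hk; simp only [Finset.mem_Ico] at hk; omega
            · intro k hk
              rw [Nat.cast_sub (Finset.mem_Ico.1 hk).2.le]
          rw [hre]
          exact Finset.sum_le_sum_of_subset fun k hk => by
            simp only [Finset.mem_Ico, Finset.mem_Icc] at hk ⊢; omega
      _ ≤ ENNReal.ofReal (ψ 0) + ENNReal.ofReal ρ * C := by gcongr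
      _ = C := ENNReal.add_mul_div_one_sub hρ0 hρ

end Adapted

/-! ### Comparison of the continuous and the discrete intensity -/

/-- The kernel through which the discrete process sees the past: `h` at the distance of the bins
of `s` and `u`. -/
noncomputable def laggedKernel (h : ℝ → ℝ) (Δ s u : ℝ) : ℝ :=
  if ⌈u / Δ⌉ < ⌈s / Δ⌉ then h (((⌈s / Δ⌉ : ℝ) - ⌈u / Δ⌉) * Δ) else 0

theorem measurable_laggedKernel {h : ℝ → ℝ} (hh : Measurable h) (Δ : ℝ) :
    Measurable fun x : ℝ × ℝ => laggedKernel h Δ x.1 x.2 := by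
  have h1 : Measurable fun x : ℝ × ℝ => ⌈x.1 / Δ⌉ := (measurable_fst.div_const Δ).ceil
  have h2 : Measurable fun x : ℝ × ℝ => ⌈x.2 / Δ⌉ := (measurable_snd.div_const Δ).ceil
  have hc : Measurable fun n : ℤ => (n : ℝ) := measurable_of_countable _
  exact Measurable.ite (measurableSet_lt h2 h1)
    (hh.comp (((hc.comp h1).sub (hc.comp h2)).mul_const Δ)) measurable_const

section Path

variable {Q : Measure (ℝ × ℝ × ℝ)} {h ψ b : ℝ → ℝ} {Δ : ℝ} {M : ℕ}

theorem acceptedPoints_stepIntensity (hΔ : 0 < Δ) {n : ℕ} (hn : n ≤ M) :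
    acceptedPoints (Ioc 0 (n * Δ)) (stepIntensity Q h ψ b Δ M) =
      ⋃ k ∈ Finset.Icc 1 n, acceptedPoints (timeBin Δ k)
        (fun _ => discreteIntensity Q h ψ b Δ k) := by
  ext p
  simp only [mem_iUnion, exists_prop]
  constructor
  · rintro ⟨h1, h2, h3⟩
    obtain ⟨k, hk, hp⟩ := exists_mem_timeBin hΔ h1
    have hkM : k ∈ Finset.Icc 1 M := by
      simp only [Finset.mem_Icc] at hk ⊢; omega
    rw [stepIntensity_of_mem hΔ hkM hp] at h3
    exact ⟨k, hk, hp, h2, h3⟩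
  · rintro ⟨k, hk, hp, h2, h3⟩
    have hkM : k ∈ Finset.Icc 1 M := by
      simp only [Finset.mem_Icc] at hk ⊢; omega
    refine ⟨timeBin_subset hΔ hk hp, h2, ?_⟩
    rwa [stepIntensity_of_mem hΔ hkM hp]

theorem IsSimpleConfiguration.integrableOn_stepIntensity (hQ : IsSimpleConfiguration Q)
    (hΔ : 0 < Δ) {n : ℕ} (hn : n ≤ M) {f : ℝ × ℝ × ℝ → ℝ} (hf : Measurable f) :
    IntegrableOn f (acceptedPoints (Ioc 0 (n * Δ)) (stepIntensity Q h ψ b Δ M)) Q := by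
  rw [acceptedPoints_stepIntensity hΔ hn, integrableOn_finset_iUnion]
  exact fun k _ => hQ.integrableOn
    (measurableSet_acceptedPoints (measurableSet_timeBin Δ k) measurable_const)
    (hQ.acceptedPoints_const_lt_top (timeBin_subset_Iic Δ k) _) hf

theorem IsSimpleConfiguration.setIntegral_stepIntensity (hQ : IsSimpleConfiguration Q)
    (hΔ : 0 < Δ) {n : ℕ} (hn : n ≤ M) {f : ℝ × ℝ × ℝ → ℝ} (hf : Measurable f) :
    ∫ p in acceptedPoints (Ioc 0 (n * Δ)) (stepIntensity Q h ψ b Δ M), f p ∂Q =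
      ∑ k ∈ Finset.Icc 1 n,
        ∫ p in acceptedPoints (timeBin Δ k) (fun _ => discreteIntensity Q h ψ b Δ k), f p ∂Q := by
  rw [acceptedPoints_stepIntensity hΔ hn, integral_biUnion_finset]
  · exact fun k _ => measurableSet_acceptedPoints (measurableSet_timeBin Δ k) measurable_const
  · intro k _ k' _ hne
    exact Set.disjoint_left.2 fun p hp hp' =>
      Set.disjoint_left.1 (disjoint_timeBin hΔ hne) hp.1 hp'.1
  · exact fun k _ => hQ.integrableOn
      (measurableSet_acceptedPoints (measurableSet_timeBin Δ k) measurable_const)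
      (hQ.acceptedPoints_const_lt_top (timeBin_subset_Iic Δ k) _) hf

/-- For `s` in bin `n + 1` the lagged kernel is constant on each earlier bin. The discrete recursion
thereby takes the form of the Hawkes equation, with the lagged kernel and the step intensity. -/
theorem IsSimpleConfiguration.sum_discreteX_eq (hQ : IsSimpleConfiguration Q) (hΔ : 0 < Δ)
    (hh : Measurable h) (hb_meas : Measurable b) {n : ℕ} (hn : n + 1 ≤ M) {s : ℝ}
    (hs : s ∈ timeBin Δ (n + 1)) :
    ∑ k ∈ Finset.Ico 1 (n + 1), h ((((n + 1 : ℕ) : ℝ) - k) * Δ) * discreteX Q h ψ b Δ k =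
      ∫ p in acceptedPoints (Ioc 0 (n * Δ)) (stepIntensity Q h ψ b Δ M),
        laggedKernel h Δ s p.1 * b p.2.2 ∂Q := by
  have hlag : Measurable fun p : ℝ × ℝ × ℝ => laggedKernel h Δ s p.1 * b p.2.2 :=
    ((measurable_laggedKernel hh Δ).comp
      (by fun_prop : Measurable fun p : ℝ × ℝ × ℝ => (s, p.1))).mul (by fun_prop)
  rw [hQ.setIntegral_stepIntensity hΔ (by omega) hlag]
  refine Finset.sum_congr rfl fun k hk => ?_
  have hk' := Finset.mem_Ico.1 hk
  rw [discreteX_eq hk'.1, ← integral_const_mul]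
  refine setIntegral_congr_fun
    (measurableSet_acceptedPoints (measurableSet_timeBin Δ k) measurable_const) fun p hp => ?_
  have h1 := (mem_timeBin_iff hΔ).1 hp.1
  have h2 := (mem_timeBin_iff hΔ).1 hs
  have h3 : ((k : ℕ) : ℤ) < ((n + 1 : ℕ) : ℤ) := by exact_mod_cast hk'.2
  simp only [laggedKernel, h1, h2, if_pos h3]
  simp

/-- With `g` the lagged kernel and `ℓ'` the step intensity, `h 1_ℓ - g 1_ℓ'` equals `(h - g) 1_ℓ + g
(1_ℓ - 1_ℓ')`: a kernel error along the continuous process and a feedback term carried by the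
discrepancy. -/
theorem IsSimpleConfiguration.abs_sub_discrete_le (hQ : IsSimpleConfiguration Q) (hΔ : 0 < Δ)
    (hh : Measurable h) (hb_meas : Measurable b) (hb : ∀ y, 0 ≤ b y) {ℓ : ℝ → ℝ}
    (hℓ : Measurable ℓ) (hfin : Q (acceptedPoints (Ioc 0 (M * Δ)) ℓ) < ∞) {n : ℕ} (hn : n + 1 ≤ M)
    {s : ℝ} (hs : s ∈ timeBin Δ (n + 1)) :
    ENNReal.ofReal |∫ p in acceptedPoints (Ico 0 s) ℓ, h (s - p.1) * b p.2.2 ∂Q -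
        ∑ k ∈ Finset.Ico 1 (n + 1), h ((((n + 1 : ℕ) : ℝ) - k) * Δ) * discreteX Q h ψ b Δ k| ≤
      ∫⁻ p in {p | p.1 < s}, (ENNReal.ofReal |h (s - p.1) - laggedKernel h Δ s p.1| *
          acceptance (ℓ p.1) p.2.1 * ENNReal.ofReal (b p.2.2) +
        ENNReal.ofReal |laggedKernel h Δ s p.1| *
          discrepancy (ℓ p.1) (stepIntensity Q h ψ b Δ M p.1) p.2.1 *
          ENNReal.ofReal (b p.2.2)) ∂Q := by
  have hsM : s ≤ M * Δ := hs.2.trans (by gcongr)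
  have hlag : Measurable fun p : ℝ × ℝ × ℝ => laggedKernel h Δ s p.1 * b p.2.2 :=
    ((measurable_laggedKernel hh Δ).comp
      (by fun_prop : Measurable fun p : ℝ × ℝ × ℝ => (s, p.1))).mul (by fun_prop)
  have hker : Measurable fun p : ℝ × ℝ × ℝ => h (s - p.1) * b p.2.2 := by fun_prop
  have hA : MeasurableSet (acceptedPoints (Ico 0 s) ℓ) :=
    measurableSet_acceptedPoints measurableSet_Ico hℓ
  have hA' : MeasurableSet (acceptedPoints (Ioc 0 (n * Δ)) (stepIntensity Q h ψ b Δ M)) :=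
    measurableSet_acceptedPoints measurableSet_Ioc (measurable_stepIntensity ..)
  have hAfin : Q (acceptedPoints (Ico 0 s) ℓ) < ∞ := by
    have h1 : acceptedPoints (Ico 0 s) ℓ ⊆ acceptedPoints (Ioc 0 (M * Δ)) ℓ ∪ quadrantᶜ := by
      intro p hp
      by_cases hq : p ∈ quadrant
      · exact Or.inl (acceptedPoints_Ico_subset ℓ hsM ⟨hp, hq⟩)
      · exact Or.inr hq
    refine ((measure_mono h1).trans (measure_union_le _ _)).trans_lt ?_
    rwa [hQ.compl_quadrant, add_zero]
  rw [hQ.sum_discreteX_eq hΔ hh hb_meas hn hs, ← integral_indicator hA, ← integral_indicator hA',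
    ← integral_sub ((hQ.integrableOn hA hAfin hker).integrable_indicator hA)
      ((hQ.integrableOn_stepIntensity hΔ (by omega) hlag).integrable_indicator hA'),
    ← Real.enorm_eq_ofReal_abs, setLIntegral_time_lt]
  refine (enorm_integral_le_lintegral_enorm _).trans (lintegral_mono_ae ?_)
  have h0 : ∀ᵐ q ∂Q, q ∈ quadrant := hQ.compl_quadrant
  filter_upwards [h0] with p hp
  have hp0 : 0 < p.1 := hp.1
  have hsn : n * Δ < s := by
    have := hs.1
    push_cast at this
    linarith
  by_cases hps : p ∈ {p : ℝ × ℝ × ℝ | p.1 < s}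
  · have hps' : p.1 < s := hps
    rw [indicator_of_mem hps]
    set ℓ' := stepIntensity Q h ψ b Δ M with hℓ'
    have h1 : (acceptedPoints (Ico 0 s) ℓ).indicator (fun p => h (s - p.1) * b p.2.2) p =
        (Icc 0 (ℓ p.1)).indicator (fun _ => h (s - p.1) * b p.2.2) p.2.1 := by
      by_cases hθ : p.2.1 ∈ Icc 0 (ℓ p.1)
      · rw [indicator_of_mem hθ, indicator_of_mem]
        exact ⟨⟨hp0.le, hps'⟩, hθ.1, hθ.2⟩
      · rw [indicator_of_notMem hθ, indicator_of_notMem]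
        exact fun hq => hθ ⟨hq.2.1, hq.2.2⟩
    have h2 : (acceptedPoints (Ioc 0 (n * Δ)) ℓ').indicator
          (fun p => laggedKernel h Δ s p.1 * b p.2.2) p =
        (Icc 0 (ℓ' p.1)).indicator (fun _ => laggedKernel h Δ s p.1 * b p.2.2) p.2.1 := by
      by_cases hθ : p.2.1 ∈ Icc 0 (ℓ' p.1)
      · rw [indicator_of_mem hθ]
        rcases le_or_gt p.1 (n * Δ) with hle | hgt
        · rw [indicator_of_mem]
          exact ⟨⟨hp0, hle⟩, hθ.1, hθ.2⟩
        -- A point before `s` in the bin of `s` is outside the discrete domain `(0,nΔ]`; the lagged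
        -- kernel vanishes there, so nothing is lost.
        · have hbin : p.1 ∈ timeBin Δ (n + 1) := by
            refine ⟨?_, hps'.le.trans hs.2⟩
            push_cast
            linarith
          have hzero : laggedKernel h Δ s p.1 = 0 := by
            rw [laggedKernel, (mem_timeBin_iff hΔ).1 hbin, (mem_timeBin_iff hΔ).1 hs, if_neg]
            exact lt_irrefl _
          rw [indicator_of_notMem, hzero, zero_mul]
          exact fun hq => absurd hq.1.2 (not_le.2 hgt)
      · rw [indicator_of_notMem hθ, indicator_of_notMem]
        exact fun hq => hθ ⟨hq.2.1, hq.2.2⟩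
    rw [h1, h2]
    have hbe : ∀ x : ℝ, ‖x * b p.2.2‖ₑ = ENNReal.ofReal |x| * ENNReal.ofReal (b p.2.2) := fun x => by
      rw [enorm_mul, Real.enorm_eq_ofReal_abs, Real.enorm_eq_ofReal (hb _)]
    simp only [discrepancy, acceptance]
    by_cases hθ : p.2.1 ∈ Icc 0 (ℓ p.1) <;> by_cases hθ' : p.2.1 ∈ Icc 0 (ℓ' p.1)
    · have hsd : p.2.1 ∉ symmDiff (Icc 0 (ℓ p.1)) (Icc 0 (ℓ' p.1)) := by
        rw [Set.mem_symmDiff]; tauto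
      rw [indicator_of_mem hθ, indicator_of_mem hθ', indicator_of_mem hθ, indicator_of_notMem hsd,
        ← sub_mul, hbe]
      simp
    · have hsd : p.2.1 ∈ symmDiff (Icc 0 (ℓ p.1)) (Icc 0 (ℓ' p.1)) := by
        rw [Set.mem_symmDiff]; tauto
      rw [indicator_of_mem hθ, indicator_of_notMem hθ', indicator_of_mem hθ, indicator_of_mem hsd,
        sub_zero, hbe, Pi.one_apply, mul_one, mul_one, ← add_mul,
        ← ENNReal.ofReal_add (abs_nonneg _) (abs_nonneg _)]
      gcongr
      calc |h (s - p.1)| = |(h (s - p.1) - laggedKernel h Δ s p.1) + laggedKernel h Δ s p.1| := by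
            ring_nf
        _ ≤ _ := abs_add_le _ _
    · have hsd : p.2.1 ∈ symmDiff (Icc 0 (ℓ p.1)) (Icc 0 (ℓ' p.1)) := by
        rw [Set.mem_symmDiff]; tauto
      rw [indicator_of_notMem hθ, indicator_of_mem hθ', indicator_of_notMem hθ,
        indicator_of_mem hsd, zero_sub, enorm_neg, hbe]
      simp
    · rw [indicator_of_notMem hθ, indicator_of_notMem hθ']
      simp
  · have hps' : ¬ p.1 < s := hps
    rw [indicator_of_notMem hps, indicator_of_notMem, indicator_of_notMem]
    · simp
    · exact fun hq => hps' (hq.1.2.trans_lt hsn)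
    · exact fun hq => hps' hq.1.2

end Path

/-! ### Integrals of the kernels over the later time -/

section KernelIntegrals

variable {h : ℝ → ℝ} {Δ : ℝ} {M : ℕ}

theorem setLIntegral_Ioc_eq_sum_timeBin (hΔ : 0 < Δ) (M : ℕ) (f : ℝ → ℝ≥0∞) :
    ∫⁻ s in Ioc 0 (M * Δ), f s = ∑ n ∈ Finset.Icc 1 M, ∫⁻ s in timeBin Δ n, f s := by
  have : Ioc 0 (M * Δ) = ⋃ n ∈ Finset.Icc 1 M, timeBin Δ n := by
    ext s
    simp only [mem_iUnion, exists_prop]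
    exact ⟨fun hs => exists_mem_timeBin hΔ hs, fun ⟨n, hn, hs⟩ => timeBin_subset hΔ hn hs⟩
  rw [this, lintegral_biUnion_finset]
  · exact fun k _ k' _ hne => disjoint_timeBin hΔ hne
  · exact fun k _ => measurableSet_timeBin Δ k

/-- For `u` in bin `k`, the integral over `s` runs through the samples `h(jΔ)` with `1 ≤ j ≤ M - k`,
a part of the Riemann sum of `|h|`. -/
theorem lintegral_laggedKernel_le (hΔ : 0 < Δ) {u : ℝ} (hu : u ∈ Ioc 0 (M * Δ)) :
    ∫⁻ s in Ioc 0 (M * Δ), ENNReal.ofReal |laggedKernel h Δ s u| ≤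
      ∑ k ∈ Finset.Icc 1 M, ENNReal.ofReal |h (k * Δ)| * ENNReal.ofReal Δ := by
  obtain ⟨k, hk, huk⟩ := exists_mem_timeBin hΔ hu
  have hk' := (mem_timeBin_iff hΔ).1 huk
  rw [setLIntegral_Ioc_eq_sum_timeBin hΔ]
  have h1 : ∀ n ∈ Finset.Icc 1 M, ∫⁻ s in timeBin Δ n, ENNReal.ofReal |laggedKernel h Δ s u| =
      if k < n then ENNReal.ofReal |h (((n - k : ℕ) : ℝ) * Δ)| * ENNReal.ofReal Δ else 0 := by
    intro n _
    rw [setLIntegral_congr_fun (measurableSet_timeBin Δ n) (g := fun _ =>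
      if k < n then ENNReal.ofReal |h (((n - k : ℕ) : ℝ) * Δ)| else 0)]
    · rw [setLIntegral_const, volume_timeBin]
      split_ifs <;> simp
    · intro s hs
      have hs' := (mem_timeBin_iff hΔ).1 hs
      simp only [laggedKernel, hk', hs', Nat.cast_lt]
      split_ifs with hkn
      · rw [Nat.cast_sub hkn.le]; simp
      · simp
  rw [Finset.sum_congr rfl h1, ← Finset.sum_filter]
  refine (Finset.sum_nbij (i := fun n => n - k) (t := Finset.Icc 1 (M - k))
    (g := fun j : ℕ => ENNReal.ofReal |h (j * Δ)| * ENNReal.ofReal Δ) ?_ ?_ ?_ ?_).trans_le ?_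
  · intro n hn; simp only [Finset.mem_filter, Finset.mem_Icc] at hn ⊢; omega
  · intro n hn n' hn' heq
    simp only [Finset.coe_filter, Finset.mem_Icc, mem_ofPred_eq] at hn hn' heq; omega
  · intro j hj
    simp only [Finset.coe_Icc, mem_Icc] at hj
    simp only [Finset.coe_filter, Finset.mem_Icc, mem_image, mem_ofPred_eq]
    have := Finset.mem_Icc.1 hk
    exact ⟨j + k, ⟨by omega, by omega⟩, by omega⟩
  · intro n _; rfl
  · exact Finset.sum_le_sum_of_subset (Finset.Icc_subset_Icc_right (by omega))

theorem setLIntegral_Ioc_translate (f : ℝ → ℝ≥0∞) (a c : ℝ) :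
    ∫⁻ s in Ioc a c, f s = ∫⁻ r in Ioc 0 (c - a), f (a + r) := by
  rw [← lintegral_indicator measurableSet_Ioc, ← lintegral_indicator measurableSet_Ioc,
    ← lintegral_add_left_eq_self _ a]
  refine lintegral_congr fun r => ?_
  by_cases hr : r ∈ Ioc 0 (c - a)
  · rw [indicator_of_mem hr, indicator_of_mem]
    exact ⟨by linarith [hr.1], by linarith [hr.2]⟩
  · rw [indicator_of_notMem hr, indicator_of_notMem]
    exact fun hr' => hr ⟨by linarith [hr'.1], by linarith [hr'.2]⟩

theorem ofReal_intervalIntegral_abs {f : ℝ → ℝ} (hf : Measurable f) {a C : ℝ} (ha : 0 ≤ a)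
    (hC : ∀ x ∈ Ioc 0 a, |f x| ≤ C) :
    ENNReal.ofReal (∫ x in (0 : ℝ)..a, |f x|) = ∫⁻ x in Ioc 0 a, ENNReal.ofReal |f x| := by
  rw [intervalIntegral.integral_of_le ha, ofReal_integral_eq_lintegral_ofReal]
  · refine Measure.integrableOn_of_bounded (M := C) (by simp) hf.abs.aestronglyMeasurable ?_
    refine (ae_restrict_iff' measurableSet_Ioc).2 (Eventually.of_forall fun x hx => ?_)
    simpa using hC x hx
  · exact Eventually.of_forall fun x => abs_nonneg _

/-- The two sides differ only at grid points, a countable set. -/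
theorem ae_ceil_eq_floor_add_one (hΔ : 0 < Δ) :
    ∀ᵐ r : ℝ, (⌈r / Δ⌉ : ℝ) * Δ = (⌊r / Δ⌋ : ℝ) * Δ + Δ := by
  have hcount : (range fun n : ℤ => (n : ℝ) * Δ).Countable := countable_range _
  have h0 := hcount.ae_notMem (volume : Measure ℝ)
  filter_upwards [h0] with r hr
  have hne : ∀ n : ℤ, (n : ℝ) ≠ r / Δ := fun n hn => hr ⟨n, by
    simp only; rw [hn]; field_simp⟩
  have : ⌈r / Δ⌉ = ⌊r / Δ⌋ + 1 := by
    rw [Int.ceil_eq_iff]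
    push_cast
    exact ⟨by linarith [lt_of_le_of_ne (Int.floor_le (r / Δ)) (hne _)],
      (Int.lt_floor_add_one _).le⟩
  rw [this]; push_cast; ring

/-- Needed for the real supremum in `kernelRegularity` to dominate its members; an unbounded family
would have supremum 0 by convention. -/
theorem bddAbove_translation_integrals {H : ℝ}
    (hH : ∀ t, 0 ≤ t → |h t| ≤ H) {a : ℝ} (ha : 0 ≤ a) :
    BddAbove (range fun ε : Icc (0 : ℝ) Δ => ∫ y in (0 : ℝ)..a, |h (y + ε) - h y|) := by
  refine ⟨(2 * H) * a, ?_⟩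
  rintro _ ⟨ε, rfl⟩
  have h1 : ∀ x ∈ uIoc 0 a, ‖|h (x + ε) - h x|‖ ≤ 2 * H := by
    intro x hx
    rw [uIoc_of_le ha] at hx
    rw [Real.norm_eq_abs, abs_abs]
    have h2 := hH (x + ε) (by linarith [hx.1, ε.2.1])
    have h3 := hH x hx.1.le
    calc |h (x + ε) - h x| ≤ |h (x + ε)| + |h x| := abs_sub _ _
      _ ≤ _ := by linarith
  have := intervalIntegral.norm_integral_le_of_norm_le_const h1
  rw [sub_zero, abs_of_nonneg ha] at this
  exact (le_abs_self _).trans this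

/-- The three terms of `C_R` arise here. Up to the end `kΔ` of the bin of `u` the lagged kernel is
zero, which leaves `∫_0^Δ |h|`. Beyond it put `s = kΔ + r` and `v = kΔ - u ∈ [0,Δ]`: the kernels are
`h(r + v)` and `h(⌈r/Δ⌉Δ)`, and the triangle inequality through `h(r)` leaves a translation error
and the grid error. -/
theorem lintegral_sub_laggedKernel_le (hΔ : 0 < Δ) (hh : Measurable h) {H : ℝ}
    (hH : ∀ t, 0 ≤ t → |h t| ≤ H) {u : ℝ} (hu : u ∈ Ioc 0 (M * Δ)) :
    ∫⁻ s in Ioc u (M * Δ), ENNReal.ofReal |h (s - u) - laggedKernel h Δ s u| ≤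
      ENNReal.ofReal (kernelRegularity h (M * Δ) Δ) := by
  obtain ⟨k, hk, huk⟩ := exists_mem_timeBin hΔ hu
  have hkM := Finset.mem_Icc.1 hk
  have hk1 : (1 : ℝ) ≤ k := by exact_mod_cast hkM.1
  have hkM' : (k : ℝ) ≤ M := by exact_mod_cast hkM.2
  have hM1 : (1 : ℝ) ≤ M := hk1.trans hkM'
  have hk' := (mem_timeBin_iff hΔ).1 huk
  have hv0 : 0 ≤ k * Δ - u := by linarith [huk.2]
  have hvΔ : k * Δ - u ≤ Δ := by have := huk.1; linarith
  have hTΔ : 0 ≤ M * Δ - Δ := by nlinarith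
  set v := k * Δ - u with hv
  have hI1 : ∫⁻ s in Ioc u (k * Δ), ENNReal.ofReal |h (s - u) - laggedKernel h Δ s u| ≤
      ENNReal.ofReal (∫ y in (0 : ℝ)..Δ, |h y|) := by
    rw [ofReal_intervalIntegral_abs hh hΔ.le (C := H) (fun x hx => hH x hx.1.le)]
    have h1 : ∫⁻ s in Ioc u (k * Δ), ENNReal.ofReal |h (s - u) - laggedKernel h Δ s u| =
        ∫⁻ s in Ioc u (k * Δ), ENNReal.ofReal |h (s - u)| := by
      refine setLIntegral_congr_fun measurableSet_Ioc fun s hs => ?_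
      have hsk : s ∈ timeBin Δ k := ⟨huk.1.trans hs.1, hs.2⟩
      have hs' := (mem_timeBin_iff hΔ).1 hsk
      simp [laggedKernel, hs', hk']
    rw [h1, setLIntegral_Ioc_translate]
    simp only [add_sub_cancel_left]
    exact lintegral_mono_set (Ioc_subset_Ioc_right hvΔ)
  have hI2 : ∫⁻ s in Ioc (k * Δ) (M * Δ), ENNReal.ofReal |h (s - u) - laggedKernel h Δ s u| ≤
      ENNReal.ofReal (⨆ ε : Icc (0 : ℝ) Δ, ∫ y in (0 : ℝ)..(M * Δ - Δ), |h (y + ε) - h y|) +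
        ENNReal.ofReal (gridError h (M * Δ) Δ) := by
    have hgrid : ENNReal.ofReal (gridError h (M * Δ) Δ) =
        ∫⁻ r in Ioc 0 (M * Δ - Δ), ENNReal.ofReal |h r - h ((⌈r / Δ⌉ : ℝ) * Δ)| := by
      have hfl : Measurable fun y : ℝ => (⌊y / Δ⌋ : ℝ) * Δ + Δ := by
        have hc : Measurable fun n : ℤ => (n : ℝ) := measurable_of_countable _
        exact ((hc.comp (measurable_id.div_const Δ).floor).mul_const Δ).add_const Δ
      rw [gridError, ofReal_intervalIntegral_abs (f := fun y => h y - h ((⌊y / Δ⌋ : ℝ) * Δ + Δ))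
        (hh.sub (hh.comp hfl)) hTΔ (C := 2 * H)]
      · refine setLIntegral_congr_fun_ae measurableSet_Ioc ?_
        filter_upwards [ae_ceil_eq_floor_add_one hΔ] with r hr _
        rw [hr]
      · intro x hx
        have h2 := hH x hx.1.le
        have h3 := hH ((⌊x / Δ⌋ : ℝ) * Δ + Δ) (by
          have : (0 : ℝ) ≤ ⌊x / Δ⌋ := by exact_mod_cast Int.floor_nonneg.2 (div_nonneg hx.1.le hΔ.le)
          positivity)
        calc _ ≤ |h x| + |h ((⌊x / Δ⌋ : ℝ) * Δ + Δ)| := abs_sub _ _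
          _ ≤ _ := by linarith
    have hsup : ∫⁻ r in Ioc 0 (M * Δ - Δ), ENNReal.ofReal |h (r + v) - h r| ≤
        ENNReal.ofReal (⨆ ε : Icc (0 : ℝ) Δ, ∫ y in (0 : ℝ)..(M * Δ - Δ), |h (y + ε) - h y|) := by
      rw [← ofReal_intervalIntegral_abs (f := fun r => h (r + v) - h r) (by fun_prop) hTΔ
        (C := 2 * H)]
      · exact ENNReal.ofReal_le_ofReal
          (le_ciSup (bddAbove_translation_integrals hH hTΔ) (⟨v, hv0, hvΔ⟩ : Icc (0 : ℝ) Δ))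
      · intro x hx
        have h2 := hH (x + v) (by linarith [hx.1])
        have h3 := hH x hx.1.le
        calc |h (x + v) - h x| ≤ |h (x + v)| + |h x| := abs_sub _ _
          _ ≤ _ := by linarith
    rw [setLIntegral_Ioc_translate]
    calc ∫⁻ r in Ioc 0 (M * Δ - k * Δ),
          ENNReal.ofReal |h (k * Δ + r - u) - laggedKernel h Δ (k * Δ + r) u|
        ≤ ∫⁻ r in Ioc 0 (M * Δ - k * Δ), (ENNReal.ofReal |h (r + v) - h r| +
            ENNReal.ofReal |h r - h ((⌈r / Δ⌉ : ℝ) * Δ)|) := by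
          refine setLIntegral_mono' measurableSet_Ioc fun r hr => ?_
          have hceil : ⌈(k * Δ + r) / Δ⌉ = k + ⌈r / Δ⌉ := by
            have : (k * Δ + r) / Δ = (k : ℤ) + r / Δ := by
              push_cast; field_simp
            rw [this, Int.ceil_intCast_add]
          have hpos : 0 < ⌈r / Δ⌉ := Int.ceil_pos.2 (div_pos hr.1 hΔ)
          have hlag : laggedKernel h Δ (k * Δ + r) u = h ((⌈r / Δ⌉ : ℝ) * Δ) := by
            rw [laggedKernel, hceil, hk', if_pos (by omega)]
            congr 1; push_cast; ring
          rw [hlag, ← ENNReal.ofReal_add (abs_nonneg _) (abs_nonneg _)]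
          refine ENNReal.ofReal_le_ofReal ?_
          have : k * Δ + r - u = r + v := by rw [hv]; ring
          rw [this]
          exact abs_sub_le _ _ _
      _ ≤ ∫⁻ r in Ioc 0 (M * Δ - Δ), (ENNReal.ofReal |h (r + v) - h r| +
            ENNReal.ofReal |h r - h ((⌈r / Δ⌉ : ℝ) * Δ)|) :=
          lintegral_mono_set (Ioc_subset_Ioc_right (by nlinarith))
      _ = (∫⁻ r in Ioc 0 (M * Δ - Δ), ENNReal.ofReal |h (r + v) - h r|) +
            ∫⁻ r in Ioc 0 (M * Δ - Δ), ENNReal.ofReal |h r - h ((⌈r / Δ⌉ : ℝ) * Δ)| :=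
          lintegral_add_left (Measurable.ennreal_ofReal (by fun_prop)) _
      _ ≤ _ := by rw [hgrid]; gcongr
  have hnn1 : 0 ≤ ∫ y in (0 : ℝ)..Δ, |h y| :=
    intervalIntegral.integral_nonneg hΔ.le fun _ _ => abs_nonneg _
  have hnn2 : 0 ≤ ⨆ ε : Icc (0 : ℝ) Δ, ∫ y in (0 : ℝ)..(M * Δ - Δ), |h (y + ε) - h y| :=
    Real.iSup_nonneg fun ε => intervalIntegral.integral_nonneg hTΔ fun _ _ => abs_nonneg _
  have hnn3 : 0 ≤ gridError h (M * Δ) Δ :=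
    intervalIntegral.integral_nonneg hTΔ fun _ _ => abs_nonneg _
  rw [kernelRegularity, ENNReal.ofReal_add (by positivity) hnn3, ENNReal.ofReal_add hnn1 hnn2,
    add_assoc]
  refine le_trans ?_ (add_le_add hI1 hI2)
  refine le_trans (lintegral_mono_set fun s hs => ?_) (lintegral_union_le _ _ _)
  rcases le_or_gt s (k * Δ) with hle | hgt
  · exact Or.inl ⟨hs.1, hle⟩
  · exact Or.inr ⟨hgt, hs.2⟩

end KernelIntegrals

/-- By Tonelli the later variable is integrated first, leaving the integral of `k` over `s ∈ (u,T]`,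
which is bounded uniformly in `u`. -/
theorem lintegral_volterra_le {k : ℝ → ℝ → ℝ≥0∞} (hk : Measurable fun x : ℝ × ℝ => k x.1 x.2)
    {m : ℝ → ℝ≥0∞} (hm : Measurable m) {T : ℝ} {S : ℝ≥0∞}
    (hS : ∀ u ∈ Ioc 0 T, ∫⁻ s in Ioc u T, k s u ≤ S) :
    ∫⁻ s in Ioc 0 T, ∫⁻ u in Ioi 0, (Iio s).indicator (k s) u * m u ≤
      S * ∫⁻ u in Ioc 0 T, m u := by
  have hmeas : Measurable fun x : ℝ × ℝ => (Iio x.1).indicator (k x.1) x.2 * m x.2 := by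
    refine Measurable.mul ?_ (hm.comp measurable_snd)
    exact hk.indicator (s := {x : ℝ × ℝ | x.2 < x.1}) (measurableSet_lt measurable_snd measurable_fst)
  rw [lintegral_lintegral_swap hmeas.aemeasurable]
  calc ∫⁻ u in Ioi 0, ∫⁻ s in Ioc 0 T, (Iio s).indicator (k s) u * m u
      ≤ ∫⁻ u in Ioi 0, (Ioc 0 T).indicator (fun u => S * m u) u := by
        refine setLIntegral_mono' measurableSet_Ioi fun u hu => ?_
        have hku : Measurable fun s => (Iio s).indicator (k s) u :=
          (hk.comp (by fun_prop : Measurable fun s : ℝ => (s, u))).indicator (s := Ioi u)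
            measurableSet_Ioi
        rw [lintegral_mul_const _ hku]
        by_cases huT : u ∈ Ioc 0 T
        · rw [indicator_of_mem huT]
          gcongr
          refine le_trans ?_ (hS u huT)
          rw [← lintegral_indicator measurableSet_Ioc, ← lintegral_indicator measurableSet_Ioc]
          refine lintegral_mono fun s => ?_
          by_cases hs : s ∈ Ioc 0 T
          · rw [indicator_of_mem hs]
            by_cases hus : u < s
            · rw [indicator_of_mem (show u ∈ Iio s from hus),
                indicator_of_mem (show s ∈ Ioc u T from ⟨hus, hs.2⟩)]
            · rw [indicator_of_notMem (show u ∉ Iio s from hus)]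
              exact zero_le
          · rw [indicator_of_notMem hs]
            exact zero_le
        · rw [indicator_of_notMem huT]
          have hz : ∫⁻ s in Ioc 0 T, (Iio s).indicator (k s) u = 0 := by
            rw [setLIntegral_congr_fun (g := fun _ => 0) measurableSet_Ioc]
            · simp
            · intro s hs
              show (Iio s).indicator (k s) u = 0
              have hus : u ∉ Iio s := fun hus => huT ⟨hu, (show u < s from hus).le.trans hs.2⟩
              rw [indicator_of_notMem hus]
          rw [hz, zero_mul]
    _ ≤ ∫⁻ u, (Ioc 0 T).indicator (fun u => S * m u) u := setLIntegral_le_lintegral _ _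
    _ = S * ∫⁻ u in Ioc 0 T, m u := by
        rw [lintegral_indicator measurableSet_Ioc, lintegral_const_mul _ hm]

/-! ### The L¹ distance of the two intensities -/

section Coupling

variable {Ω : Type*} [mΩ : MeasurableSpace Ω] {Pr : Measure Ω} [IsProbabilityMeasure Pr]
  {𝓖 : Filtration ℝ≥0 mΩ} {κ : Ω → Measure (ℝ × ℝ × ℝ)} {ν : Measure ℝ} [IsProbabilityMeasure ν]
  {h ψ b : ℝ → ℝ} {Δ : ℝ} {M : ℕ} {a : Ω → ℝ → ℝ} {L : ℝ≥0}

/-- Mean distance of the continuous and the discrete intensity at time `s`. -/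
noncomputable def intensityGap (Pr : Measure Ω) (κ : Ω → Measure (ℝ × ℝ × ℝ)) (h ψ b : ℝ → ℝ)
    (Δ : ℝ) (M : ℕ) (a : Ω → ℝ → ℝ) (s : ℝ) : ℝ≥0∞ :=
  ∫⁻ ω, ENNReal.ofReal |a ω s - stepIntensity (κ ω) h ψ b Δ M s| ∂Pr

theorem measurable_intensityGap (hκ : IsCompensatedProcess Pr 𝓖 κ ν) (hΔ : 0 < Δ)
    (hψ : Measurable ψ) (hb_meas : Measurable b) (hb : ∀ y, 0 ≤ b y)
    (ha : IsThinnedHawkes Pr 𝓖 κ h ψ b (M * Δ) a) :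
    Measurable (intensityGap Pr κ h ψ b Δ M a) := by
  have h1 := measurable_section_of_predictablePoints ha.measurable
  have h2 := measurable_section_of_predictablePoints (a := fun ω => stepIntensity (κ ω) h ψ b Δ M)
    (hκ.predictable_stepIntensity (h := h) hΔ hψ hb_meas hb M)
  have h3 : Measurable fun x : Ω × ℝ =>
      ENNReal.ofReal |a x.1 x.2 - stepIntensity (κ x.1) h ψ b Δ M x.2| :=
    ((measurable_norm.comp (h1.sub h2))).ennreal_ofReal
  exact h3.lintegral_prod_left'

/-- Taking means in `IsSimpleConfiguration.abs_sub_discrete_le`, compensation replaces the random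
integrals by Lebesgue integrals over the past and produces the factor `E[b(Y)]`; the factor `L` is
the Lipschitz constant. -/
theorem IsThinnedHawkes.intensityGap_le_add (hκ : IsCompensatedProcess Pr 𝓖 κ ν) (hΔ : 0 < Δ)
    (hψ : LipschitzWith L ψ) (hb_meas : Measurable b) (hb : ∀ y, 0 ≤ b y) (hh : Measurable h)
    (ha : IsThinnedHawkes Pr 𝓖 κ h ψ b (M * Δ) a) {s : ℝ} (hs : s ∈ Ioc 0 (M * Δ)) :
    intensityGap Pr κ h ψ b Δ M a s ≤ L * (∫⁻ y, ENNReal.ofReal (b y) ∂ν) *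
      ((∫⁻ u in Ioi 0, (Iio s).indicator
          (fun u => ENNReal.ofReal |h (s - u) - laggedKernel h Δ s u|) u *
          ∫⁻ ω, ENNReal.ofReal (a ω u) ∂Pr) +
        ∫⁻ u in Ioi 0, (Iio s).indicator (fun u => ENNReal.ofReal |laggedKernel h Δ s u|) u *
          intensityGap Pr κ h ψ b Δ M a u) := by
  have hψm := hψ.continuous.measurable
  set c : Ω → ℝ → ℝ := fun ω => stepIntensity (κ ω) h ψ b Δ M with hc
  have hcm : Measurable[predictablePoints 𝓖] fun x : Ω × (ℝ × ℝ × ℝ) => c x.1 x.2.1 :=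
    hκ.predictable_stepIntensity (h := h) hΔ hψm hb_meas hb M
  have hlag : Measurable fun u => laggedKernel h Δ s u :=
    (measurable_laggedKernel hh Δ).comp (by fun_prop : Measurable fun u : ℝ => (s, u))
  set w₁ : ℝ → ℝ≥0∞ := (Iio s).indicator
    (fun u => ENNReal.ofReal |h (s - u) - laggedKernel h Δ s u|) with hw₁
  set w₂ : ℝ → ℝ≥0∞ := (Iio s).indicator (fun u => ENNReal.ofReal |laggedKernel h Δ s u|) with hw₂
  have hw₁m : Measurable w₁ := by
    refine Measurable.indicator ?_ measurableSet_Iio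
    exact (measurable_norm.comp ((by fun_prop : Measurable fun u => h (s - u)).sub hlag)).ennreal_ofReal
  have hw₂m : Measurable w₂ :=
    (measurable_norm.comp hlag).ennreal_ofReal.indicator measurableSet_Iio
  obtain ⟨k, hk, hsk⟩ := exists_mem_timeBin hΔ hs
  obtain ⟨n, rfl⟩ := Nat.exists_eq_add_of_le' (Finset.mem_Icc.1 hk).1
  have hm₁ : Measurable fun x : Ω × (ℝ × ℝ × ℝ) =>
      w₁ x.2.1 * acceptance (a x.1 x.2.1) x.2.2.1 * ENNReal.ofReal (b x.2.2.2) := by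
    have h1 := ha.measurable.mono predictablePoints_le le_rfl
    exact ((hw₁m.comp (by fun_prop)).mul (measurable_acceptance h1 (by fun_prop))).mul
      (by fun_prop)
  have hm₂ : Measurable fun x : Ω × (ℝ × ℝ × ℝ) =>
      w₂ x.2.1 * discrepancy (a x.1 x.2.1) (c x.1 x.2.1) x.2.2.1 * ENNReal.ofReal (b x.2.2.2) := by
    have h1 := ha.measurable.mono predictablePoints_le le_rfl
    have h2 := hcm.mono predictablePoints_le le_rfl
    exact ((hw₂m.comp (by fun_prop)).mul (measurable_discrepancy h1 h2 (by fun_prop))).mul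
      (by fun_prop)
  calc intensityGap Pr κ h ψ b Δ M a s
      ≤ ∫⁻ ω, L * ((∫⁻ p, w₁ p.1 * acceptance (a ω p.1) p.2.1 * ENNReal.ofReal (b p.2.2) ∂(κ ω)) +
          ∫⁻ p, w₂ p.1 * discrepancy (a ω p.1) (c ω p.1) p.2.1 *
            ENNReal.ofReal (b p.2.2) ∂(κ ω)) ∂Pr := by
        refine lintegral_mono_ae ?_
        filter_upwards [ha.finite, ha.eq] with ω hfin heq
        rw [stepIntensity_of_mem hΔ hk hsk, heq s ⟨hs.1.le, hs.2⟩, discreteIntensity]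
        refine (hψ.ofReal_abs_sub_le _ _).trans ?_
        gcongr
        have hℓ : Measurable (a ω) := (measurable_section_of_predictablePoints ha.measurable).comp
          (by fun_prop : Measurable fun u : ℝ => (ω, u))
        refine ((hκ.simple ω).abs_sub_discrete_le hΔ hh hb_meas hb hℓ hfin
          (Finset.mem_Icc.1 hk).2 hsk).trans_eq ?_
        have hm₁' : Measurable fun p : ℝ × ℝ × ℝ =>
            w₁ p.1 * acceptance (a ω p.1) p.2.1 * ENNReal.ofReal (b p.2.2) :=
          hm₁.comp (by fun_prop : Measurable fun p : ℝ × ℝ × ℝ => (ω, p))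
        rw [setLIntegral_time_lt, ← lintegral_add_left hm₁']
        refine lintegral_congr fun p => ?_
        by_cases hp : p.1 < s
        · rw [indicator_of_mem (show p ∈ {p : ℝ × ℝ × ℝ | p.1 < s} from hp), hw₁, hw₂,
            indicator_of_mem (show p.1 ∈ Iio s from hp), indicator_of_mem (show p.1 ∈ Iio s from hp)]
        · rw [indicator_of_notMem (show p ∉ {p : ℝ × ℝ × ℝ | p.1 < s} from hp), hw₁, hw₂,
            indicator_of_notMem (show p.1 ∉ Iio s from hp),
            indicator_of_notMem (show p.1 ∉ Iio s from hp)]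
          simp
    _ = L * ((∫⁻ ω, ∫⁻ p, w₁ p.1 * acceptance (a ω p.1) p.2.1 * ENNReal.ofReal (b p.2.2) ∂(κ ω) ∂Pr) +
          ∫⁻ ω, ∫⁻ p, w₂ p.1 * discrepancy (a ω p.1) (c ω p.1) p.2.1 *
            ENNReal.ofReal (b p.2.2) ∂(κ ω) ∂Pr) := by
        rw [lintegral_const_mul' _ _ (by simp), lintegral_add_left (hκ.measurable_lintegral hm₁)]
    _ ≤ L * ((∫⁻ u in Ioi 0, ∫⁻ ω, w₁ u * ENNReal.ofReal (a ω u) ∂Pr) *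
            (∫⁻ y, ENNReal.ofReal (b y) ∂ν) +
          (∫⁻ u in Ioi 0, ∫⁻ ω, w₂ u * ENNReal.ofReal |a ω u - c ω u| ∂Pr) *
            ∫⁻ y, ENNReal.ofReal (b y) ∂ν) := by
        gcongr
        · exact (hκ.lintegral_acceptance_eq (w := fun _ u => w₁ u) (a := a)
            (hw₁m.comp measurable_predictablePoints_time) ha.measurable hb_meas.ennreal_ofReal).le
        · exact hκ.lintegral_discrepancy_le (w := fun _ u => w₂ u) (a := a) (c := c)
            (hw₂m.comp measurable_predictablePoints_time) ha.measurable hcm hb_meas.ennreal_ofReal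
    _ = _ := by
        have hfin₁ : ∀ u, w₁ u ≠ ∞ := fun u => by
          rw [hw₁, indicator_apply]; split_ifs <;> simp
        have hfin₂ : ∀ u, w₂ u ≠ ∞ := fun u => by
          rw [hw₂, indicator_apply]; split_ifs <;> simp
        simp_rw [lintegral_const_mul' _ _ (hfin₁ _), lintegral_const_mul' _ _ (hfin₂ _)]
        rw [← add_mul, mul_comm _ (∫⁻ y, ENNReal.ofReal (b y) ∂ν), ← mul_assoc]
        rfl

/-- The two intensities are close in `L¹` if the kernel is regular at the scale of the grid. -/
theorem IsThinnedHawkes.lintegral_intensityGap_le (hκ : IsCompensatedProcess Pr 𝓖 κ ν) (hΔ : 0 < Δ)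
    (hψ : LipschitzWith L ψ) (hψ0 : ∀ x, 0 ≤ ψ x) (hb_meas : Measurable b) (hb : ∀ y, 0 ≤ b y)
    (hb_int : ∫⁻ y, ENNReal.ofReal (b y) ∂ν ≠ ∞)
    (hh : Measurable h) {H : ℝ} (hH : ∀ t, 0 ≤ t → |h t| ≤ H) {ρ : ℝ} (hρ0 : 0 ≤ ρ) (hρ : ρ < 1)
    (hstab : L * (∫⁻ t in Ioc 0 (M * Δ), ENNReal.ofReal |h t|) *
      ∫⁻ y, ENNReal.ofReal (b y) ∂ν ≤ ENNReal.ofReal ρ)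
    (hstab' : L * (∑ k ∈ Finset.Icc 1 M, ENNReal.ofReal |h (k * Δ)| * ENNReal.ofReal Δ) *
      ∫⁻ y, ENNReal.ofReal (b y) ∂ν ≤ ENNReal.ofReal ρ)
    (ha : IsThinnedHawkes Pr 𝓖 κ h ψ b (M * Δ) a) :
    ∫⁻ s in Ioc 0 (M * Δ), intensityGap Pr κ h ψ b Δ M a s ≤
      L * (∫⁻ y, ENNReal.ofReal (b y) ∂ν) *
        (ENNReal.ofReal (kernelRegularity h (M * Δ) Δ) *
          (ENNReal.ofReal (ψ 0) / ENNReal.ofReal (1 - ρ) * ENNReal.ofReal (M * Δ))) /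
        ENNReal.ofReal (1 - ρ) := by
  have hψm := hψ.continuous.measurable
  set β := ∫⁻ y, ENNReal.ofReal (b y) ∂ν with hβ
  set C := ENNReal.ofReal (ψ 0) / ENNReal.ofReal (1 - ρ) with hC
  have hCfin : C ≠ ∞ := ENNReal.div_ne_top (by simp) (by simpa using hρ)
  set A : ℝ → ℝ≥0∞ := fun u => ∫⁻ ω, ENNReal.ofReal (a ω u) ∂Pr with hA
  have hAm : Measurable A :=
    ((measurable_section_of_predictablePoints ha.measurable).ennreal_ofReal).lintegral_prod_left'
  have hAC : ∀ u ∈ Ioc 0 (M * Δ), A u ≤ C := fun u hu =>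
    ha.lintegral_le hκ hψ hb_meas hb hh hH hρ0 hρ hstab hu
  have hgm := measurable_intensityGap hκ hΔ hψm hb_meas hb ha
  -- A crude bound by the sum of the two mean intensities. Its only role is to make the total gap
  -- finite, so that it can be absorbed.
  have hgap : ∀ u ∈ Ioc 0 (M * Δ), intensityGap Pr κ h ψ b Δ M a u ≤ C + C := by
    intro u hu
    obtain ⟨k, hk, huk⟩ := exists_mem_timeBin hΔ hu
    calc intensityGap Pr κ h ψ b Δ M a u
        ≤ ∫⁻ ω, (ENNReal.ofReal (a ω u) +
            ENNReal.ofReal (discreteIntensity (κ ω) h ψ b Δ k)) ∂Pr := by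
          refine lintegral_mono_ae ?_
          filter_upwards [ha.eq] with ω hω
          rw [stepIntensity_of_mem hΔ hk huk,
            ← ENNReal.ofReal_add ((hψ0 _).trans_eq (hω u ⟨hu.1.le, hu.2⟩).symm)
              (discreteIntensity_nonneg hψ0 k)]
          refine ENNReal.ofReal_le_ofReal ((abs_sub _ _).trans ?_)
          rw [abs_of_nonneg ((hψ0 _).trans_eq (hω u ⟨hu.1.le, hu.2⟩).symm),
            abs_of_nonneg (discreteIntensity_nonneg hψ0 k)]
      _ ≤ C + C := by
          rw [lintegral_add_right _ (hκ.measurable_discreteIntensity hΔ hψm hb_meas hb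
            (Finset.mem_Icc.1 hk).1).ennreal_ofReal]
          exact add_le_add (hAC u hu)
            (hκ.lintegral_discreteIntensity_le hΔ hψ hb_meas hb hρ0 hρ hstab' hk)
  have hMΔ : volume (Ioc 0 (M * Δ)) = ENNReal.ofReal (M * Δ) := by
    rw [Real.volume_Ioc, sub_zero]
  have hDfin : ∫⁻ s in Ioc 0 (M * Δ), intensityGap Pr κ h ψ b Δ M a s ≠ ∞ := by
    refine ((setLIntegral_mono measurable_const hgap).trans_lt ?_).ne
    rw [setLIntegral_const, hMΔ]
    exact ENNReal.mul_lt_top (ENNReal.add_lt_top.2 ⟨hCfin.lt_top, hCfin.lt_top⟩) ENNReal.ofReal_lt_top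
  refine ENNReal.le_div_of_le_add_mul hρ0 hρ hDfin ?_
  have hlag := measurable_laggedKernel hh Δ
  have hk₁ : Measurable fun x : ℝ × ℝ =>
      ENNReal.ofReal |h (x.1 - x.2) - laggedKernel h Δ x.1 x.2| :=
    (measurable_norm.comp
      ((by fun_prop : Measurable fun x : ℝ × ℝ => h (x.1 - x.2)).sub hlag)).ennreal_ofReal
  have hk₂ : Measurable fun x : ℝ × ℝ => ENNReal.ofReal |laggedKernel h Δ x.1 x.2| :=
    (measurable_norm.comp hlag).ennreal_ofReal
  -- The kernel error against the bounded mean intensity is the source term; in `hV₂` the lagged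
  -- kernel returns the gap itself with the factor of the discrete stability constant.
  have hV₁ := lintegral_volterra_le (k := fun s u => ENNReal.ofReal |h (s - u) - laggedKernel h Δ s u|)
    hk₁ hAm (T := M * Δ) (S := ENNReal.ofReal (kernelRegularity h (M * Δ) Δ))
    (fun u hu => lintegral_sub_laggedKernel_le hΔ hh hH hu)
  have hV₂ := lintegral_volterra_le (k := fun s u => ENNReal.ofReal |laggedKernel h Δ s u|)
    hk₂ hgm (T := M * Δ) (fun u hu => (lintegral_mono_set (Ioc_subset_Ioc_left hu.1.le)).trans
      (lintegral_laggedKernel_le hΔ hu))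
  have hmeas₁ : Measurable fun s => ∫⁻ u in Ioi 0, (Iio s).indicator
      (fun u => ENNReal.ofReal |h (s - u) - laggedKernel h Δ s u|) u * A u := by
    have : Measurable fun x : ℝ × ℝ => (Iio x.1).indicator
        (fun u => ENNReal.ofReal |h (x.1 - u) - laggedKernel h Δ x.1 u|) x.2 * A x.2 :=
      (hk₁.indicator (s := {x : ℝ × ℝ | x.2 < x.1})
        (measurableSet_lt measurable_snd measurable_fst)).mul (hAm.comp measurable_snd)
    exact this.lintegral_prod_right'
  calc ∫⁻ s in Ioc 0 (M * Δ), intensityGap Pr κ h ψ b Δ M a s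
      ≤ ∫⁻ s in Ioc 0 (M * Δ), L * β * ((∫⁻ u in Ioi 0, (Iio s).indicator
          (fun u => ENNReal.ofReal |h (s - u) - laggedKernel h Δ s u|) u * A u) +
        ∫⁻ u in Ioi 0, (Iio s).indicator (fun u => ENNReal.ofReal |laggedKernel h Δ s u|) u *
          intensityGap Pr κ h ψ b Δ M a u) :=
        setLIntegral_mono' measurableSet_Ioc fun s hs =>
          ha.intensityGap_le_add hκ hΔ hψ hb_meas hb hh hs
    _ ≤ L * β * (ENNReal.ofReal (kernelRegularity h (M * Δ) Δ) * (C * ENNReal.ofReal (M * Δ)) +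
          (∑ k ∈ Finset.Icc 1 M, ENNReal.ofReal |h (k * Δ)| * ENNReal.ofReal Δ) *
            ∫⁻ s in Ioc 0 (M * Δ), intensityGap Pr κ h ψ b Δ M a s) := by
        rw [lintegral_const_mul' _ _ (ENNReal.mul_ne_top (by simp) hb_int),
          lintegral_add_left hmeas₁]
        gcongr
        refine hV₁.trans ?_
        gcongr
        refine (setLIntegral_mono measurable_const hAC).trans_eq ?_
        rw [setLIntegral_const, hMΔ]
    _ = L * β * (ENNReal.ofReal (kernelRegularity h (M * Δ) Δ) * (C * ENNReal.ofReal (M * Δ))) +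
          (L * (∑ k ∈ Finset.Icc 1 M, ENNReal.ofReal |h (k * Δ)| * ENNReal.ofReal Δ) * β) *
            ∫⁻ s in Ioc 0 (M * Δ), intensityGap Pr κ h ψ b Δ M a s := by ring
    _ ≤ _ := by gcongr

/-- Mean total mark of the points of `(0, MΔ]` accepted in exactly one of the two processes. -/
theorem IsThinnedHawkes.lintegral_discrepancy_le_gap (hκ : IsCompensatedProcess Pr 𝓖 κ ν)
    (hΔ : 0 < Δ) (hψ : Measurable ψ) (hb_meas : Measurable b) (hb : ∀ y, 0 ≤ b y)
    (ha : IsThinnedHawkes Pr 𝓖 κ h ψ b (M * Δ) a) {g : ℝ → ℝ≥0∞} (hg : Measurable g) :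
    ∫⁻ ω, ∫⁻ p, (Ioc 0 (M * Δ)).indicator 1 p.1 *
        discrepancy (a ω p.1) (stepIntensity (κ ω) h ψ b Δ M p.1) p.2.1 * g p.2.2 ∂(κ ω) ∂Pr ≤
      (∫⁻ s in Ioc 0 (M * Δ), intensityGap Pr κ h ψ b Δ M a s) * ∫⁻ y, g y ∂ν := by
  have hI : Measurable ((Ioc 0 (M * Δ)).indicator (1 : ℝ → ℝ≥0∞)) :=
    measurable_one.indicator measurableSet_Ioc
  refine (hκ.lintegral_discrepancy_le (w := fun _ u => (Ioc 0 (M * Δ)).indicator 1 u) (a := a)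
    (c := fun ω => stepIntensity (κ ω) h ψ b Δ M)
    (hI.comp measurable_predictablePoints_time) ha.measurable
    (hκ.predictable_stepIntensity (h := h) hΔ hψ hb_meas hb M) hg).trans ?_
  refine mul_le_mul_left ?_ _
  refine (setLIntegral_le_lintegral _ _).trans ?_
  rw [← lintegral_indicator measurableSet_Ioc]
  refine lintegral_mono fun s => ?_
  by_cases hs : s ∈ Ioc 0 (M * Δ)
  · simp only [indicator_of_mem hs, Pi.one_apply, one_mul]
    exact le_rfl
  · simp [indicator_of_notMem hs]

end Coupling

/-! ### Time changes -/

/-- The continuous piecewise linear function with the value `kΔ` at `s k` for `k ≤ M`. -/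
noncomputable def gridTimeChange (s : ℕ → ℝ) (Δ : ℝ) (M : ℕ) (t : ℝ) : ℝ :=
  ∑ k ∈ Finset.range M, Δ * max 0 (min 1 ((t - s k) / (s (k + 1) - s k)))

section TimeChange

variable {s : ℕ → ℝ} {Δ : ℝ} {M : ℕ}

/-- Each summand is a ramp rising from 0 to `Δ` between `s k` and `s (k + 1)`. At `s j` the first
`j` ramps are complete and the others have not begun. -/
theorem gridTimeChange_apply (hs : ∀ i < M, s i < s (i + 1)) {j : ℕ} (hj : j ≤ M) :
    gridTimeChange s Δ M (s j) = j * Δ := by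
  have hmono : ∀ m n, m ≤ n → n ≤ M → s m ≤ s n := by
    intro m n hmn
    induction n, hmn using Nat.le_induction with
    | base => exact fun _ => le_rfl
    | succ n _ ih => exact fun hn => (ih (by omega)).trans (hs n (by omega)).le
  have h1 : ∀ k ∈ Finset.range M, Δ * max 0 (min 1 ((s j - s k) / (s (k + 1) - s k))) =
      if k < j then Δ else 0 := by
    intro k hk
    have hkM := Finset.mem_range.1 hk
    have hpos : 0 < s (k + 1) - s k := sub_pos.2 (hs k hkM)
    split_ifs with hkj
    · have h2 : 1 ≤ (s j - s k) / (s (k + 1) - s k) := by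
        rw [le_div_iff₀ hpos, one_mul]
        linarith [hmono (k + 1) j hkj hj]
      rw [min_eq_left h2]; simp
    · have h2 : (s j - s k) / (s (k + 1) - s k) ≤ 0 :=
        div_nonpos_of_nonpos_of_nonneg (by linarith [hmono j k (by omega) hkM.le]) hpos.le
      rw [max_eq_left ((min_le_right _ _).trans h2), mul_zero]
  rw [gridTimeChange, Finset.sum_congr rfl h1, ← Finset.sum_filter]
  have : (Finset.range M).filter (· < j) = Finset.range j := by
    ext k; simp only [Finset.mem_filter, Finset.mem_range]; omega
  rw [this]
  simp

/-- Every `t` before the end lies in some `[s k, s (k + 1))`, where ramp `k` increases strictly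
while the others do not decrease. -/
theorem isTimeChange_gridTimeChange (hΔ : 0 < Δ) (hs : ∀ i < M, s i < s (i + 1)) (h0 : s 0 = 0)
    (hM : s M = M * Δ) : IsTimeChange (M * Δ) (gridTimeChange s Δ M) where
  strictMono := by
    intro t ht t' ht' htt'
    obtain ⟨k, hk, hkt, htk⟩ : ∃ k < M, s k ≤ t ∧ t < s (k + 1) := by
      by_contra! hcon
      have : ∀ k ≤ M, s k ≤ t := by
        intro k
        induction k with
        | zero => exact fun _ => h0.trans_le ht.1
        | succ k ih => exact fun hk => hcon k (by omega) (ih (by omega))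
      have := this M le_rfl
      rw [hM] at this
      exact absurd (this.trans_lt htt') (not_lt.2 ht'.2)
    refine Finset.sum_lt_sum (fun i hi => ?_) ⟨k, Finset.mem_range.2 hk, ?_⟩
    · have hpos : 0 < s (i + 1) - s i := sub_pos.2 (hs i (Finset.mem_range.1 hi))
      gcongr
    · have hpos : 0 < s (k + 1) - s k := sub_pos.2 (hs k hk)
      have h1 : 0 ≤ (t - s k) / (s (k + 1) - s k) := div_nonneg (by linarith) hpos.le
      have h2 : (t - s k) / (s (k + 1) - s k) < 1 := by rw [div_lt_one hpos]; linarith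
      have h3 : (t - s k) / (s (k + 1) - s k) < (t' - s k) / (s (k + 1) - s k) := by gcongr
      rw [min_eq_right h2.le, max_eq_right h1]
      gcongr
      exact lt_max_of_lt_right (lt_min h2 h3)
  continuous := by
    unfold gridTimeChange
    fun_prop
  map_zero := by simpa [h0] using gridTimeChange_apply (Δ := Δ) hs (Nat.zero_le M)
  map_end := by simpa [hM] using gridTimeChange_apply (Δ := Δ) hs (le_refl M)

theorem lt_succ_of_mem_timeBin (hs : ∀ k ∈ Finset.Icc 1 M, s k ∈ timeBin Δ k)
    (h0 : s 0 = 0) : ∀ i < M, s i < s (i + 1) := by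
  intro i hi
  have h1 := (hs (i + 1) (Finset.mem_Icc.2 ⟨by omega, by omega⟩)).1
  push_cast at h1
  have h2 : s i ≤ i * Δ := by
    rcases Nat.eq_zero_or_pos i with rfl | hpos
    · simp [h0]
    · exact (hs i (Finset.mem_Icc.2 ⟨hpos, hi.le⟩)).2
  linarith

/-- A time change moving the grid points to prescribed points of the bins. -/
theorem exists_isTimeChange (hΔ : 0 < Δ) (hs : ∀ k ∈ Finset.Icc 1 M, s k ∈ timeBin Δ k)
    (h0 : s 0 = 0) (hM : s M = M * Δ) :
    ∃ μ, IsTimeChange (M * Δ) μ ∧ (∀ k ≤ M, μ (s k) = k * Δ) ∧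
      ∀ t ∈ Icc 0 (M * Δ), |t - μ t| ≤ 2 * Δ := by
  have hlt := lt_succ_of_mem_timeBin hs h0
  have hμ := isTimeChange_gridTimeChange hΔ hlt h0 hM
  refine ⟨gridTimeChange s Δ M, hμ, fun k hk => gridTimeChange_apply hlt hk, fun t ht => ?_⟩
  have hmem : ∀ k ≤ M, s k ∈ Icc 0 (M * Δ) := by
    intro k hk
    rcases Nat.eq_zero_or_pos k with rfl | hpos
    · rw [h0]; exact ⟨le_rfl, by positivity⟩
    · have hkM : k ∈ Finset.Icc 1 M := Finset.mem_Icc.2 ⟨hpos, hk⟩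
      exact Ioc_subset_Icc_self (timeBin_subset hΔ hkM (hs k hkM))
  rcases ht.1.eq_or_lt with rfl | htpos
  · rw [hμ.map_zero]; simp [hΔ.le]
  obtain ⟨k, hk, htk⟩ := exists_mem_timeBin hΔ (show t ∈ Ioc 0 (M * Δ) from ⟨htpos, ht.2⟩)
  obtain ⟨n, rfl⟩ := Nat.exists_eq_add_of_le' (Finset.mem_Icc.1 hk).1
  have hnM := (Finset.mem_Icc.1 hk).2
  obtain ⟨ht1, ht2⟩ := htk
  push_cast at ht1 ht2
  -- For `t ∈ (nΔ,(n+1)Δ]` one has `s n ≤ t ≤ s (n + 2)`, hence the image of `t` lies between `nΔ`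
  -- and `(n+2)Δ` and the displacement is at most `2Δ`. In the last bin the end point replaces `s (n
  -- + 2)`.
  have hlow : n * Δ ≤ gridTimeChange s Δ M t := by
    rw [← gridTimeChange_apply hlt (show n ≤ M by omega)]
    refine hμ.strictMono.monotoneOn (hmem n (by omega)) ht ?_
    rcases Nat.eq_zero_or_pos n with rfl | hpos
    · rw [h0]; exact ht.1
    · have := (hs n (Finset.mem_Icc.2 ⟨hpos, by omega⟩)).2
      linarith
  have hup : gridTimeChange s Δ M t ≤ (n + 2) * Δ := by
    rcases hnM.lt_or_eq with hlt' | heq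
    · have h1 := gridTimeChange_apply (Δ := Δ) hlt (show n + 2 ≤ M by omega)
      push_cast at h1
      rw [← h1]
      refine hμ.strictMono.monotoneOn ht (hmem (n + 2) (by omega)) ?_
      have := (hs (n + 2) (Finset.mem_Icc.2 ⟨by omega, by omega⟩)).1
      push_cast at this
      linarith
    · have h1 := hμ.strictMono.monotoneOn ht ⟨by positivity, le_rfl⟩ ht.2
      rw [hμ.map_end] at h1
      have hcast : (M : ℝ) = n + 1 := by rw [← heq]; push_cast; ring
      rw [hcast] at h1
      linarith
  rw [abs_le]
  constructor <;> linarith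

end TimeChange

/-! ### Comparison of the two risks on one path -/

section Path

variable {Q : Measure (ℝ × ℝ × ℝ)} {h ψ b : ℝ → ℝ} {Δ : ℝ} {M : ℕ}

/-- A mass below 2 is 0 or 1. If there is an atom its time is taken, and the rest of `A` has mass 0;
otherwise any time in the bin will do, here its right end. -/
theorem IsSimpleConfiguration.exists_time (hQ : IsSimpleConfiguration Q) (hΔ : 0 < Δ) (n : ℕ)
    {A : Set (ℝ × ℝ × ℝ)} (hA : MeasurableSet A) (hAn : ∀ p ∈ A, p.1 ∈ timeBin Δ n) :
    ∃ s ∈ timeBin Δ n, Q A < 2 → Q (A ∩ {p | p.1 ≠ s}) = 0 := by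
  have hn : (n : ℝ) * Δ ∈ timeBin Δ n := ⟨by linarith, le_rfl⟩
  by_cases h2 : Q A < 2
  swap
  · exact ⟨_, hn, fun h => absurd h h2⟩
  by_cases h0 : Q A = 0
  · exact ⟨_, hn, fun _ => measure_mono_null inter_subset_left h0⟩
  obtain ⟨I, x, hx⟩ := hQ.atoms
  obtain ⟨i, hi⟩ : ∃ i : I, x i ∈ A := by
    by_contra! hcon
    refine h0 ?_
    rw [hx, Measure.sum_apply _ hA]
    simp [hA, hcon]
  refine ⟨(x i).1, hAn _ hi, fun _ => ?_⟩
  have hS : MeasurableSet {p : ℝ × ℝ × ℝ | p.1 = (x i).1} :=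
    measurableSet_eq_fun measurable_fst measurable_const
  have h1 : 1 ≤ Q (A ∩ {p | p.1 = (x i).1}) := by
    rw [hx]
    refine le_trans ?_ (Measure.le_sum_apply _ _)
    refine le_trans ?_ (ENNReal.le_tsum i)
    rw [Measure.dirac_apply_of_mem]
    exact ⟨hi, rfl⟩
  have hsplit := measure_inter_add_sdiff (μ := Q) A hS
  have hB : A ∩ {p | p.1 ≠ (x i).1} = A \ {p | p.1 = (x i).1} := rfl
  rw [hB]
  have hfin : Q (A \ {p | p.1 = (x i).1}) ≠ ∞ :=
    ((measure_mono sdiff_subset).trans_lt (h2.trans (by simp))).ne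
  obtain ⟨m, hm⟩ := hQ.exists_natCast (hA.diff hS) hfin
  have h3 : (1 : ℝ≥0∞) + m < 2 := by
    rw [← hm]
    exact (add_le_add h1 le_rfl).trans_lt (hsplit.trans_lt h2)
  have h4 : 1 + m < 2 := by exact_mod_cast h3
  rw [hm]
  have : m = 0 := by omega
  simp [this]

/-- The bound counts the mismatched points over all of `(0,T]` so as to be independent of `t`, as
the supremum in the Skorokhod distance requires. -/
theorem IsSimpleConfiguration.abs_hawkesRisk_sub_le (hQ : IsSimpleConfiguration Q) {ℓ ℓ' : ℝ → ℝ}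
    (hℓ : Measurable ℓ) (hℓ' : Measurable ℓ') {T : ℝ} (hfin : Q (acceptedPoints (Ioc 0 T) ℓ) < ∞)
    (hfin' : Q (acceptedPoints (Ioc 0 T) ℓ') < ∞) {t : ℝ} (ht : t ≤ T) :
    ENNReal.ofReal |hawkesRisk Q ℓ t - hawkesRisk Q ℓ' t| ≤
      ∫⁻ p, (Ioc 0 T).indicator 1 p.1 * discrepancy (ℓ p.1) (ℓ' p.1) p.2.1 *
        ENNReal.ofReal |p.2.2| ∂Q := by
  have hA : MeasurableSet (acceptedPoints (Ioc 0 t) ℓ) :=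
    measurableSet_acceptedPoints measurableSet_Ioc hℓ
  have hA' : MeasurableSet (acceptedPoints (Ioc 0 t) ℓ') :=
    measurableSet_acceptedPoints measurableSet_Ioc hℓ'
  have hsub : ∀ r : ℝ → ℝ, acceptedPoints (Ioc 0 t) r ⊆ acceptedPoints (Ioc 0 T) r :=
    fun r p hp => ⟨⟨hp.1.1, hp.1.2.trans ht⟩, hp.2⟩
  have hy : Measurable fun p : ℝ × ℝ × ℝ => p.2.2 := by fun_prop
  rw [hawkesRisk, hawkesRisk, ← integral_indicator hA, ← integral_indicator hA', ← integral_sub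
    ((hQ.integrableOn hA ((measure_mono (hsub _)).trans_lt hfin) hy).integrable_indicator hA)
    ((hQ.integrableOn hA' ((measure_mono (hsub _)).trans_lt hfin') hy).integrable_indicator hA'),
    ← Real.enorm_eq_ofReal_abs]
  refine (enorm_integral_le_lintegral_enorm _).trans (lintegral_mono fun p => ?_)
  by_cases hp : p.1 ∈ Ioc 0 t
  · have hpT : p.1 ∈ Ioc 0 T := ⟨hp.1, hp.2.trans ht⟩
    have h1 : ∀ r : ℝ → ℝ, (acceptedPoints (Ioc 0 t) r).indicator (fun p => p.2.2) p =
        (Icc 0 (r p.1)).indicator (fun _ => p.2.2) p.2.1 := by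
      intro r
      by_cases hθ : p.2.1 ∈ Icc 0 (r p.1)
      · rw [indicator_of_mem hθ, indicator_of_mem]
        exact ⟨hp, hθ.1, hθ.2⟩
      · rw [indicator_of_notMem hθ, indicator_of_notMem]
        exact fun hq => hθ ⟨hq.2.1, hq.2.2⟩
    rw [h1, h1, indicator_of_mem hpT, Pi.one_apply, one_mul, discrepancy,
      ← Real.enorm_eq_ofReal_abs]
    by_cases hθ : p.2.1 ∈ Icc 0 (ℓ p.1) <;> by_cases hθ' : p.2.1 ∈ Icc 0 (ℓ' p.1)
    · rw [indicator_of_mem hθ, indicator_of_mem hθ', sub_self, enorm_zero]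
      exact zero_le
    · rw [indicator_of_mem hθ, indicator_of_notMem hθ', sub_zero,
        indicator_of_mem (show p.2.1 ∈ symmDiff _ _ from Or.inl ⟨hθ, hθ'⟩), Pi.one_apply, one_mul]
    · rw [indicator_of_notMem hθ, indicator_of_mem hθ', zero_sub, enorm_neg,
        indicator_of_mem (show p.2.1 ∈ symmDiff _ _ from Or.inr ⟨hθ', hθ⟩), Pi.one_apply, one_mul]
    · rw [indicator_of_notMem hθ, indicator_of_notMem hθ', sub_zero, enorm_zero]
      exact zero_le
  · rw [indicator_of_notMem fun hq => hp hq.1, indicator_of_notMem fun hq => hp hq.1, sub_zero,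
      enorm_zero]
    exact zero_le

/-- Total absolute mark of the points of the bin `k` accepted in the discrete process. -/
noncomputable def binTotal (Q : Measure (ℝ × ℝ × ℝ)) (h ψ b : ℝ → ℝ) (Δ : ℝ) (k : ℕ) : ℝ≥0∞ :=
  ∫⁻ p in acceptedPoints (timeBin Δ k) (fun _ => discreteIntensity Q h ψ b Δ k),
    ENNReal.ofReal |p.2.2| ∂Q

theorem IsSimpleConfiguration.hawkesRisk_stepIntensity (hQ : IsSimpleConfiguration Q) (hΔ : 0 < Δ)
    {t : ℝ} (ht : t ≤ M * Δ) : hawkesRisk Q (stepIntensity Q h ψ b Δ M) t =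
      ∑ k ∈ Finset.Icc 1 M, ∫ p in acceptedPoints (timeBin Δ k)
        (fun _ => discreteIntensity Q h ψ b Δ k), {p : ℝ × ℝ × ℝ | p.1 ≤ t}.indicator
          (fun p => p.2.2) p ∂Q := by
  have hS : MeasurableSet {p : ℝ × ℝ × ℝ | p.1 ≤ t} := measurableSet_le measurable_fst measurable_const
  rw [← hQ.setIntegral_stepIntensity hΔ le_rfl
    (Measurable.indicator (by fun_prop) hS), setIntegral_indicator hS, hawkesRisk]
  congr 2
  ext p
  constructor
  · exact fun hp => ⟨⟨⟨hp.1.1, hp.1.2.trans ht⟩, hp.2⟩, hp.1.2⟩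
  · exact fun hp => ⟨⟨hp.1.1.1, hp.2⟩, hp.1.2⟩

theorem discreteRisk_eq_sum (hΔ : 0 < Δ) {u : ℝ} (hu : u ∈ Icc 0 (M * Δ)) :
    discreteRisk Q h ψ b Δ u = ∑ k ∈ Finset.Icc 1 M, if (k : ℝ) * Δ ≤ u then
      ∫ p in acceptedPoints (timeBin Δ k) (fun _ => discreteIntensity Q h ψ b Δ k), p.2.2 ∂Q
        else 0 := by
  rw [discreteRisk, ← Finset.sum_filter]
  congr 1
  ext k
  have h1 : k ≤ ⌊u / Δ⌋₊ ↔ (k : ℝ) * Δ ≤ u := by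
    rw [Nat.le_floor_iff (div_nonneg hu.1 hΔ.le), le_div_iff₀ hΔ]
  simp only [Finset.mem_Icc, Finset.mem_filter, h1]
  constructor
  · rintro ⟨h2, h3⟩
    refine ⟨⟨h2, ?_⟩, h3⟩
    have := le_of_mul_le_mul_right (h3.trans hu.2) hΔ
    exact_mod_cast this
  · exact fun h2 => ⟨h2.1.1, h2.2⟩

/-- The hypothesis `hsu` synchronises the times: `u` has passed the grid point `kΔ` exactly when `t`
has passed `s k`. Bins lying entirely before or after `t` then contribute equally to both risks, and
so does the bin of `t` if all its accepted points sit at `s k`. Hence a maximum over the unmatched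
bins rather than a sum. -/
theorem IsSimpleConfiguration.abs_sub_discreteRisk_le (hQ : IsSimpleConfiguration Q) (hΔ : 0 < Δ)
    {s : ℕ → ℝ} (hs : ∀ k ∈ Finset.Icc 1 M, s k ∈ timeBin Δ k)
    (hsQ : ∀ k ∈ Finset.Icc 1 M, k ≠ M →
      Q (acceptedPoints (timeBin Δ k) (fun _ => discreteIntensity Q h ψ b Δ k)) < 2 →
      Q (acceptedPoints (timeBin Δ k) (fun _ => discreteIntensity Q h ψ b Δ k) ∩
        {p | p.1 ≠ s k}) = 0)
    {t u : ℝ} (ht : t ∈ Icc 0 (M * Δ)) (hu : u ∈ Icc 0 (M * Δ))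
    (hsu : ∀ k ∈ Finset.Icc 1 M, (k : ℝ) * Δ ≤ u ↔ s k ≤ t) {B : ℝ≥0∞}
    (hB : ∀ k ∈ Finset.Icc 1 M, (k = M ∨
      2 ≤ Q (acceptedPoints (timeBin Δ k) (fun _ => discreteIntensity Q h ψ b Δ k))) →
      binTotal Q h ψ b Δ k ≤ B) :
    ENNReal.ofReal |hawkesRisk Q (stepIntensity Q h ψ b Δ M) t - discreteRisk Q h ψ b Δ u| ≤ B := by
  set A : ℕ → Set (ℝ × ℝ × ℝ) := fun k =>
    acceptedPoints (timeBin Δ k) (fun _ => discreteIntensity Q h ψ b Δ k) with hAdef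
  have hAm : ∀ k, MeasurableSet (A k) := fun k =>
    measurableSet_acceptedPoints (measurableSet_timeBin Δ k) measurable_const
  have hAfin : ∀ k, Q (A k) < ∞ := fun k =>
    hQ.acceptedPoints_const_lt_top (timeBin_subset_Iic Δ k) _
  have hS : MeasurableSet {p : ℝ × ℝ × ℝ | p.1 ≤ t} := measurableSet_le measurable_fst measurable_const
  have hy : Measurable fun p : ℝ × ℝ × ℝ => p.2.2 := by fun_prop
  set e : ℕ → ℝ := fun k => ∫ p in A k, ({p : ℝ × ℝ × ℝ | p.1 ≤ t}.indicator (fun p => p.2.2) p -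
    if s k ≤ t then p.2.2 else 0) ∂Q with he
  have hsum : hawkesRisk Q (stepIntensity Q h ψ b Δ M) t - discreteRisk Q h ψ b Δ u =
      ∑ k ∈ Finset.Icc 1 M, e k := by
    rw [hQ.hawkesRisk_stepIntensity hΔ ht.2, discreteRisk_eq_sum hΔ hu, ← Finset.sum_sub_distrib]
    refine Finset.sum_congr rfl fun k hk => ?_
    simp only [he, hsu k hk]
    rw [integral_sub (hQ.integrableOn (hAm k) (hAfin k) (hy.indicator hS))]
    · split_ifs <;> simp [hAdef]
    · split_ifs
      · exact hQ.integrableOn (hAm k) (hAfin k) hy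
      · exact integrable_zero _ _ _
  have hezero : ∀ k ∈ Finset.Icc 1 M, t ∉ timeBin Δ k → e k = 0 := by
    intro k hk htk
    have : e k = ∫ p in A k, (0 : ℝ) ∂Q := by
      refine setIntegral_congr_fun (hAm k) fun p hp => ?_
      have hp1 : p.1 ∈ timeBin Δ k := hp.1
      have hsk := hs k hk
      have hiff : p.1 ≤ t ↔ s k ≤ t := by
        by_cases htk' : t ≤ (k - 1) * Δ
        · exact ⟨fun h => absurd (h.trans htk') (not_le.2 hp1.1),
            fun h => absurd (h.trans htk') (not_le.2 hsk.1)⟩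
        · have hkt : k * Δ < t := by
            by_contra! hcon
            exact htk ⟨not_le.1 htk', hcon⟩
          exact ⟨fun _ => hsk.2.trans hkt.le, fun _ => hp1.2.trans hkt.le⟩
      simp only [indicator_apply, mem_ofPred_eq, hiff, sub_self]
    rw [this, integral_zero]
  have hebound : ∀ k ∈ Finset.Icc 1 M, ENNReal.ofReal |e k| ≤ B := by
    intro k hk
    by_cases hbad : k = M ∨ 2 ≤ Q (A k)
    · refine le_trans ?_ (hB k hk hbad)
      rw [← Real.enorm_eq_ofReal_abs]
      refine (enorm_integral_le_lintegral_enorm _).trans (lintegral_mono fun p => ?_)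
      rw [← Real.enorm_eq_ofReal_abs, indicator_apply]
      split_ifs <;> simp
    · rw [not_or, not_le] at hbad
      have h0 := hsQ k hk hbad.1 hbad.2
      have : e k = 0 := by
        refine integral_eq_zero_of_ae ?_
        have h1 : ∀ᵐ p ∂(Q.restrict (A k)), p.1 = s k := by
          rw [ae_iff, Measure.restrict_apply]
          · rwa [inter_comm]
          · exact (measurableSet_eq_fun measurable_fst measurable_const).compl
        filter_upwards [h1] with p hp
        simp only [indicator_apply, mem_ofPred_eq, hp, sub_self, Pi.zero_apply]
      rw [this]; simp
  rw [hsum]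
  by_cases hex : ∃ k ∈ Finset.Icc 1 M, t ∈ timeBin Δ k
  · obtain ⟨k, hk, htk⟩ := hex
    rw [Finset.sum_eq_single_of_mem k hk]
    · exact hebound k hk
    · exact fun j hj hjk => hezero j hj fun htj =>
        Set.disjoint_left.1 (disjoint_timeBin hΔ hjk) htj htk
  · rw [Finset.sum_eq_zero fun k hk => hezero k hk fun htk => hex ⟨k, hk, htk⟩]
    simp

/-- The Skorokhod distance of the two risks is controlled by the points accepted in only one of
the two processes and by the bins in which the time change cannot match the jumps. -/
theorem IsSimpleConfiguration.skorokhodDist_le (hQ : IsSimpleConfiguration Q) (hΔ : 0 < Δ)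
    (hM : 1 ≤ M) {ℓ : ℝ → ℝ} (hℓ : Measurable ℓ) (hfin : Q (acceptedPoints (Ioc 0 (M * Δ)) ℓ) < ∞)
    {B : ℝ≥0∞} (hB : ∀ k ∈ Finset.Icc 1 M, (k = M ∨
      2 ≤ Q (acceptedPoints (timeBin Δ k) (fun _ => discreteIntensity Q h ψ b Δ k))) →
      binTotal Q h ψ b Δ k ≤ B) :
    skorokhodDist (M * Δ) (hawkesRisk Q ℓ) (discreteRisk Q h ψ b Δ) ≤
      ENNReal.ofReal (2 * Δ) + (∫⁻ p, (Ioc 0 (M * Δ)).indicator 1 p.1 *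
        discrepancy (ℓ p.1) (stepIntensity Q h ψ b Δ M p.1) p.2.1 * ENNReal.ofReal |p.2.2| ∂Q) +
        B := by
  have hex := fun k : ℕ => hQ.exists_time hΔ k
    (A := acceptedPoints (timeBin Δ k) (fun _ => discreteIntensity Q h ψ b Δ k))
    (measurableSet_acceptedPoints (measurableSet_timeBin Δ k) measurable_const) fun p hp => hp.1
  choose σ hσ hσQ using hex
  -- A time change fixes `T`, so the chosen time in the last bin is forced to be `MΔ`; for this
  -- reason the bin `M` always counts as unmatched.
  set s : ℕ → ℝ := fun k => if k = 0 then 0 else if k = M then M * Δ else σ k with hsdef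
  have hsmem : ∀ k ∈ Finset.Icc 1 M, s k ∈ timeBin Δ k := by
    intro k hk
    have hk0 : k ≠ 0 := by have := (Finset.mem_Icc.1 hk).1; omega
    simp only [hsdef, if_neg hk0]
    split_ifs with hkM
    · rw [hkM]; exact ⟨by linarith, le_rfl⟩
    · exact hσ k
  have hM0 : M ≠ 0 := by omega
  obtain ⟨μ, hμ, hμs, hμt⟩ := exists_isTimeChange hΔ hsmem (by simp [hsdef]) (by simp [hsdef, hM0])
  have hmaps : ∀ t ∈ Icc 0 (M * Δ), μ t ∈ Icc 0 (M * Δ) := by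
    intro t ht
    have hT : (0 : ℝ) ≤ M * Δ := by positivity
    constructor
    · rw [← hμ.map_zero]
      exact hμ.strictMono.monotoneOn ⟨le_rfl, hT⟩ ht ht.1
    · exact (hμ.strictMono.monotoneOn ht ⟨hT, le_rfl⟩ ht.2).trans_eq hμ.map_end
  have hfin' : Q (acceptedPoints (Ioc 0 (M * Δ)) (stepIntensity Q h ψ b Δ M)) < ∞ := by
    rw [acceptedPoints_stepIntensity hΔ le_rfl]
    exact measure_biUnion_lt_top (Finset.finite_toSet _) fun k _ =>
      hQ.acceptedPoints_const_lt_top (timeBin_subset_Iic Δ k) _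
  refine (iInf₂_le μ hμ).trans (max_le ?_ ?_)
  · refine iSup₂_le fun t ht => (ENNReal.ofReal_le_ofReal (hμt t ht)).trans ?_
    rw [add_assoc]
    exact le_self_add
  · refine iSup₂_le fun t ht => ?_
    have h1 := hQ.abs_hawkesRisk_sub_le hℓ (measurable_stepIntensity Q h ψ b Δ M) hfin hfin' ht.2
    have h2 := hQ.abs_sub_discreteRisk_le (t := t) (u := μ t) hΔ hsmem (fun k hk hkM hlt => by
      have hk0 : k ≠ 0 := by have := (Finset.mem_Icc.1 hk).1; omega
      simpa only [hsdef, if_neg hk0, if_neg hkM] using hσQ k hlt) ht (hmaps t ht)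
      (fun k hk => by
        rw [← hμs k (Finset.mem_Icc.1 hk).2]
        exact hμ.strictMono.le_iff_le
          (Ioc_subset_Icc_self (timeBin_subset hΔ hk (hsmem k hk))) ht) hB
    refine le_trans ?_ (add_le_add (h1.trans le_add_self) h2)
    rw [← ENNReal.ofReal_add (abs_nonneg _) (abs_nonneg _)]
    exact ENNReal.ofReal_le_ofReal (abs_sub_le _ _ _)

end Path

/-! ### Bins with two points -/

/-- Cauchy–Schwarz, by integrating `2|f p||f q| ≤ f(p)² + f(q)²` over pairs. -/
theorem sq_lintegral_abs_le {α : Type*} [MeasurableSpace α] (η : Measure α) [IsFiniteMeasure η]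
    {f : α → ℝ} (hf : Measurable f) :
    (∫⁻ p, ENNReal.ofReal |f p| ∂η) ^ 2 ≤ η univ * ∫⁻ p, ENNReal.ofReal (f p ^ 2) ∂η := by
  have hfm : Measurable fun p => ENNReal.ofReal |f p| := by fun_prop
  have hfm2 : Measurable fun p => ENNReal.ofReal (f p ^ 2) := by fun_prop
  have h1 : 2 * (∫⁻ p, ENNReal.ofReal |f p| ∂η) ^ 2 =
      ∫⁻ p, ∫⁻ q, 2 * (ENNReal.ofReal |f p| * ENNReal.ofReal |f q|) ∂η ∂η := by
    rw [sq, ← lintegral_mul_const _ hfm, ← lintegral_const_mul _ (hfm.mul_const _)]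
    refine lintegral_congr fun p => ?_
    rw [lintegral_const_mul _ (hfm.const_mul _), lintegral_const_mul _ hfm]
  have h2 : ∫⁻ p, ∫⁻ q, (ENNReal.ofReal (f p ^ 2) + ENNReal.ofReal (f q ^ 2)) ∂η ∂η =
      2 * (η univ * ∫⁻ p, ENNReal.ofReal (f p ^ 2) ∂η) := by
    simp_rw [lintegral_add_left measurable_const, lintegral_const]
    rw [lintegral_add_right _ measurable_const, lintegral_const, lintegral_mul_const _ hfm2]
    ring
  rw [← ENNReal.mul_le_mul_iff_right (a := 2) (by simp) (by simp), h1, ← h2]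
  refine lintegral_mono fun p => lintegral_mono fun q => ?_
  rw [← ENNReal.ofReal_mul (abs_nonneg _), ← ENNReal.ofReal_add (sq_nonneg _) (sq_nonneg _),
    show (2 : ℝ≥0∞) = ENNReal.ofReal 2 by simp, ← ENNReal.ofReal_mul (by norm_num)]
  refine ENNReal.ofReal_le_ofReal ?_
  rw [← sq_abs (f p), ← sq_abs (f q)]
  nlinarith [sq_nonneg (|f p| - |f q|)]

/-- If at least two points are present and no two at the same time, the square of the total mark
is controlled by the ordered pairs of points. -/
theorem sq_lintegral_abs_le_pairs (η : Measure (ℝ × ℝ × ℝ)) [IsFiniteMeasure η]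
    (hη : ∀ t : ℝ, η {p | p.1 = t} ≤ 1) (h2 : 2 ≤ η univ) {f : ℝ × ℝ × ℝ → ℝ} (hf : Measurable f) :
    (∫⁻ p, ENNReal.ofReal |f p| ∂η) ^ 2 ≤
      2 * ((∫⁻ p, ENNReal.ofReal (f p ^ 2) * (∫⁻ _ in {q | q.1 < p.1}, 1 ∂η) ∂η) +
        ∫⁻ p, (∫⁻ q in {q | q.1 < p.1}, ENNReal.ofReal (f q ^ 2) ∂η) ∂η) := by
  have hfm2 : Measurable fun p => ENNReal.ofReal (f p ^ 2) := by fun_prop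
  have hlt : ∀ t : ℝ, MeasurableSet {q : ℝ × ℝ × ℝ | q.1 < t} := fun t =>
    measurableSet_lt measurable_fst measurable_const
  have hgt : ∀ t : ℝ, MeasurableSet {q : ℝ × ℝ × ℝ | t < q.1} := fun t =>
    measurableSet_lt measurable_const measurable_fst
  -- At most one point sits at time `t`, so with at least two points present the others make up at
  -- least half of the total. This removes the diagonal at the cost of a factor 2.
  have hcount : ∀ t : ℝ, η univ ≤ 2 * (η {q | q.1 < t} + η {q | t < q.1}) := by
    intro t
    have h3 : η univ ≤ 1 + (η {q | q.1 < t} + η {q | t < q.1}) := by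
      have : (univ : Set (ℝ × ℝ × ℝ)) = {q | q.1 = t} ∪ ({q | q.1 < t} ∪ {q | t < q.1}) := by
        ext q
        simp only [mem_univ, mem_union, mem_ofPred_eq, true_iff]
        rcases lt_trichotomy q.1 t with h | h | h
        · exact Or.inr (Or.inl h)
        · exact Or.inl h
        · exact Or.inr (Or.inr h)
      rw [this]
      exact (measure_union_le _ _).trans (add_le_add (hη t) (measure_union_le _ _))
    have h4 : 1 ≤ η {q | q.1 < t} + η {q | t < q.1} := by
      have h5 := h2.trans h3
      rw [← one_add_one_eq_two] at h5
      exact (ENNReal.add_le_add_iff_left (by simp)).1 h5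
    exact h3.trans ((add_le_add h4 le_rfl).trans_eq (two_mul _).symm)
  -- Exchanging the two points replaces the later points by the earlier ones: the inner integral
  -- must run over the strict past in order to be predictable.
  have hswap : ∫⁻ p, ENNReal.ofReal (f p ^ 2) * η {q | p.1 < q.1} ∂η =
      ∫⁻ p, (∫⁻ q in {q | q.1 < p.1}, ENNReal.ofReal (f q ^ 2) ∂η) ∂η := by
    have hm : Measurable fun x : (ℝ × ℝ × ℝ) × (ℝ × ℝ × ℝ) =>
        {x : (ℝ × ℝ × ℝ) × (ℝ × ℝ × ℝ) | x.1.1 < x.2.1}.indicator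
          (fun x => ENNReal.ofReal (f x.1 ^ 2)) x :=
      Measurable.indicator (by fun_prop)
        (measurableSet_lt (by fun_prop) (by fun_prop))
    calc ∫⁻ p, ENNReal.ofReal (f p ^ 2) * η {q | p.1 < q.1} ∂η
        = ∫⁻ p, ∫⁻ q, {x : (ℝ × ℝ × ℝ) × (ℝ × ℝ × ℝ) | x.1.1 < x.2.1}.indicator
          (fun x => ENNReal.ofReal (f x.1 ^ 2)) (p, q) ∂η ∂η := by
          refine lintegral_congr fun p => ?_
          rw [← setLIntegral_const, ← lintegral_indicator (hgt _)]
          rfl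
      _ = ∫⁻ q, ∫⁻ p, {x : (ℝ × ℝ × ℝ) × (ℝ × ℝ × ℝ) | x.1.1 < x.2.1}.indicator
          (fun x => ENNReal.ofReal (f x.1 ^ 2)) (p, q) ∂η ∂η :=
          lintegral_lintegral_swap hm.aemeasurable
      _ = _ := by
          refine lintegral_congr fun q => ?_
          rw [← lintegral_indicator (hlt _)]
          rfl
  have hmgt : Measurable fun p : ℝ × ℝ × ℝ => η {q | q.1 < p.1} := by
    have : Measurable fun t : ℝ => η {q | q.1 < t} :=
      Monotone.measurable fun s t hst => measure_mono fun q hq => lt_of_lt_of_le hq hst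
    exact this.comp measurable_fst
  calc (∫⁻ p, ENNReal.ofReal |f p| ∂η) ^ 2
      ≤ η univ * ∫⁻ p, ENNReal.ofReal (f p ^ 2) ∂η := sq_lintegral_abs_le η hf
    _ = ∫⁻ p, ENNReal.ofReal (f p ^ 2) * η univ ∂η := by
        rw [lintegral_mul_const _ hfm2, mul_comm]
    _ ≤ ∫⁻ p, 2 * (ENNReal.ofReal (f p ^ 2) * η {q | q.1 < p.1} +
          ENNReal.ofReal (f p ^ 2) * η {q | p.1 < q.1}) ∂η := by
        refine lintegral_mono fun p => ?_
        refine (mul_le_mul_right (hcount p.1) _).trans_eq ?_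
        ring
    _ = _ := by
        have hm : Measurable fun p => ENNReal.ofReal (f p ^ 2) * η {q | q.1 < p.1} := hfm2.mul hmgt
        rw [lintegral_const_mul' _ _ (by simp), lintegral_add_left hm, hswap]
        simp

/-- Sum over the ordered pairs of points accepted in the bin `k` of the product of a function of
the later and a function of the earlier mark. -/
noncomputable def pairSum (Q : Measure (ℝ × ℝ × ℝ)) (h ψ b : ℝ → ℝ) (Δ : ℝ) (k : ℕ)
    (g₁ g₂ : ℝ → ℝ≥0∞) : ℝ≥0∞ :=
  ∫⁻ p, (timeBin Δ k).indicator 1 p.1 * acceptance (discreteIntensity Q h ψ b Δ k) p.2.1 *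
    g₁ p.2.2 * (∫⁻ q in {q | q.1 < p.1}, (timeBin Δ k).indicator 1 q.1 *
      acceptance (discreteIntensity Q h ψ b Δ k) q.2.1 * g₂ q.2.2 ∂Q) ∂Q

section Path

variable {Q : Measure (ℝ × ℝ × ℝ)} {h ψ b : ℝ → ℝ} {Δ : ℝ} {M : ℕ}

theorem pairSum_eq (k : ℕ) (g₁ g₂ : ℝ → ℝ≥0∞) : pairSum Q h ψ b Δ k g₁ g₂ =
    ∫⁻ p in acceptedPoints (timeBin Δ k) (fun _ => discreteIntensity Q h ψ b Δ k), g₁ p.2.2 *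
      (∫⁻ q in {q | q.1 < p.1}, g₂ q.2.2
        ∂(Q.restrict (acceptedPoints (timeBin Δ k) (fun _ => discreteIntensity Q h ψ b Δ k)))) ∂Q := by
  rw [pairSum, setLIntegral_acceptedPoints (measurableSet_timeBin Δ k) measurable_const]
  refine lintegral_congr fun p => ?_
  have hlt : MeasurableSet {q : ℝ × ℝ × ℝ | q.1 < p.1} :=
    measurableSet_lt measurable_fst measurable_const
  rw [mul_assoc, ← setLIntegral_acceptedPoints (measurableSet_timeBin Δ k) measurable_const,
    Measure.restrict_restrict hlt, Measure.restrict_restrict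
      (measurableSet_acceptedPoints (measurableSet_timeBin Δ k) measurable_const), inter_comm]

/-- The total mark of a bin with at least two accepted points. -/
theorem IsSimpleConfiguration.sq_binTotal_le (hQ : IsSimpleConfiguration Q) {k : ℕ}
    (h2 : 2 ≤ Q (acceptedPoints (timeBin Δ k) (fun _ => discreteIntensity Q h ψ b Δ k))) :
    binTotal Q h ψ b Δ k ^ 2 ≤ 2 * (pairSum Q h ψ b Δ k (fun y => ENNReal.ofReal (y ^ 2)) 1 +
      pairSum Q h ψ b Δ k 1 (fun y => ENNReal.ofReal (y ^ 2))) := by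
  set A := acceptedPoints (timeBin Δ k) (fun _ => discreteIntensity Q h ψ b Δ k) with hA
  have : IsFiniteMeasure (Q.restrict A) :=
    ⟨by rw [Measure.restrict_apply_univ]
        exact hQ.acceptedPoints_const_lt_top (timeBin_subset_Iic Δ k) _⟩
  have h3 := sq_lintegral_abs_le_pairs (Q.restrict A)
    (fun t => (Measure.restrict_apply_le _ _).trans (hQ.time_le_one t))
    (by rwa [Measure.restrict_apply_univ]) (f := fun p => p.2.2) (by fun_prop)
  rw [pairSum_eq, pairSum_eq, binTotal]
  simpa [← hA] using h3

/-- Trades a first power for a square, so that a maximum over bins can be bounded by a sum of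
squares. It is applied with `x` equal to `√Δ` times a random majorant of the intensity. -/
theorem ENNReal.le_add_sq_div {S x : ℝ≥0∞} (hx : x ≠ 0) (hx' : x ≠ ∞) : S ≤ x + S ^ 2 / x := by
  rcases le_total S x with hle | hle
  · exact hle.trans le_self_add
  · refine le_trans ?_ le_add_self
    rw [ENNReal.le_div_iff_mul_le (Or.inl hx) (Or.inl hx'), sq]
    gcongr

/-- A majorant of the discrete intensities of the bins up to `k`, known at the beginning of the
bin `k`. -/
noncomputable def intensityMajorant (Q : Measure (ℝ × ℝ × ℝ)) (h ψ b : ℝ → ℝ) (Δ : ℝ) (L : ℝ≥0)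
    (H : ℝ) (k : ℕ) : ℝ≥0∞ :=
  -- The summand 1 keeps the majorant away from zero, so that it can be divided by.
  1 + ENNReal.ofReal (ψ 0) +
    L * (ENNReal.ofReal H * ∑ j ∈ Finset.Ico 1 k, ENNReal.ofReal (discreteX Q h ψ b Δ j))

theorem intensityMajorant_mono (L : ℝ≥0) (H : ℝ) :
    Monotone (intensityMajorant Q h ψ b Δ L H) := by
  intro k k' hkk'
  unfold intensityMajorant
  gcongr

theorem intensityMajorant_ne_zero (L : ℝ≥0) (H : ℝ) (k : ℕ) :
    intensityMajorant Q h ψ b Δ L H k ≠ 0 := by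
  unfold intensityMajorant
  rw [add_assoc]
  simp

theorem intensityMajorant_ne_top (L : ℝ≥0) (H : ℝ) (k : ℕ) :
    intensityMajorant Q h ψ b Δ L H k ≠ ∞ := by
  unfold intensityMajorant
  have : ∑ j ∈ Finset.Ico 1 k, ENNReal.ofReal (discreteX Q h ψ b Δ j) ≠ ∞ :=
    (ENNReal.sum_lt_top.2 fun _ _ => ENNReal.ofReal_lt_top).ne
  finiteness

theorem ofReal_discreteIntensity_le_majorant {L : ℝ≥0} (hψ : LipschitzWith L ψ)
    (hb : ∀ y, 0 ≤ b y) (hΔ : 0 < Δ) {H : ℝ} (hH : ∀ t, 0 ≤ t → |h t| ≤ H) (k : ℕ) :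
    ENNReal.ofReal (discreteIntensity Q h ψ b Δ k) ≤ intensityMajorant Q h ψ b Δ L H k := by
  refine (ofReal_discreteIntensity_le hψ hb k).trans ?_
  unfold intensityMajorant
  rw [Finset.mul_sum (a := ENNReal.ofReal H)]
  refine add_le_add le_add_self ?_
  gcongr with j hj
  refine hH _ (mul_nonneg ?_ hΔ.le)
  rw [sub_nonneg]
  exact_mod_cast (Finset.mem_Ico.1 hj).2.le

/-- The bound on the bins in which the time change cannot match the jumps. -/
noncomputable def pairError (Q : Measure (ℝ × ℝ × ℝ)) (h ψ b : ℝ → ℝ) (Δ : ℝ) (L : ℝ≥0)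
    (H : ℝ) (M : ℕ) : ℝ≥0∞ :=
  ENNReal.ofReal √Δ * intensityMajorant Q h ψ b Δ L H M +
    (∑ k ∈ Finset.Icc 1 M, 2 * (ENNReal.ofReal √Δ)⁻¹ * ((intensityMajorant Q h ψ b Δ L H k)⁻¹ *
      pairSum Q h ψ b Δ k (fun y => ENNReal.ofReal (y ^ 2)) 1 +
      (intensityMajorant Q h ψ b Δ L H k)⁻¹ *
        pairSum Q h ψ b Δ k 1 (fun y => ENNReal.ofReal (y ^ 2)))) +
    binTotal Q h ψ b Δ M

theorem IsSimpleConfiguration.binTotal_le_pairError (hQ : IsSimpleConfiguration Q) (hΔ : 0 < Δ)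
    (L : ℝ≥0) (H : ℝ) {k : ℕ} (hk : k ∈ Finset.Icc 1 M) (hbad : k = M ∨
      2 ≤ Q (acceptedPoints (timeBin Δ k) (fun _ => discreteIntensity Q h ψ b Δ k))) :
    binTotal Q h ψ b Δ k ≤ pairError Q h ψ b Δ L H M := by
  rcases hbad with rfl | h2
  · exact le_add_self
  have hc0 : ENNReal.ofReal √Δ ≠ 0 := by simpa using hΔ
  set U := intensityMajorant Q h ψ b Δ L H k with hU
  have hU0 : U ≠ 0 := intensityMajorant_ne_zero L H k
  have hU' : U ≠ ∞ := intensityMajorant_ne_top L H k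
  refine (ENNReal.le_add_sq_div (x := ENNReal.ofReal √Δ * U) (mul_ne_zero hc0 hU0)
    (ENNReal.mul_ne_top (by simp) hU')).trans ?_
  refine le_trans ?_ le_self_add
  -- The majorant increases with the bin, so the linear term is at most that of bin `M`, common to
  -- all bins; the quadratic terms are summed.
  refine add_le_add (mul_le_mul_right (intensityMajorant_mono L H (Finset.mem_Icc.1 hk).2) _) ?_
  refine le_trans ?_ (Finset.single_le_sum (f := fun k => 2 * (ENNReal.ofReal √Δ)⁻¹ *
    ((intensityMajorant Q h ψ b Δ L H k)⁻¹ *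
      pairSum Q h ψ b Δ k (fun y => ENNReal.ofReal (y ^ 2)) 1 +
      (intensityMajorant Q h ψ b Δ L H k)⁻¹ *
        pairSum Q h ψ b Δ k 1 (fun y => ENNReal.ofReal (y ^ 2)))) (fun _ _ => zero_le) hk)
  rw [ENNReal.div_eq_inv_mul, ENNReal.mul_inv (Or.inl hc0) (Or.inl (by simp))]
  refine (mul_le_mul_right (hQ.sq_binTotal_le h2) _).trans_eq ?_
  ring

end Path

/-! ### Means of the sums over pairs of points in a bin -/

section PairMean

variable {Ω : Type*} [mΩ : MeasurableSpace Ω] {Pr : Measure Ω} [IsProbabilityMeasure Pr]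
  {𝓖 : Filtration ℝ≥0 mΩ} {κ : Ω → Measure (ℝ × ℝ × ℝ)} {ν : Measure ℝ} [IsProbabilityMeasure ν]
  {h ψ b : ℝ → ℝ} {Δ : ℝ} {L : ℝ≥0}

theorem IsCompensatedProcess.measurable_intensityMajorant (hκ : IsCompensatedProcess Pr 𝓖 κ ν)
    (hΔ : 0 < Δ) (hψ : Measurable ψ) (hb_meas : Measurable b) (hb : ∀ y, 0 ≤ b y) (L : ℝ≥0) (H : ℝ)
    (n : ℕ) : Measurable[𝓖 (n * Δ).toNNReal]
      fun ω => intensityMajorant (κ ω) h ψ b Δ L H (n + 1) := by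
  have hX : ∀ j ∈ Finset.Ico 1 (n + 1), Measurable[𝓖 (n * Δ).toNNReal]
      fun ω => ENNReal.ofReal (discreteX (κ ω) h ψ b Δ j) := by
    intro j hj
    have hjn : (j : ℝ) ≤ n := by exact_mod_cast Nat.lt_succ_iff.1 (Finset.mem_Ico.1 hj).2
    have hle : (j : ℝ) * Δ ≤ n * Δ := by gcongr
    exact ((hκ.measurable_discrete hΔ hψ hb_meas hb j).1.mono
      (𝓖.mono (Real.toNNReal_le_toNNReal hle)) le_rfl).ennreal_ofReal
  unfold intensityMajorant
  let _ : MeasurableSpace Ω := 𝓖 (n * Δ).toNNReal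
  exact (((Finset.measurable_fun_sum _ hX).const_mul _).const_mul _).const_add _

theorem IsCompensatedProcess.measurable_lintegral_time_lt (hκ : IsCompensatedProcess Pr 𝓖 κ ν)
    {f : Ω × (ℝ × ℝ × ℝ) → ℝ≥0∞} (hf : Measurable f) :
    Measurable fun x : Ω × ℝ => ∫⁻ q in {q : ℝ × ℝ × ℝ | q.1 < x.2}, f (x.1, q) ∂(κ x.1) := by
  have := hκ.isSFiniteKernel
  simp_rw [setLIntegral_time_lt]
  have hm : Measurable fun z : (Ω × ℝ) × (ℝ × ℝ × ℝ) =>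
      {z : (Ω × ℝ) × (ℝ × ℝ × ℝ) | z.2.1 < z.1.2}.indicator (fun z => f (z.1.1, z.2)) z :=
    Measurable.indicator (by fun_prop) (measurableSet_lt (by fun_prop) (by fun_prop))
  exact Measurable.lintegral_kernel_prod_right (κ := hκ.kernel.comap Prod.fst measurable_fst)
    (f := fun (x : Ω × ℝ) q => {q : ℝ × ℝ × ℝ | q.1 < x.2}.indicator (fun q => f (x.1, q)) q) hm

theorem IsCompensatedProcess.measurable_pairSum (hκ : IsCompensatedProcess Pr 𝓖 κ ν)
    (hΔ : 0 < Δ) (hψ : Measurable ψ) (hb_meas : Measurable b) (hb : ∀ y, 0 ≤ b y) {k : ℕ}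
    (hk : 1 ≤ k) {g₁ g₂ : ℝ → ℝ≥0∞} (hg₁ : Measurable g₁) (hg₂ : Measurable g₂) :
    Measurable fun ω => pairSum (κ ω) h ψ b Δ k g₁ g₂ := by
  have hl := hκ.measurable_discreteIntensity (h := h) hΔ hψ hb_meas hb hk
  have hIm : Measurable ((timeBin Δ k).indicator (1 : ℝ → ℝ≥0∞)) :=
    measurable_one.indicator (measurableSet_timeBin Δ k)
  have hm : ∀ g : ℝ → ℝ≥0∞, Measurable g → Measurable fun x : Ω × (ℝ × ℝ × ℝ) =>
      (timeBin Δ k).indicator 1 x.2.1 *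
        acceptance (discreteIntensity (κ x.1) h ψ b Δ k) x.2.2.1 * g x.2.2.2 := fun g hg =>
    ((hIm.comp (by fun_prop)).mul (measurable_acceptance (hl.comp measurable_fst)
      (by fun_prop))).mul (by fun_prop)
  exact hκ.measurable_lintegral ((hm g₁ hg₁).mul ((hκ.measurable_lintegral_time_lt (hm g₂ hg₂)).comp
    (by fun_prop : Measurable fun x : Ω × (ℝ × ℝ × ℝ) => (x.1, x.2.1))))

/-- Mean of the weighted sum over the ordered pairs of points of one bin. -/
theorem IsCompensatedProcess.lintegral_pairSum_le (hκ : IsCompensatedProcess Pr 𝓖 κ ν)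
    (hΔ : 0 < Δ) (hψ : Measurable ψ) (hb_meas : Measurable b) (hb : ∀ y, 0 ≤ b y) {n : ℕ}
    {v : Ω → ℝ≥0∞} (hv : Measurable[𝓖 (n * Δ).toNNReal] v)
    (hvl : ∀ ω, v ω * ENNReal.ofReal (discreteIntensity (κ ω) h ψ b Δ (n + 1)) ≤ 1)
    {g₁ g₂ : ℝ → ℝ≥0∞} (hg₁ : Measurable g₁) (hg₂ : Measurable g₂) :
    ∫⁻ ω, v ω * pairSum (κ ω) h ψ b Δ (n + 1) g₁ g₂ ∂Pr ≤
      ENNReal.ofReal Δ * (ENNReal.ofReal Δ *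
        (∫⁻ ω, ENNReal.ofReal (discreteIntensity (κ ω) h ψ b Δ (n + 1)) ∂Pr) *
          ∫⁻ y, g₂ y ∂ν) * ∫⁻ y, g₁ y ∂ν := by
  set I : ℝ → ℝ≥0∞ := (timeBin Δ (n + 1)).indicator 1 with hI
  have hIm : Measurable I := measurable_one.indicator (measurableSet_timeBin Δ (n + 1))
  have hnM : n + 1 ∈ Finset.Icc 1 (n + 1) := Finset.mem_Icc.2 ⟨by omega, le_rfl⟩
  set c : Ω → ℝ → ℝ := fun ω => stepIntensity (κ ω) h ψ b Δ (n + 1) with hc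
  have hcm : Measurable[predictablePoints 𝓖] fun x : Ω × (ℝ × ℝ × ℝ) => c x.1 x.2.1 :=
    hκ.predictable_stepIntensity (h := h) hΔ hψ hb_meas hb (n + 1)
  have hcl : ∀ ω, ∀ s ∈ timeBin Δ (n + 1), c ω s = discreteIntensity (κ ω) h ψ b Δ (n + 1) :=
    fun ω s hs => stepIntensity_of_mem hΔ hnM hs
  -- The sum over the strictly earlier points is predictable, so compensation applies to the later
  -- point with this sum as a weight.
  set past : Ω → ℝ → ℝ≥0∞ := fun ω s => ∫⁻ q in {q : ℝ × ℝ × ℝ | q.1 < s},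
    I q.1 * acceptance (c ω q.1) q.2.1 * g₂ q.2.2 ∂(κ ω) with hpast
  have hpastm : Measurable[predictablePoints 𝓖] fun x : Ω × (ℝ × ℝ × ℝ) => past x.1 x.2.1 :=
    hκ.measurable_lintegral_lt (f := fun x => I x.2.1 * acceptance (c x.1 x.2.1) x.2.2.1 * g₂ x.2.2.2)
      (((hIm.comp measurable_predictablePoints_time).mul
        (measurable_acceptance hcm measurable_predictablePoints_height)).mul
        (hg₂.comp measurable_predictablePoints_mark))
  set w : Ω → ℝ → ℝ≥0∞ := fun ω s => I s *
    (Ioi (((n * Δ).toNNReal : ℝ≥0) : ℝ)).indicator (fun _ => v ω) s * past ω s with hw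
  have hwm : Measurable[predictablePoints 𝓖] fun x : Ω × (ℝ × ℝ × ℝ) => w x.1 x.2.1 :=
    ((hIm.comp measurable_predictablePoints_time).mul
      (measurable_predictablePoints_indicator hv)).mul hpastm
  have hweq : ∀ ω, ∀ s ∈ timeBin Δ (n + 1), w ω s = v ω * past ω s := by
    intro ω s hs
    have h2 : s ∈ Ioi (((n * Δ).toNNReal : ℝ≥0) : ℝ) := by
      rw [mem_Ioi, Real.coe_toNNReal _ (by positivity)]
      have := hs.1
      push_cast at this
      linarith
    simp only [hw, hI, indicator_of_mem hs, indicator_of_mem h2, Pi.one_apply, one_mul]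
  have hw0 : ∀ ω, ∀ s ∉ timeBin Δ (n + 1), w ω s = 0 := by
    intro ω s hs
    simp only [hw, hI, indicator_of_notMem hs, zero_mul]
  have hrewrite : ∀ ω, v ω * pairSum (κ ω) h ψ b Δ (n + 1) g₁ g₂ =
      ∫⁻ p, w ω p.1 * acceptance (c ω p.1) p.2.1 * g₁ p.2.2 ∂(κ ω) := by
    intro ω
    have hm : Measurable fun p : ℝ × ℝ × ℝ => I p.1 *
        acceptance (discreteIntensity (κ ω) h ψ b Δ (n + 1)) p.2.1 * g₁ p.2.2 * past ω p.1 := by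
      have h1 : Measurable fun p : ℝ × ℝ × ℝ => past ω p.1 :=
        (hpastm.mono predictablePoints_le le_rfl).comp
          (by fun_prop : Measurable fun p : ℝ × ℝ × ℝ => (ω, p))
      exact (((hIm.comp measurable_fst).mul (measurable_acceptance measurable_const
        (by fun_prop))).mul (by fun_prop)).mul h1
    have hpe : ∀ s : ℝ, ∫⁻ q in {q : ℝ × ℝ × ℝ | q.1 < s}, I q.1 *
        acceptance (discreteIntensity (κ ω) h ψ b Δ (n + 1)) q.2.1 * g₂ q.2.2 ∂(κ ω) =
        past ω s := by
      intro s
      refine lintegral_congr fun q => ?_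
      by_cases hq : q.1 ∈ timeBin Δ (n + 1)
      · rw [hcl ω q.1 hq]
      · simp [hI, indicator_of_notMem hq]
    rw [pairSum]
    simp_rw [← hI, hpe]
    rw [← lintegral_const_mul _ hm]
    refine lintegral_congr fun p => ?_
    by_cases hp : p.1 ∈ timeBin Δ (n + 1)
    · rw [hweq ω p.1 hp, hcl ω p.1 hp, hI, indicator_of_mem hp, Pi.one_apply]
      ring
    · rw [hw0 ω p.1 hp, hI, indicator_of_notMem hp]
      simp
  simp_rw [hrewrite]
  rw [hκ.lintegral_acceptance_eq (w := w) (a := c) hwm hcm hg₁]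
  gcongr
  calc ∫⁻ s in Ioi 0, ∫⁻ ω, w ω s * ENNReal.ofReal (c ω s) ∂Pr
      ≤ ∫⁻ s, (timeBin Δ (n + 1)).indicator (fun _ => ENNReal.ofReal Δ *
        (∫⁻ ω, ENNReal.ofReal (discreteIntensity (κ ω) h ψ b Δ (n + 1)) ∂Pr) *
          ∫⁻ y, g₂ y ∂ν) s := by
        refine (setLIntegral_le_lintegral _ _).trans (lintegral_mono fun s => ?_)
        by_cases hs : s ∈ timeBin Δ (n + 1)
        · rw [indicator_of_mem hs, ← hκ.lintegral_timeBin hΔ hψ hb_meas hb (by omega) hg₂]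
          refine lintegral_mono fun ω => ?_
          rw [hweq ω s hs, hcl ω s hs, mul_right_comm]
          -- The weight `v` cancels the intensity produced by the later point. Only a first moment
          -- of the discrete intensity remains; no second moment is assumed.
          refine (mul_le_of_le_one_left zero_le (hvl ω)).trans ?_
          refine (setLIntegral_le_lintegral _ _).trans (lintegral_mono fun q => ?_)
          by_cases hq : q.1 ∈ timeBin Δ (n + 1)
          · rw [hcl ω q.1 hq]
          · simp [hI, indicator_of_notMem hq]
        · rw [indicator_of_notMem hs]
          simp [hw0 _ s hs]
    _ = _ := by
        rw [lintegral_indicator (measurableSet_timeBin _ _), setLIntegral_const, volume_timeBin,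
          mul_comm]

theorem binTotal_eq (Q : Measure (ℝ × ℝ × ℝ)) (k : ℕ) : binTotal Q h ψ b Δ k =
    ∫⁻ p, (timeBin Δ k).indicator 1 p.1 * acceptance (discreteIntensity Q h ψ b Δ k) p.2.1 *
      ENNReal.ofReal |p.2.2| ∂Q := by
  rw [binTotal, setLIntegral_acceptedPoints (measurableSet_timeBin Δ k) measurable_const]

/-- Mean of the contribution of the bins in which the time change cannot match the jumps. -/
theorem IsCompensatedProcess.lintegral_pairError_le (hκ : IsCompensatedProcess Pr 𝓖 κ ν)
    (hΔ : 0 < Δ) (hψ : LipschitzWith L ψ) (hb_meas : Measurable b)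
    (hb : ∀ y, 0 ≤ b y) {H : ℝ} (hH : ∀ t, 0 ≤ t → |h t| ≤ H) {M : ℕ} (hM : 1 ≤ M) {C : ℝ≥0∞}
    (hC : ∀ k ∈ Finset.Icc 1 M,
      ∫⁻ ω, ENNReal.ofReal (discreteIntensity (κ ω) h ψ b Δ k) ∂Pr ≤ C) :
    ∫⁻ ω, pairError (κ ω) h ψ b Δ L H M ∂Pr ≤
      ENNReal.ofReal √Δ * (1 + ENNReal.ofReal (ψ 0) + L * (ENNReal.ofReal H *
        (ENNReal.ofReal (M * Δ) * C * ∫⁻ y, ENNReal.ofReal (b y) ∂ν))) +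
      4 * (ENNReal.ofReal √Δ * (ENNReal.ofReal (M * Δ) * C * ∫⁻ y, ENNReal.ofReal (y ^ 2) ∂ν)) +
      ENNReal.ofReal Δ * C * ∫⁻ y, ENNReal.ofReal |y| ∂ν := by
  have hψm := hψ.continuous.measurable
  set β := ∫⁻ y, ENNReal.ofReal (b y) ∂ν with hβ
  set E2 := ∫⁻ y, ENNReal.ofReal (y ^ 2) ∂ν with hE2
  set U : Ω → ℕ → ℝ≥0∞ := fun ω k => intensityMajorant (κ ω) h ψ b Δ L H k with hU
  have hc0 : ENNReal.ofReal √Δ ≠ 0 := by simpa using hΔ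
  have hMΔ : ENNReal.ofReal (M * Δ) = M * ENNReal.ofReal Δ := by
    rw [ENNReal.ofReal_mul (by positivity), ENNReal.ofReal_natCast]
  have hUm : ∀ k ∈ Finset.Icc 1 M, Measurable fun ω => U ω k := by
    intro k hk
    obtain ⟨n, rfl⟩ := Nat.exists_eq_add_of_le' (Finset.mem_Icc.1 hk).1
    exact (hκ.measurable_intensityMajorant hΔ hψm hb_meas hb L H n).mono (𝓖.le _) le_rfl
  have hUmean : ∫⁻ ω, U ω M ∂Pr ≤ 1 + ENNReal.ofReal (ψ 0) + L * (ENNReal.ofReal H *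
        (ENNReal.ofReal (M * Δ) * C * β)) := by
    have hX : ∀ j ∈ Finset.Ico 1 M, Measurable
        fun ω => ENNReal.ofReal (discreteX (κ ω) h ψ b Δ j) := fun j _ =>
      (hκ.measurable_discreteX hΔ hψm hb_meas hb j).ennreal_ofReal
    simp only [hU, intensityMajorant]
    rw [lintegral_add_left measurable_const, lintegral_const_mul' _ _ (by simp),
      lintegral_const_mul' _ _ (by simp), lintegral_finsetSum _ hX, lintegral_const, measure_univ,
      mul_one]
    gcongr
    calc ∑ j ∈ Finset.Ico 1 M, ∫⁻ ω, ENNReal.ofReal (discreteX (κ ω) h ψ b Δ j) ∂Pr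
        ≤ ∑ j ∈ Finset.Ico 1 M, ENNReal.ofReal Δ * C * β := by
          refine Finset.sum_le_sum fun j hj => ?_
          have hjM := Finset.mem_Ico.1 hj
          rw [hκ.lintegral_discreteX hΔ hψm hb_meas hb hjM.1]
          gcongr
          exact hC j (Finset.mem_Icc.2 ⟨hjM.1, hjM.2.le⟩)
      _ ≤ M * (ENNReal.ofReal Δ * C * β) := by
          rw [Finset.sum_const, nsmul_eq_mul, Nat.card_Ico]
          gcongr
          omega
      _ = ENNReal.ofReal (M * Δ) * C * β := by rw [hMΔ]; ring
  have hpair : ∀ k ∈ Finset.Icc 1 M, ∀ {g₁ g₂ : ℝ → ℝ≥0∞}, Measurable g₁ → Measurable g₂ →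
      ∫⁻ ω, (U ω k)⁻¹ * pairSum (κ ω) h ψ b Δ k g₁ g₂ ∂Pr ≤
        ENNReal.ofReal Δ * (ENNReal.ofReal Δ * C * ∫⁻ y, g₂ y ∂ν) * ∫⁻ y, g₁ y ∂ν := by
    intro k hk g₁ g₂ hg₁ hg₂
    have hCk := hC k hk
    obtain ⟨n, rfl⟩ := Nat.exists_eq_add_of_le' (Finset.mem_Icc.1 hk).1
    refine (hκ.lintegral_pairSum_le hΔ hψm hb_meas hb (v := fun ω => (U ω (n + 1))⁻¹)
      (hκ.measurable_intensityMajorant hΔ hψm hb_meas hb L H n).inv (fun ω => ?_) hg₁ hg₂).trans ?_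
    · rw [mul_comm, ← div_eq_mul_inv]
      refine ENNReal.div_le_of_le_mul ?_
      rw [one_mul]
      exact ofReal_discreteIntensity_le_majorant hψ hb hΔ hH (n + 1)
    · gcongr
  have hmS : Measurable fun ω => binTotal (κ ω) h ψ b Δ M := by
    simp_rw [binTotal_eq]
    refine hκ.measurable_lintegral (f := fun x => (timeBin Δ M).indicator 1 x.2.1 *
      acceptance (discreteIntensity (κ x.1) h ψ b Δ M) x.2.2.1 * ENNReal.ofReal |x.2.2.2|) ?_
    have h1 := (hκ.measurable_discreteIntensity (h := h) hΔ hψm hb_meas hb hM)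
    have hIm : Measurable ((timeBin Δ M).indicator (1 : ℝ → ℝ≥0∞)) :=
      measurable_one.indicator (measurableSet_timeBin Δ M)
    exact ((hIm.comp (by fun_prop)).mul (measurable_acceptance (h1.comp measurable_fst)
      (by fun_prop))).mul (by fun_prop)
  have hcoef : (2 * (ENNReal.ofReal √Δ)⁻¹ : ℝ≥0∞) ≠ ∞ :=
    ENNReal.mul_ne_top (by simp) (ENNReal.inv_ne_top.2 hc0)
  have hg2 : Measurable fun y : ℝ => ENNReal.ofReal (y ^ 2) := by fun_prop
  have hpm : ∀ k ∈ Finset.Icc 1 M, ∀ {g₁ g₂ : ℝ → ℝ≥0∞}, Measurable g₁ → Measurable g₂ →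
      Measurable fun ω => (U ω k)⁻¹ * pairSum (κ ω) h ψ b Δ k g₁ g₂ := fun k hk g₁ g₂ hg₁ hg₂ =>
    (hUm k hk).inv.mul
      (hκ.measurable_pairSum hΔ hψm hb_meas hb (Finset.mem_Icc.1 hk).1 hg₁ hg₂)
  have hsum : ∀ k ∈ Finset.Icc 1 M, ∫⁻ ω, 2 * (ENNReal.ofReal √Δ)⁻¹ * ((U ω k)⁻¹ *
      pairSum (κ ω) h ψ b Δ k (fun y => ENNReal.ofReal (y ^ 2)) 1 + (U ω k)⁻¹ *
        pairSum (κ ω) h ψ b Δ k 1 (fun y => ENNReal.ofReal (y ^ 2))) ∂Pr ≤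
      4 * (ENNReal.ofReal √Δ * (ENNReal.ofReal Δ * C * E2)) := by
    intro k hk
    rw [lintegral_const_mul' _ _ hcoef,
      lintegral_add_left (hpm k hk hg2 measurable_one)]
    calc 2 * (ENNReal.ofReal √Δ)⁻¹ * (_ + _)
        ≤ 2 * (ENNReal.ofReal √Δ)⁻¹ * (ENNReal.ofReal Δ * (ENNReal.ofReal Δ * C * 1) * E2 +
            ENNReal.ofReal Δ * (ENNReal.ofReal Δ * C * E2) * 1) := by
          gcongr
          · refine (hpair k hk hg2 measurable_one).trans_eq ?_
            simp [hE2]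
          · refine (hpair k hk measurable_one hg2).trans_eq ?_
            simp [hE2]
      _ = 4 * ((ENNReal.ofReal √Δ)⁻¹ * ENNReal.ofReal Δ) * (ENNReal.ofReal Δ * C * E2) := by ring
      _ = _ := by
          -- Of the two factors `Δ` of a pair, one combines with `1/√Δ` into `√Δ`; the other adds up
          -- to `T` over the `M` bins.
          have : (ENNReal.ofReal √Δ)⁻¹ * ENNReal.ofReal Δ = ENNReal.ofReal √Δ := by
            nth_rewrite 2 [← Real.mul_self_sqrt hΔ.le]
            rw [ENNReal.ofReal_mul (Real.sqrt_nonneg _), ← mul_assoc,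
              ENNReal.inv_mul_cancel hc0 (by simp), one_mul]
          rw [this, mul_assoc]
  simp only [pairError]
  rw [lintegral_add_right _ hmS, lintegral_add_left ((hUm M (Finset.mem_Icc.2 ⟨hM, le_rfl⟩)).const_mul _),
    lintegral_const_mul' _ _ (by simp)]
  gcongr
  · have hterm : ∀ k ∈ Finset.Icc 1 M, Measurable fun ω => 2 * (ENNReal.ofReal √Δ)⁻¹ * ((U ω k)⁻¹ *
        pairSum (κ ω) h ψ b Δ k (fun y => ENNReal.ofReal (y ^ 2)) 1 + (U ω k)⁻¹ *
          pairSum (κ ω) h ψ b Δ k 1 (fun y => ENNReal.ofReal (y ^ 2))) := fun k hk =>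
      ((hpm k hk hg2 measurable_one).add (hpm k hk measurable_one hg2)).const_mul _
    rw [lintegral_finsetSum _ hterm]
    refine (Finset.sum_le_sum hsum).trans_eq ?_
    rw [Finset.sum_const, nsmul_eq_mul, Nat.card_Icc, Nat.add_sub_cancel, hMΔ]
    ring
  · simp_rw [binTotal_eq]
    rw [hκ.lintegral_timeBin hΔ hψm hb_meas hb hM (g := fun y => ENNReal.ofReal |y|) (by fun_prop)]
    gcongr
    exact hC M (Finset.mem_Icc.2 ⟨hM, le_rfl⟩)

end PairMean

/-! ### The mean Skorokhod distance -/

section Mean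

variable {Ω : Type*} [mΩ : MeasurableSpace Ω] {Pr : Measure Ω} [IsProbabilityMeasure Pr]
  {𝓖 : Filtration ℝ≥0 mΩ} {κ : Ω → Measure (ℝ × ℝ × ℝ)} {ν : Measure ℝ} [IsProbabilityMeasure ν]
  {h ψ b : ℝ → ℝ} {Δ : ℝ} {M : ℕ} {a : Ω → ℝ → ℝ} {L : ℝ≥0}

/-- The displacement of time, the mismatched points and the unmatched bins add up pathwise.
Monotonicity of `∫⁻` holds for arbitrary functions, so measurability of the Skorokhod distance is
not at issue. -/
theorem IsThinnedHawkes.lintegral_skorokhodDist_le (hκ : IsCompensatedProcess Pr 𝓖 κ ν)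
    (hΔ : 0 < Δ) (hM : 1 ≤ M)
    (hψ : LipschitzWith L ψ) (hψ0 : ∀ x, 0 ≤ ψ x) (hb_meas : Measurable b) (hb : ∀ y, 0 ≤ b y)
    (hb_int : ∫⁻ y, ENNReal.ofReal (b y) ∂ν ≠ ∞)
    (hh : Measurable h) {H : ℝ} (hH : ∀ t, 0 ≤ t → |h t| ≤ H) {ρ : ℝ} (hρ0 : 0 ≤ ρ) (hρ : ρ < 1)
    (hstab : L * (∫⁻ t in Ioc 0 (M * Δ), ENNReal.ofReal |h t|) *
      ∫⁻ y, ENNReal.ofReal (b y) ∂ν ≤ ENNReal.ofReal ρ)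
    (hstab' : L * (∑ k ∈ Finset.Icc 1 M, ENNReal.ofReal |h (k * Δ)| * ENNReal.ofReal Δ) *
      ∫⁻ y, ENNReal.ofReal (b y) ∂ν ≤ ENNReal.ofReal ρ)
    (ha : IsThinnedHawkes Pr 𝓖 κ h ψ b (M * Δ) a) :
    ∫⁻ ω, skorokhodDist (M * Δ) (hawkesRisk (κ ω) (a ω)) (discreteRisk (κ ω) h ψ b Δ) ∂Pr ≤
      ENNReal.ofReal (2 * Δ) + (L * (∫⁻ y, ENNReal.ofReal (b y) ∂ν) *
        (ENNReal.ofReal (kernelRegularity h (M * Δ) Δ) *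
          (ENNReal.ofReal (ψ 0) / ENNReal.ofReal (1 - ρ) * ENNReal.ofReal (M * Δ))) /
        ENNReal.ofReal (1 - ρ)) * (∫⁻ y, ENNReal.ofReal |y| ∂ν) +
      (ENNReal.ofReal √Δ * (1 + ENNReal.ofReal (ψ 0) + L * (ENNReal.ofReal H *
        (ENNReal.ofReal (M * Δ) * (ENNReal.ofReal (ψ 0) / ENNReal.ofReal (1 - ρ)) *
          ∫⁻ y, ENNReal.ofReal (b y) ∂ν))) +
      4 * (ENNReal.ofReal √Δ * (ENNReal.ofReal (M * Δ) *
        (ENNReal.ofReal (ψ 0) / ENNReal.ofReal (1 - ρ)) * ∫⁻ y, ENNReal.ofReal (y ^ 2) ∂ν)) +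
      ENNReal.ofReal Δ * (ENNReal.ofReal (ψ 0) / ENNReal.ofReal (1 - ρ)) *
        ∫⁻ y, ENNReal.ofReal |y| ∂ν) := by
  have hψm := hψ.continuous.measurable
  have hIm : Measurable ((Ioc 0 (M * Δ)).indicator (1 : ℝ → ℝ≥0∞)) :=
    measurable_one.indicator measurableSet_Ioc
  have hdm : Measurable fun ω => ∫⁻ p, (Ioc 0 (M * Δ)).indicator 1 p.1 *
      discrepancy (a ω p.1) (stepIntensity (κ ω) h ψ b Δ M p.1) p.2.1 *
        ENNReal.ofReal |p.2.2| ∂(κ ω) := by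
    refine hκ.measurable_lintegral (f := fun x => (Ioc 0 (M * Δ)).indicator 1 x.2.1 *
      discrepancy (a x.1 x.2.1) (stepIntensity (κ x.1) h ψ b Δ M x.2.1) x.2.2.1 *
        ENNReal.ofReal |x.2.2.2|) ?_
    exact ((hIm.comp (by fun_prop)).mul (measurable_discrepancy
      (ha.measurable.mono predictablePoints_le le_rfl)
      ((hκ.predictable_stepIntensity (h := h) hΔ hψm hb_meas hb M).mono predictablePoints_le le_rfl)
      (by fun_prop))).mul (by fun_prop)
  calc ∫⁻ ω, skorokhodDist (M * Δ) (hawkesRisk (κ ω) (a ω)) (discreteRisk (κ ω) h ψ b Δ) ∂Pr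
      ≤ ∫⁻ ω, (ENNReal.ofReal (2 * Δ) + (∫⁻ p, (Ioc 0 (M * Δ)).indicator 1 p.1 *
          discrepancy (a ω p.1) (stepIntensity (κ ω) h ψ b Δ M p.1) p.2.1 *
          ENNReal.ofReal |p.2.2| ∂(κ ω)) + pairError (κ ω) h ψ b Δ L H M) ∂Pr := by
        refine lintegral_mono_ae ?_
        filter_upwards [ha.finite] with ω hfin
        have hℓ : Measurable (a ω) := (measurable_section_of_predictablePoints ha.measurable).comp
          (by fun_prop : Measurable fun u : ℝ => (ω, u))
        exact (hκ.simple ω).skorokhodDist_le hΔ hM hℓ hfin fun k hk hbad =>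
          (hκ.simple ω).binTotal_le_pairError hΔ L H hk hbad
    _ = ENNReal.ofReal (2 * Δ) + (∫⁻ ω, ∫⁻ p, (Ioc 0 (M * Δ)).indicator 1 p.1 *
          discrepancy (a ω p.1) (stepIntensity (κ ω) h ψ b Δ M p.1) p.2.1 *
          ENNReal.ofReal |p.2.2| ∂(κ ω) ∂Pr) + ∫⁻ ω, pairError (κ ω) h ψ b Δ L H M ∂Pr := by
        have hdm' := hdm.const_add (ENNReal.ofReal (2 * Δ))
        rw [lintegral_add_left hdm', lintegral_add_left measurable_const]
        simp
    _ ≤ _ := by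
        refine add_le_add (add_le_add le_rfl ?_) ?_
        · refine (ha.lintegral_discrepancy_le_gap hκ hΔ hψm hb_meas hb
            (g := fun y => ENNReal.ofReal |y|) (by fun_prop)).trans (mul_le_mul_left ?_ _)
          exact ha.lintegral_intensityGap_le hκ hΔ hψ hψ0 hb_meas hb hb_int hh hH hρ0 hρ hstab hstab'
        · exact hκ.lintegral_pairError_le hΔ hψ hb_meas hb hH hM fun k hk =>
            hκ.lintegral_discreteIntensity_le hΔ hψ hb_meas hb hρ0 hρ hstab' hk

end Mean

/-! ### Return to the Poisson random measure and collection of the constants -/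

theorem acceptedPoints_congr {J : Set ℝ} {ℓ ℓ' : ℝ → ℝ} (hℓ : ∀ s ∈ J, ℓ s = ℓ' s) :
    acceptedPoints J ℓ = acceptedPoints J ℓ' := by
  ext p
  refine and_congr_right fun hp => ?_
  rw [hℓ p.1 hp]

/-- A Hawkes intensity driven by a Poisson random measure solves the Hawkes equation driven by its
regular version. -/
theorem IsHawkesIntensity.isThinnedHawkes {Ω : Type*} [mΩ : MeasurableSpace Ω] {Pr : Measure Ω}
    {P : Ω → Measure (ℝ × ℝ × ℝ)} {hP : Measurable P} {h ψ b : ℝ → ℝ} {T : ℝ} {lam : ℝ → Ω → ℝ}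
    (hlam : IsHawkesIntensity Pr P hP h ψ b T lam) {κ : Ω → Measure (ℝ × ℝ × ℝ)}
    (hκ : ∀ᵐ ω ∂Pr, P ω = κ ω) :
    IsThinnedHawkes Pr (completedFiltration Pr (pointFiltration P hP)) κ h ψ b T
      (fun ω s => lam (s.toNNReal : ℝ) ω) where
  measurable := by
    refine IsStronglyPredictable.measurable_predictablePoints
      (u := fun (t : ℝ≥0) ω => lam (t : ℝ) ω) ?_
    exact StronglyMeasurable.mono hlam.predictable (predictable_mono (le_completedFiltration _))
  finite := by
    filter_upwards [hlam.finite, hκ] with ω hω hPκ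
    rw [← hPκ, acceptedPoints_congr (ℓ' := fun s => lam s ω)]
    · exact hω
    · intro s hs
      rw [Real.coe_toNNReal _ hs.1.le]
  eq := by
    filter_upwards [hlam.eq, hκ] with ω hω hPκ t ht
    rw [← hPκ, acceptedPoints_congr (ℓ' := fun s => lam s ω), Real.coe_toNNReal _ ht.1]
    · exact hω t ht
    · intro s hs
      rw [Real.coe_toNNReal _ hs.1]

theorem hawkesRisk_congr {Q : Measure (ℝ × ℝ × ℝ)} {ℓ ℓ' : ℝ → ℝ} (hℓ : ∀ s, 0 < s → ℓ s = ℓ' s) :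
    hawkesRisk Q ℓ = hawkesRisk Q ℓ' := by
  ext t
  rw [hawkesRisk, hawkesRisk, acceptedPoints_congr fun s hs => hℓ s hs.1]

theorem kernelRegularity_nonneg {h : ℝ → ℝ} {T Δ : ℝ} (hΔ : 0 ≤ Δ) (hT : Δ ≤ T) :
    0 ≤ kernelRegularity h T Δ := by
  have hT' : 0 ≤ T - Δ := by linarith
  refine add_nonneg (add_nonneg ?_ ?_) ?_
  · exact intervalIntegral.integral_nonneg hΔ fun _ _ => abs_nonneg _
  · exact Real.iSup_nonneg fun ε => intervalIntegral.integral_nonneg hT' fun _ _ => abs_nonneg _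
  · exact intervalIntegral.integral_nonneg hT' fun _ _ => abs_nonneg _

theorem ofReal_mul_lintegral_le_of_stabilityConst_le {L : ℝ≥0} {ν : Measure ℝ} {b h : ℝ → ℝ}
    {T ρ : ℝ} (hT : 0 ≤ T) (hb_int : Integrable b ν) (hb : ∀ y, 0 ≤ b y) (hh : Measurable h)
    {H : ℝ} (hH : ∀ t, 0 ≤ t → |h t| ≤ H) (hstab : stabilityConst L ν b h T ≤ ρ) :
    L * (∫⁻ t in Ioc 0 T, ENNReal.ofReal |h t|) * ∫⁻ y, ENNReal.ofReal (b y) ∂ν ≤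
      ENNReal.ofReal ρ := by
  rw [← ofReal_intervalIntegral_abs hh hT (C := H) (fun x hx => hH x hx.1.le),
    ← ofReal_integral_eq_lintegral_ofReal hb_int (Eventually.of_forall hb),
    ← ENNReal.ofReal_coe_nnreal, ← ENNReal.ofReal_mul L.coe_nonneg, ← ENNReal.ofReal_mul]
  · exact ENNReal.ofReal_le_ofReal hstab
  · exact mul_nonneg L.coe_nonneg (intervalIntegral.integral_nonneg hT fun _ _ => abs_nonneg _)

theorem ofReal_mul_sum_le_of_discreteStabilityConst_le {L : ℝ≥0} {ν : Measure ℝ} {b h : ℝ → ℝ}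
    {T ρ : ℝ} {M : ℕ} (hT : 0 ≤ T) (hb_int : Integrable b ν) (hb : ∀ y, 0 ≤ b y)
    (hstab : discreteStabilityConst L ν b h T M ≤ ρ) :
    L * (∑ k ∈ Finset.Icc 1 M, ENNReal.ofReal |h (k * (T / M))| * ENNReal.ofReal (T / M)) *
      ∫⁻ y, ENNReal.ofReal (b y) ∂ν ≤ ENNReal.ofReal ρ := by
  have hΔ : 0 ≤ T / M := by positivity
  rw [← ofReal_integral_eq_lintegral_ofReal hb_int (Eventually.of_forall hb)]
  simp_rw [← ENNReal.ofReal_mul (abs_nonneg _)]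
  rw [← ENNReal.ofReal_sum_of_nonneg fun k _ => mul_nonneg (abs_nonneg _) hΔ,
    ← ENNReal.ofReal_coe_nnreal, ← ENNReal.ofReal_mul L.coe_nonneg, ← ENNReal.ofReal_mul]
  · exact ENNReal.ofReal_le_ofReal hstab
  · exact mul_nonneg L.coe_nonneg (Finset.sum_nonneg fun k _ => mul_nonneg (abs_nonneg _) hΔ)

/-- Collecting the error terms. -/
theorem error_terms_le {Δ T R c β E1 E2 H x d : ℝ} {L : ℝ≥0} (hΔ : 0 < Δ) (hΔT : Δ ≤ T) (hR0 : 0 ≤ R)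
    (hc0 : 0 ≤ c) (hβ0 : 0 ≤ β) (hE10 : 0 ≤ E1) (hE20 : 0 ≤ E2) (hH0 : 0 ≤ H) (hx : 0 ≤ x)
    (hd : 0 < d) :
    2 * Δ + (L * β * (R * (c * T)) / d) * E1 +
      (√Δ * (1 + x + L * (H * (T * c * β))) + 4 * (√Δ * (T * c * E2)) + Δ * c * E1) ≤
      (2 + (1 + x + L * (H * (c * β))) + 4 * (c * E2) + c * E1 + L * β * c / d * E1) *
        (√Δ * (1 + T ^ (3 / 2 : ℝ)) + T * R) := by
  have hT : 0 < T := hΔ.trans_le hΔT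
  have hL0 : (0 : ℝ) ≤ L := L.coe_nonneg
  have hs0 : 0 ≤ √Δ := Real.sqrt_nonneg _
  set S := 1 + T ^ (3 / 2 : ℝ) with hSdef
  have hT32 : 0 ≤ T ^ (3 / 2 : ℝ) := by positivity
  -- The power 3/2 enters only because `S = 1 + T^{3/2}` dominates 1, `T` and `√T`.
  have hTS : T ≤ S := by
    rcases le_total T 1 with h1 | h1
    · linarith
    · have : T ^ (1 : ℝ) ≤ T ^ (3 / 2 : ℝ) := Real.rpow_le_rpow_of_exponent_le h1 (by norm_num)
      rw [Real.rpow_one] at this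
      linarith
  have hsT : √T ≤ S := by
    rcases le_total T 1 with h1 | h1
    · have : √T ≤ 1 := Real.sqrt_le_one.2 h1
      linarith
    · have : √T ≤ T := Real.sqrt_le_self_iff.2 (Or.inr h1)
      linarith
  have hΔS : Δ ≤ √Δ * S := by
    calc Δ = √Δ * √Δ := (Real.mul_self_sqrt hΔ.le).symm
      _ ≤ √Δ * √T := by gcongr
      _ ≤ √Δ * S := by gcongr
  have h1S : 1 ≤ S := by linarith
  have t1 : L * β * (R * (c * T)) / d * E1 = L * β * c / d * E1 * (T * R) := by ring
  have t2 : √Δ * (1 + x + L * (H * (T * c * β))) ≤ (1 + x + L * (H * (c * β))) * (√Δ * S) := by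
    calc √Δ * (1 + x + L * (H * (T * c * β)))
        = √Δ * ((1 + x) * 1 + L * (H * (c * β)) * T) := by ring
      _ ≤ √Δ * ((1 + x) * S + L * (H * (c * β)) * S) := by gcongr
      _ = _ := by ring
  have t3 : 4 * (√Δ * (T * c * E2)) ≤ 4 * (c * E2) * (√Δ * S) := by
    calc 4 * (√Δ * (T * c * E2)) = 4 * (c * E2) * (√Δ * T) := by ring
      _ ≤ _ := by gcongr
  have t4 : Δ * c * E1 ≤ c * E1 * (√Δ * S) := by
    calc Δ * c * E1 = c * E1 * Δ := by ring
      _ ≤ _ := by gcongr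
  have hTR : 0 ≤ T * R := by positivity
  have hsS : 0 ≤ √Δ * S := by positivity
  have p1 : 0 ≤ (2 + (1 + x + L * (H * (c * β))) + 4 * (c * E2) + c * E1) * (T * R) := by
    positivity
  have p2 : 0 ≤ L * β * c / d * E1 * (√Δ * S) := by positivity
  rw [t1]
  nlinarith

/-- All quantities lift to `ℝ≥0`, after which the identity is a matter of casts; only the division
needs `d ≠ 0`. -/
theorem ofReal_error_terms {Δ T R c β E1 E2 H x d : ℝ} {L : ℝ≥0} (hΔ : 0 < Δ) (hT : 0 < T)
    (hR0 : 0 ≤ R) (hc0 : 0 ≤ c) (hβ0 : 0 ≤ β) (hE10 : 0 ≤ E1) (hE20 : 0 ≤ E2) (hH0 : 0 ≤ H)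
    (hx : 0 ≤ x) (hd : 0 < d) :
    ENNReal.ofReal (2 * Δ) + (L * ENNReal.ofReal β *
        (ENNReal.ofReal R * (ENNReal.ofReal c * ENNReal.ofReal T)) / ENNReal.ofReal d) *
          ENNReal.ofReal E1 +
      (ENNReal.ofReal √Δ * (1 + ENNReal.ofReal x + L * (ENNReal.ofReal H *
        (ENNReal.ofReal T * ENNReal.ofReal c * ENNReal.ofReal β))) +
      4 * (ENNReal.ofReal √Δ * (ENNReal.ofReal T * ENNReal.ofReal c * ENNReal.ofReal E2)) +
      ENNReal.ofReal Δ * ENNReal.ofReal c * ENNReal.ofReal E1) =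
    ENNReal.ofReal (2 * Δ + (L * β * (R * (c * T)) / d) * E1 +
      (√Δ * (1 + x + L * (H * (T * c * β))) + 4 * (√Δ * (T * c * E2)) + Δ * c * E1)) := by
  have hs0 : 0 ≤ √Δ := Real.sqrt_nonneg _
  generalize √Δ = r at *
  lift Δ to ℝ≥0 using hΔ.le
  lift T to ℝ≥0 using hT.le
  lift R to ℝ≥0 using hR0
  lift c to ℝ≥0 using hc0
  lift β to ℝ≥0 using hβ0
  lift E1 to ℝ≥0 using hE10
  lift E2 to ℝ≥0 using hE20
  lift H to ℝ≥0 using hH0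
  lift x to ℝ≥0 using hx
  lift d to ℝ≥0 using hd.le
  lift r to ℝ≥0 using hs0
  have hd' : d ≠ 0 := fun h => by simp [h] at hd
  have h1 : (2 * (Δ : ℝ) + (L * β * (R * (c * T)) / d) * E1 +
      (r * (1 + x + L * (H * (T * c * β))) + 4 * (r * (T * c * E2)) + Δ * c * E1)) =
      ((2 * Δ + (L * β * (R * (c * T)) / d) * E1 +
        (r * (1 + x + L * (H * (T * c * β))) + 4 * (r * (T * c * E2)) + Δ * c * E1) : ℝ≥0) : ℝ) := by
    push_cast; rfl
  have h2 : (2 * (Δ : ℝ)) = ((2 * Δ : ℝ≥0) : ℝ) := by push_cast; rfl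
  rw [h1, h2]
  simp only [ENNReal.ofReal_coe_nnreal]
  push_cast [ENNReal.coe_div hd']
  rfl

/-- The mean Skorokhod error under stability of both processes. -/
theorem exists_meanSkorokhodErrorLE (L : ℝ≥0) (ψ₀ : ℝ) (ν : Measure ℝ) [IsProbabilityMeasure ν]
    (hν : Integrable (fun y : ℝ => y ^ 2) ν) (b : ℝ → ℝ) (hb_meas : Measurable b)
    (hb : ∀ y, 0 ≤ b y) (hb_int : Integrable b ν) (h : ℝ → ℝ) (hh : Measurable h) {H : ℝ}
    (hH : ∀ t, 0 ≤ t → |h t| ≤ H) {ρ : ℝ} (hρ0 : 0 ≤ ρ) (hρ : ρ < 1) :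
    ∃ K : ℝ, 0 < K ∧ ∀ ψ : ℝ → ℝ, LipschitzWith L ψ → (∀ x, 0 ≤ ψ x) → ψ 0 = ψ₀ →
      ∀ T : ℝ, 0 < T → stabilityConst L ν b h T ≤ ρ →
      ∀ M : ℕ, 1 ≤ M → discreteStabilityConst L ν b h T M ≤ ρ → ∀ B : ℝ,
        K * (√(T / M) * (1 + T ^ (3 / 2 : ℝ)) + T * kernelRegularity h T (T / M)) ≤ B →
        MeanSkorokhodErrorLE.{u} ν h ψ b T M B := by
  have hH0 : 0 ≤ H := (abs_nonneg _).trans (hH 0 le_rfl)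
  have hρ1 : 0 < 1 - ρ := by linarith
  have habs : Integrable (fun y : ℝ => |y|) ν := by
    refine Integrable.mono' (hν.add (integrable_const (1 : ℝ))) (by fun_prop) ?_
    refine Eventually.of_forall fun y => ?_
    simp only [Real.norm_eq_abs, abs_abs, Pi.add_apply]
    rw [← sq_abs y]
    nlinarith [sq_nonneg (|y| - 1)]
  obtain ⟨β, hβ0, hβ⟩ : ∃ β : ℝ, 0 ≤ β ∧ ∫⁻ y, ENNReal.ofReal (b y) ∂ν = ENNReal.ofReal β :=
    ⟨_, integral_nonneg hb,
      (ofReal_integral_eq_lintegral_ofReal hb_int (Eventually.of_forall hb)).symm⟩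
  obtain ⟨E1, hE10, hE1⟩ : ∃ e : ℝ, 0 ≤ e ∧ ∫⁻ y, ENNReal.ofReal |y| ∂ν = ENNReal.ofReal e :=
    ⟨_, integral_nonneg fun y => abs_nonneg y, (ofReal_integral_eq_lintegral_ofReal habs
      (Eventually.of_forall fun y => abs_nonneg y)).symm⟩
  obtain ⟨E2, hE20, hE2⟩ : ∃ e : ℝ, 0 ≤ e ∧ ∫⁻ y, ENNReal.ofReal (y ^ 2) ∂ν = ENNReal.ofReal e :=
    ⟨_, integral_nonneg fun y => sq_nonneg y, (ofReal_integral_eq_lintegral_ofReal hν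
      (Eventually.of_forall fun y => sq_nonneg y)).symm⟩
  -- The bound of the mean intensities. The constant is fixed before `ψ` is given, when `ψ₀ ≥ 0` is
  -- not yet known, hence the absolute value.
  set c := |ψ₀| / (1 - ρ) with hc
  have hc0 : 0 ≤ c := by positivity
  have hL0 : (0 : ℝ) ≤ L := L.coe_nonneg
  refine ⟨2 + (1 + |ψ₀| + L * (H * (c * β))) + 4 * (c * E2) + c * E1 +
    L * β * c / (1 - ρ) * E1, by positivity, ?_⟩
  intro ψ hψ hψ0 hψe T hT hstab M hM hstab' B hB Ω _ Pr _ P hP lam hlam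
  refine le_trans ?_ (ENNReal.ofReal_le_ofReal hB)
  obtain ⟨κ, hPκ, hκ⟩ := hP.exists_isCompensatedProcess
  have hM0 : (0 : ℝ) < M := by exact_mod_cast hM
  have hM1 : (1 : ℝ) ≤ M := by exact_mod_cast hM
  obtain ⟨Δ, hΔdef⟩ : ∃ Δ, Δ = T / M := ⟨_, rfl⟩
  have hΔ : 0 < Δ := by rw [hΔdef]; positivity
  have hTM : T = M * Δ := by rw [hΔdef]; field_simp
  have hΔT : Δ ≤ T := by rw [hTM]; nlinarith
  have hS := ofReal_mul_lintegral_le_of_stabilityConst_le hT.le hb_int hb hh hH hstab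
  have hS' := ofReal_mul_sum_le_of_discreteStabilityConst_le hT.le hb_int hb hstab'
  have ha := hlam.isThinnedHawkes hPκ
  set R := kernelRegularity h T (T / M) with hR
  have hR0 : 0 ≤ R := kernelRegularity_nonneg (hΔdef ▸ hΔ.le) (hΔdef ▸ hΔT)
  -- Kept as a function of its hypotheses, so that the horizon `M * Δ` can be rewritten as `T` in
  -- hypotheses and conclusion together.
  have hmain := fun hS hS' ha => IsThinnedHawkes.lintegral_skorokhodDist_le (L := L) (h := h)
    (ψ := ψ) (a := fun ω s => lam (s.toNNReal : ℝ) ω) hκ hΔ hM hψ hψ0 hb_meas hb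
    (by rw [hβ]; simp) hh hH hρ0 hρ hS hS' ha
  rw [← hTM] at hmain
  rw [← hΔdef] at hS' hR ⊢
  have hmain := hmain hS hS' ha
  have hleft : ∫⁻ ω, skorokhodDist T (hawkesRisk (P ω) (fun s => lam s ω))
      (discreteRisk (P ω) h ψ b Δ) ∂Pr = ∫⁻ ω, skorokhodDist T
        (hawkesRisk (κ ω) (fun s => lam (s.toNNReal : ℝ) ω)) (discreteRisk (κ ω) h ψ b Δ) ∂Pr := by
    refine lintegral_congr_ae ?_
    filter_upwards [hPκ] with ω hω
    rw [hω, hawkesRisk_congr (ℓ' := fun s => lam (s.toNNReal : ℝ) ω)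
      fun s hs => by rw [Real.coe_toNNReal _ hs.le]]
  rw [hleft]
  refine hmain.trans ?_
  have hψ₀ : 0 ≤ ψ₀ := hψe ▸ hψ0 0
  have hcC : ENNReal.ofReal (ψ 0) / ENNReal.ofReal (1 - ρ) = ENNReal.ofReal c := by
    rw [hψe, hc, abs_of_nonneg hψ₀, ENNReal.ofReal_div_of_pos hρ1]
  rw [hcC, hβ, hE1, hE2, ← hR, hψe]
  rw [abs_of_nonneg hψ₀, ofReal_error_terms hΔ hT hR0 hc0 hβ0 hE10 hE20 hH0 hψ₀ hρ1]
  exact ENNReal.ofReal_le_ofReal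
    (error_terms_le hΔ hΔT hR0 hc0 hβ0 hE10 hE20 hH0 hψ₀ hρ1)

/-! ### Kernels of finite variation -/

theorem sum_ofReal_rpow_le_pVariation {p : ℝ} (hp : 1 ≤ p) {h : ℝ → ℝ} {T : ℝ} (n : ℕ) {t : ℕ → ℝ}
    (ht : Monotone t) (htT : ∀ i, t i ∈ Icc 0 T) :
    ∑ i ∈ Finset.range n, ENNReal.ofReal (|h (t (i + 1)) - h (t i)| ^ p) ≤ pVariation p h T ^ p := by
  rw [pVariation, ← ENNReal.rpow_mul, one_div_mul_cancel (by linarith), ENNReal.rpow_one]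
  exact le_iSup (fun q : ℕ × {t : ℕ → ℝ // Monotone t ∧ ∀ i, t i ∈ Icc (0 : ℝ) T} =>
    ∑ i ∈ Finset.range q.1, ENNReal.ofReal (|h (q.2.1 (i + 1)) - h (q.2.1 i)| ^ p)) (n, ⟨t, ht, htT⟩)

/-- Of the increments of an interleaved sequence only every second one is wanted. -/
theorem sum_range_even_le (g : ℕ → ℝ≥0∞) (n : ℕ) :
    ∑ j ∈ Finset.range n, g (2 * j) ≤ ∑ i ∈ Finset.range (2 * n), g i := by
  induction n with
  | zero => simp
  | succ n ih =>
    rw [show 2 * (n + 1) = 2 * n + 1 + 1 by ring, Finset.sum_range_succ, Finset.sum_range_succ,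
      Finset.sum_range_succ, add_assoc]
    exact add_le_add ih le_self_add

section Variation

variable {p : ℝ} {h : ℝ → ℝ} {Δ : ℝ} {n : ℕ} {σ : ℝ → ℝ}

/-- Variation along a grid and a point between any two of its neighbours. -/
theorem sum_rpow_grid_le_pVariation (hp : 1 ≤ p) (hΔ : 0 < Δ)
    (hσ : ∀ y, y ≤ σ y ∧ σ y ≤ y + Δ) {y : ℝ} (hy : y ∈ Ioc 0 Δ) :
    ∑ j ∈ Finset.range n, ENNReal.ofReal (|h (y + j * Δ) - h (σ (y + j * Δ))| ^ p) ≤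
      pVariation p h ((n + 1 : ℕ) * Δ) ^ p := by
  set T : ℝ := (n + 1 : ℕ) * Δ with hT
  -- Interleaves `y + jΔ` with `σ (y + jΔ)`; the result is monotone because `σ` moves forward by at
  -- most one step.
  set v : ℕ → ℝ := fun i => if Even i then y + (i / 2 : ℕ) * Δ else σ (y + (i / 2 : ℕ) * Δ) with hv
  have hveven : ∀ j : ℕ, v (2 * j) = y + j * Δ := fun j => by simp [hv]
  have hvodd : ∀ j : ℕ, v (2 * j + 1) = σ (y + j * Δ) := fun j => by
    have h1 : ¬ Even (2 * j + 1) := by simp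
    have h2 : (2 * j + 1) / 2 = j := by omega
    simp only [hv, if_neg h1, h2]
  have hvmono : Monotone v := by
    refine monotone_nat_of_le_succ fun i => ?_
    obtain ⟨j, rfl | rfl⟩ := Nat.even_or_odd' i
    · rw [hveven, hvodd]; exact (hσ _).1
    · rw [hvodd, show 2 * j + 1 + 1 = 2 * (j + 1) by ring, hveven]
      refine (hσ _).2.trans_eq ?_
      push_cast; ring
  have hv0 : ∀ i, 0 ≤ v i := fun i => by
    refine le_trans ?_ (hvmono (Nat.zero_le i))
    have := hveven 0
    simp only [mul_zero, Nat.cast_zero, zero_mul, add_zero] at this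
    rw [this]; exact hy.1.le
  have hT0 : 0 ≤ T := by positivity
  -- The sequences in `pVariation` must stay in `[0,T]` at all indices. Truncation at `T` leaves the
  -- increments that are kept unchanged.
  have hle := sum_ofReal_rpow_le_pVariation hp (h := h) (T := T) (2 * n) (t := fun i => min (v i) T)
    (fun i j hij => min_le_min_right _ (hvmono hij)) fun i => ⟨le_min (hv0 i) hT0, min_le_right _ _⟩
  refine le_trans ?_ ((sum_range_even_le _ n).trans hle)
  refine Finset.sum_le_sum fun j hj => le_of_eq ?_
  have hjn : (j : ℝ) + 1 ≤ n := by exact_mod_cast Finset.mem_range.1 hj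
  have hTe : T = (n + 1) * Δ := by rw [hT]; push_cast; ring
  have hj1 : y + j * Δ + Δ ≤ T := by
    have := hy.2
    rw [hTe]; nlinarith
  rw [hvodd, hveven, min_eq_left ((hσ _).2.trans hj1), min_eq_left (by linarith), abs_sub_comm]

/-- Hölder's inequality over the `n` points of the shifted grid, applied to
`sum_rpow_grid_le_pVariation`. -/
theorem sum_grid_le_pVariation (hp : 1 ≤ p) (hΔ : 0 < Δ)
    (hσ : ∀ y, y ≤ σ y ∧ σ y ≤ y + Δ) {y : ℝ} (hy : y ∈ Ioc 0 Δ) :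
    ∑ j ∈ Finset.range n, ENNReal.ofReal |h (y + j * Δ) - h (σ (y + j * Δ))| ≤
      (n : ℝ≥0∞) ^ ((p - 1) / p) * pVariation p h ((n + 1 : ℕ) * Δ) := by
  have hp0 : 0 < p := by linarith
  have h1 := ENNReal.rpow_sum_le_const_mul_sum_rpow (Finset.range n)
    (fun j : ℕ => ENNReal.ofReal |h (y + j * Δ) - h (σ (y + j * Δ))|) hp
  simp_rw [ENNReal.ofReal_rpow_of_nonneg (abs_nonneg _) hp0.le] at h1
  rw [Finset.card_range] at h1
  have h2 := h1.trans (mul_le_mul_right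
    (sum_rpow_grid_le_pVariation (h := h) (n := n) hp hΔ hσ hy) _)
  have h3 := ENNReal.rpow_le_rpow h2 (show 0 ≤ 1 / p by positivity)
  rw [← ENNReal.rpow_mul, mul_one_div_cancel hp0.ne', ENNReal.rpow_one,
    ENNReal.mul_rpow_of_nonneg _ _ (by positivity), ← ENNReal.rpow_mul, ← ENNReal.rpow_mul,
    mul_one_div_cancel hp0.ne', ENNReal.rpow_one, mul_one_div] at h3
  exact h3

theorem setLIntegral_Ioc_eq_lintegral_sum (hΔ : 0 < Δ) (n : ℕ) {F : ℝ → ℝ≥0∞} (hF : Measurable F) :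
    ∫⁻ s in Ioc 0 (n * Δ), F s = ∫⁻ y in Ioc 0 Δ, ∑ j ∈ Finset.range n, F (y + j * Δ) := by
  have hI : Finset.Icc 1 n = Finset.Ico (0 + 1) (n + 1) := by
    ext k; simp only [Finset.mem_Icc, Finset.mem_Ico]; omega
  rw [setLIntegral_Ioc_eq_sum_timeBin hΔ, lintegral_finsetSum _ fun j _ => by fun_prop,
    Finset.range_eq_Ico, hI, ← Finset.sum_Ico_add' (fun k : ℕ => ∫⁻ s in timeBin Δ k, F s) 0 n 1]
  · refine Finset.sum_congr rfl fun j _ => ?_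
    rw [timeBin, setLIntegral_Ioc_translate]
    have h1 : (((j + 1 : ℕ) : ℝ)) * Δ - (((j + 1 : ℕ) : ℝ) - 1) * Δ = Δ := by ring
    rw [h1]
    refine lintegral_congr fun r => ?_
    congr 1
    push_cast; ring

/-- Folding `(0,nΔ]` onto one cell writes the integral as an integral over `y ∈ (0,Δ]` of sums along
`y + jΔ`, each controlled by the variation. -/
theorem lintegral_grid_le_pVariation (hp : 1 ≤ p) (hh : Measurable h) (hΔ : 0 < Δ)
    (hσm : Measurable σ) (hσ : ∀ y, y ≤ σ y ∧ σ y ≤ y + Δ) :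
    ∫⁻ s in Ioc 0 (n * Δ), ENNReal.ofReal |h s - h (σ s)| ≤
      (n : ℝ≥0∞) ^ ((p - 1) / p) * pVariation p h ((n + 1 : ℕ) * Δ) * ENNReal.ofReal Δ := by
  have hF : Measurable fun s => ENNReal.ofReal |h s - h (σ s)| :=
    (measurable_norm.comp (hh.sub (hh.comp hσm))).ennreal_ofReal
  rw [setLIntegral_Ioc_eq_lintegral_sum hΔ n hF]
  refine (setLIntegral_mono measurable_const fun y hy =>
    sum_grid_le_pVariation hp hΔ hσ hy).trans_eq ?_
  rw [setLIntegral_const, Real.volume_Ioc, sub_zero]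

/-- Displacement of the argument of `h` by at most one step. -/
theorem integral_displacement_le_pVariation (hp : 1 ≤ p) (hh : Measurable h) {H : ℝ}
    (hH : ∀ t, 0 ≤ t → |h t| ≤ H) {T : ℝ} (hT : 0 < T) {M : ℕ} (hM : 1 ≤ M)
    (hfin : pVariation p h T ≠ ∞) (hσm : Measurable σ)
    (hσ : ∀ y, y ≤ σ y ∧ σ y ≤ y + T / M) :
    ∫ y in (0 : ℝ)..(T - T / M), |h y - h (σ y)| ≤
      (pVariation p h T).toReal * (T ^ ((p - 1) / p) * (T / M) ^ (1 / p)) := by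
  have hp0 : 0 < p := by linarith
  obtain ⟨n, rfl⟩ := Nat.exists_eq_add_of_le' hM
  set Δ : ℝ := T / (n + 1 : ℕ) with hΔdef
  have hΔ : 0 < Δ := by positivity
  have hTe : ((n + 1 : ℕ) : ℝ) * Δ = T := by rw [hΔdef]; field_simp
  have hTΔ : T - Δ = n * Δ := by rw [← hTe]; push_cast; ring
  have h1 := lintegral_grid_le_pVariation (n := n) hp hh hΔ hσm hσ
  have h2 : ENNReal.ofReal (∫ y in (0 : ℝ)..(T - Δ), |h y - h (σ y)|) =
      ∫⁻ s in Ioc 0 (T - Δ), ENNReal.ofReal |h s - h (σ s)| := by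
    refine ofReal_intervalIntegral_abs (f := fun s => h s - h (σ s)) (hh.sub (hh.comp hσm))
      (C := 2 * H) (by rw [hTΔ]; positivity) fun x hx => ?_
    have h3 := hH x hx.1.le
    have h4 := hH (σ x) (hx.1.le.trans (hσ x).1)
    exact (abs_sub _ _).trans (by linarith)
  rw [hTe, ← hTΔ, ← h2, ← ENNReal.ofReal_toReal hfin, ← ENNReal.ofReal_natCast,
    ENNReal.ofReal_rpow_of_nonneg (by positivity) (div_nonneg (by linarith) hp0.le),
    ← ENNReal.ofReal_mul (by positivity), ← ENNReal.ofReal_mul (by positivity)] at h1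
  have h3 := (ENNReal.ofReal_le_ofReal_iff (by positivity)).1 h1
  refine h3.trans ?_
  -- Writing `Δ = Δ^{(p-1)/p} Δ^{1/p}` and enlarging `n` to `n + 1`, the first factor completes
  -- `(n+1)Δ = T`.
  calc (n : ℝ) ^ ((p - 1) / p) * (pVariation p h T).toReal * Δ
      ≤ ((n + 1 : ℕ) : ℝ) ^ ((p - 1) / p) * (pVariation p h T).toReal * Δ := by
        have hq : 0 ≤ (p - 1) / p := div_nonneg (by linarith) hp0.le
        gcongr
        omega
    _ = (pVariation p h T).toReal * (((n + 1 : ℕ) : ℝ) ^ ((p - 1) / p) *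
          (Δ ^ ((p - 1) / p) * Δ ^ (1 / p))) := by
        rw [← Real.rpow_add hΔ, ← add_div, sub_add_cancel, div_self hp0.ne', Real.rpow_one]
        ring
    _ = _ := by
        rw [← mul_assoc (((n + 1 : ℕ) : ℝ) ^ ((p - 1) / p)),
          ← Real.mul_rpow (by positivity) hΔ.le, hTe]

/-- The grid error displaces the argument to the next grid point, which is at most one step ahead.
-/
theorem gridError_le_pVariation (hp : 1 ≤ p) (hh : Measurable h) {H : ℝ}
    (hH : ∀ t, 0 ≤ t → |h t| ≤ H) {T : ℝ} (hT : 0 < T) {M : ℕ} (hM : 1 ≤ M)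
    (hfin : pVariation p h T ≠ ∞) : gridError h T (T / M) ≤
      (pVariation p h T).toReal * (T ^ ((p - 1) / p) * (T / M) ^ (1 / p)) := by
  have hM0 : (0 : ℝ) < M := by exact_mod_cast hM
  have hΔ : 0 < T / M := by positivity
  refine integral_displacement_le_pVariation hp hh hH hT hM hfin
    (σ := fun y => (⌊y / (T / M)⌋ : ℝ) * (T / M) + T / M) ?_ fun y => ?_
  · have hc : Measurable fun n : ℤ => (n : ℝ) := measurable_of_countable _
    exact ((hc.comp (measurable_id.div_const _).floor).mul_const _).add_const _
  · have h1 := Int.floor_le (y / (T / M))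
    have h2 := Int.lt_floor_add_one (y / (T / M))
    rw [le_div_iff₀ hΔ] at h1
    rw [div_lt_iff₀ hΔ] at h2
    constructor <;> linarith

/-- The regularity constant of a kernel of finite `p`-variation. -/
theorem kernelRegularity_le_pVariation (hp : 1 ≤ p) (hh : Measurable h) {H : ℝ}
    (hH : ∀ t, 0 ≤ t → |h t| ≤ H) {T : ℝ} (hT : 0 < T) {M : ℕ} (hM : 1 ≤ M)
    (hfin : pVariation p h T ≠ ∞) : kernelRegularity h T (T / M) ≤ H * (T / M) +
      2 * ((pVariation p h T).toReal * (T ^ ((p - 1) / p) * (T / M) ^ (1 / p))) := by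
  have hM0 : (0 : ℝ) < M := by exact_mod_cast hM
  have hΔ : 0 < T / M := by positivity
  have h1 : ∫ y in (0 : ℝ)..(T / M), |h y| ≤ H * (T / M) := by
    have h2 : ∀ x ∈ uIoc 0 (T / M), ‖|h x|‖ ≤ H := by
      intro x hx
      rw [uIoc_of_le hΔ.le] at hx
      rw [Real.norm_eq_abs, abs_abs]
      exact hH x hx.1.le
    have := intervalIntegral.norm_integral_le_of_norm_le_const h2
    rw [sub_zero, abs_of_pos hΔ] at this
    exact (le_abs_self _).trans this
  have h2 : (⨆ ε : Icc (0 : ℝ) (T / M), ∫ y in (0 : ℝ)..(T - T / M), |h (y + ε) - h y|) ≤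
      (pVariation p h T).toReal * (T ^ ((p - 1) / p) * (T / M) ^ (1 / p)) := by
    have : Nonempty (Icc (0 : ℝ) (T / M)) := ⟨⟨0, le_rfl, hΔ.le⟩⟩
    refine ciSup_le fun ε => ?_
    simp_rw [abs_sub_comm (h (_ + _))]
    exact integral_displacement_le_pVariation hp hh hH hT hM hfin (σ := fun y => y + ε)
      (by fun_prop) fun y => ⟨by linarith [ε.2.1], by linarith [ε.2.2]⟩
  have h3 := gridError_le_pVariation hp hh hH hT hM hfin
  rw [kernelRegularity]
  linarith

theorem gridError_nonneg {T : ℝ} (hT : Δ ≤ T) : 0 ≤ gridError h T Δ :=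
  intervalIntegral.integral_nonneg (by linarith) fun _ _ => abs_nonneg _

theorem gridErrorTendsToZero_of_pVariation (hp : 1 ≤ p) (hh : Measurable h) {H : ℝ}
    (hH : ∀ t, 0 ≤ t → |h t| ≤ H) {T : ℝ} (hT : 0 < T) (hfin : pVariation p h T ≠ ∞) :
    GridErrorTendsToZero h T := by
  have hp0 : 0 < p := by linarith
  have h0 : Tendsto (fun M : ℕ => T / (M : ℝ)) atTop (𝓝 0) := tendsto_const_div_atTop_nhds_zero_nat T
  have h1 : Tendsto (fun M : ℕ => (T / (M : ℝ)) ^ (1 / p)) atTop (𝓝 0) := by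
    have := h0.rpow_const (p := 1 / p) (Or.inr (by positivity))
    rwa [Real.zero_rpow (by positivity)] at this
  have h2 : Tendsto (fun M : ℕ => (pVariation p h T).toReal *
      (T ^ ((p - 1) / p) * (T / (M : ℝ)) ^ (1 / p))) atTop (𝓝 0) := by
    simpa using (h1.const_mul (T ^ ((p - 1) / p))).const_mul (pVariation p h T).toReal
  refine tendsto_of_tendsto_of_tendsto_of_le_of_le' tendsto_const_nhds h2 ?_ ?_
  · filter_upwards [eventually_ge_atTop 1] with M hM
    have hM1 : (1 : ℝ) ≤ M := by exact_mod_cast hM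
    exact gridError_nonneg (div_le_self hT.le hM1)
  · filter_upwards [eventually_ge_atTop 1] with M hM
    exact gridError_le_pVariation hp hh hH hT hM hfin

/-- The Riemann sum of `|h|` exceeds the integral by at most the grid error and one step. -/
theorem sum_abs_mul_le (hh : Measurable h) {H : ℝ} (hH : ∀ t, 0 ≤ t → |h t| ≤ H) {T : ℝ}
    (hT : 0 < T) {M : ℕ} (hM : 1 ≤ M) :
    ∑ k ∈ Finset.Icc 1 M, |h (k * (T / M))| * (T / M) ≤
      (∫ t in (0 : ℝ)..T, |h t|) + gridError h T (T / M) + H * (T / M) := by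
  obtain ⟨n, rfl⟩ := Nat.exists_eq_add_of_le' hM
  set Δ : ℝ := T / (n + 1 : ℕ) with hΔdef
  have hΔ : 0 < Δ := by positivity
  have hTe : ((n + 1 : ℕ) : ℝ) * Δ = T := by rw [hΔdef]; field_simp
  have hTΔ : T - Δ = n * Δ := by rw [← hTe]; push_cast; ring
  have hnΔ : 0 ≤ T - Δ := by rw [hTΔ]; positivity
  have hlast : |h ((n + 1 : ℕ) * Δ)| * Δ ≤ H * Δ := by
    gcongr
    exact hH _ (by positivity)
  -- `gridError` stops at `T - Δ`, so the sample at `T` is bounded separately by `H Δ`.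
  rw [Finset.sum_Icc_succ_top (by omega)]
  refine add_le_add ?_ hlast
  set τ : ℝ → ℝ := fun y => (⌊y / Δ⌋ : ℝ) * Δ + Δ with hτ
  have hτm : Measurable τ := by
    have hc : Measurable fun n : ℤ => (n : ℝ) := measurable_of_countable _
    exact ((hc.comp (measurable_id.div_const _).floor).mul_const _).add_const _
  have hτ0 : ∀ y, 0 < y → 0 ≤ τ y := fun y hy => by
    have : (0 : ℝ) ≤ ⌊y / Δ⌋ := by exact_mod_cast Int.floor_nonneg.2 (by positivity)
    positivity
  have hbin : ∀ k ∈ Finset.Icc 1 n, ∫⁻ y in timeBin Δ k, ENNReal.ofReal |h (τ y)| =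
      ENNReal.ofReal (|h (k * Δ)| * Δ) := by
    intro k _
    rw [ENNReal.ofReal_mul (abs_nonneg _), ← volume_timeBin Δ k, ← setLIntegral_const]
    refine setLIntegral_congr_fun_ae (measurableSet_timeBin Δ k) ?_
    filter_upwards [ae_ceil_eq_floor_add_one hΔ] with y hy hyk
    have h1 := (mem_timeBin_iff hΔ).1 hyk
    rw [hτ]
    dsimp only
    rw [← hy, h1]
    simp
  have hsum : ENNReal.ofReal (∑ k ∈ Finset.Icc 1 n, |h (k * Δ)| * Δ) =
      ∫⁻ y in Ioc 0 (T - Δ), ENNReal.ofReal |h (τ y)| := by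
    rw [ENNReal.ofReal_sum_of_nonneg fun k _ => mul_nonneg (abs_nonneg _) hΔ.le, hTΔ,
      setLIntegral_Ioc_eq_sum_timeBin hΔ]
    exact Finset.sum_congr rfl fun k hk => (hbin k hk).symm
  have hle : ENNReal.ofReal (∑ k ∈ Finset.Icc 1 n, |h (k * Δ)| * Δ) ≤
      ENNReal.ofReal ((∫ t in (0 : ℝ)..T, |h t|) + gridError h T Δ) := by
    rw [hsum, ENNReal.ofReal_add (intervalIntegral.integral_nonneg hT.le fun _ _ => abs_nonneg _)
      (gridError_nonneg (by linarith)), gridError,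
      ofReal_intervalIntegral_abs hh hT.le (C := H) (fun x hx => hH x hx.1.le),
      ofReal_intervalIntegral_abs (f := fun y => h y - h (τ y)) (hh.sub (hh.comp hτm)) hnΔ
        (C := 2 * H) (fun x hx => (abs_sub _ _).trans
          (by linarith [hH x hx.1.le, hH _ (hτ0 x hx.1)]))]
    calc ∫⁻ y in Ioc 0 (T - Δ), ENNReal.ofReal |h (τ y)|
        ≤ ∫⁻ y in Ioc 0 (T - Δ), (ENNReal.ofReal |h y| + ENNReal.ofReal |h y - h (τ y)|) := by
          refine lintegral_mono fun y => ?_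
          rw [← ENNReal.ofReal_add (abs_nonneg _) (abs_nonneg _)]
          refine ENNReal.ofReal_le_ofReal ?_
          have := abs_sub (h y) (h y - h (τ y))
          rwa [sub_sub_cancel] at this
      _ = (∫⁻ y in Ioc 0 (T - Δ), ENNReal.ofReal |h y|) +
            ∫⁻ y in Ioc 0 (T - Δ), ENNReal.ofReal |h y - h (τ y)| :=
          lintegral_add_left (by fun_prop) _
      _ ≤ _ := by
          gcongr
          linarith
  exact (ENNReal.ofReal_le_ofReal_iff (add_nonneg
    (intervalIntegral.integral_nonneg hT.le fun _ _ => abs_nonneg _)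
    (gridError_nonneg (by linarith)))).1 hle

/-- Under the grid condition the discrete process is stable on fine grids. -/
theorem exists_discreteStabilityConst_le {L : ℝ≥0} {ν : Measure ℝ} {b : ℝ → ℝ} (hb : ∀ y, 0 ≤ b y)
    (hh : Measurable h) {H : ℝ} (hH : ∀ t, 0 ≤ t → |h t| ≤ H) {T : ℝ} (hT : 0 < T)
    {ρ ρ' : ℝ} (hρ : ρ < ρ') (hstab : stabilityConst L ν b h T ≤ ρ)
    (hgrid : GridErrorTendsToZero h T) :
    ∃ Δ₀ : ℝ, 0 < Δ₀ ∧ ∀ M : ℕ, 1 ≤ M → T / M ≤ Δ₀ → discreteStabilityConst L ν b h T M ≤ ρ' := by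
  have h0 : Tendsto (fun M : ℕ => T / (M : ℝ)) atTop (𝓝 0) := tendsto_const_div_atTop_nhds_zero_nat T
  have h1 : Tendsto (fun M : ℕ => L * (gridError h T (T / M) + H * (T / M)) * ∫ y, b y ∂ν)
      atTop (𝓝 0) := by
    have := ((hgrid.add (h0.const_mul H)).const_mul (L : ℝ)).mul_const (∫ y, b y ∂ν)
    simpa using this
  obtain ⟨N, hN⟩ := eventually_atTop.1 (h1.eventually (gt_mem_nhds (sub_pos.2 hρ)))
  have hβ : 0 ≤ ∫ y, b y ∂ν := integral_nonneg hb
  -- `T/M ≤ T/(N+1)` forces `M ≥ N + 1`, which turns the limit in `M` into a threshold for the step.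
  refine ⟨T / (N + 1 : ℕ), by positivity, fun M hM hle => ?_⟩
  have hM0 : (0 : ℝ) < M := by exact_mod_cast hM
  have hNM : N ≤ M := by
    rw [div_le_div_iff_of_pos_left hT hM0 (by positivity)] at hle
    have : N + 1 ≤ M := by exact_mod_cast hle
    omega
  have h2 := hN M hNM
  have h3 := sum_abs_mul_le hh hH hT hM
  calc discreteStabilityConst L ν b h T M
      ≤ L * ((∫ t in (0 : ℝ)..T, |h t|) + gridError h T (T / M) + H * (T / M)) * ∫ y, b y ∂ν := by
        rw [discreteStabilityConst]
        gcongr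
    _ = stabilityConst L ν b h T +
          L * (gridError h T (T / M) + H * (T / M)) * ∫ y, b y ∂ν := by
        rw [stabilityConst]; ring
    _ ≤ ρ' := by linarith

end Variation

/-! ### Choice of the constants and the three statements -/

theorem mainTheorem4
    (L : ℝ≥0) (ψ₀ : ℝ)
    (ν : Measure ℝ) [IsProbabilityMeasure ν] (hν : Integrable (fun y : ℝ => y ^ 2) ν)
    (b : ℝ → ℝ) (hb_meas : Measurable b) (hb_nonneg : ∀ y, 0 ≤ b y) (hb_int : Integrable b ν)
    (h : ℝ → ℝ) (hh_meas : Measurable h) (hh_bdd : ∃ H : ℝ, ∀ t, 0 ≤ t → |h t| ≤ H)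
    (ρ : ℝ) (hρ : ρ < 1) :
    ∃ K : ℝ, 0 < K ∧
      ∀ ψ : ℝ → ℝ, LipschitzWith L ψ → (∀ x, 0 ≤ ψ x) → ψ 0 = ψ₀ →
      ∀ T : ℝ, 0 < T → stabilityConst L ν b h T ≤ ρ →
        (∀ M : ℕ, 1 ≤ M → discreteStabilityConst L ν b h T M ≤ ρ →
          MeanSkorokhodErrorLE.{u} ν h ψ b T M (riskBound K h T M)) ∧
        (GridErrorTendsToZero h T → ∃ Δ₀ : ℝ, 0 < Δ₀ ∧ ∀ M : ℕ, 1 ≤ M → T / M ≤ Δ₀ →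
          MeanSkorokhodErrorLE.{u} ν h ψ b T M (riskBound K h T M)) ∧
        (∀ p : ℝ, 1 ≤ p → pVariation p h T ≠ ∞ →
          GridErrorTendsToZero h T ∧
          (∀ M : ℕ, 1 ≤ M → discreteStabilityConst L ν b h T M ≤ ρ →
            MeanSkorokhodErrorLE.{u} ν h ψ b T M (riskBoundPVar K p h T M)) ∧
          (∃ Δ₀ : ℝ, 0 < Δ₀ ∧ ∀ M : ℕ, 1 ≤ M → T / M ≤ Δ₀ →
            MeanSkorokhodErrorLE.{u} ν h ψ b T M (riskBoundPVar K p h T M))) := by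
  obtain ⟨H, hH⟩ := hh_bdd
  have hH0 : 0 ≤ H := (abs_nonneg _).trans (hH 0 le_rfl)
  -- A level strictly between `ρ` and 1. On fine grids the discrete stability constant is only known
  -- to be at most `ρ'`; working with `ρ'` throughout gives one `K` for all statements. The maximum
  -- with 0 covers negative `ρ`.
  set ρ' := (1 + max ρ 0) / 2 with hρ'
  have hmax : max ρ 0 < 1 := max_lt hρ one_pos
  have hρ'0 : 0 ≤ ρ' := by have := le_max_right ρ 0; positivity
  have hρ'1 : ρ' < 1 := by linarith
  have hρρ' : ρ < ρ' := by have := le_max_left ρ 0; linarith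
  obtain ⟨K, hK, hKbound⟩ := exists_meanSkorokhodErrorLE.{u} L ψ₀ ν hν b hb_meas hb_nonneg hb_int h
    hh_meas hH hρ'0 hρ'1
  -- In the `p`-variation bound of `C_R` the step has coefficient `H` and the variation term has
  -- coefficient 2; `2 + H` covers both.
  refine ⟨K * (2 + H), by positivity, fun ψ hψ hψ0 hψe T hT hstab => ?_⟩
  have hstab' := hstab.trans hρρ'.le
  have hbound : ∀ M : ℕ, 1 ≤ M → discreteStabilityConst L ν b h T M ≤ ρ' →
      MeanSkorokhodErrorLE.{u} ν h ψ b T M (riskBound (K * (2 + H)) h T M) := by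
    intro M hM hd
    refine hKbound ψ hψ hψ0 hψe T hT hstab' M hM hd _ ?_
    have hM1 : (1 : ℝ) ≤ M := by exact_mod_cast hM
    have hR := kernelRegularity_nonneg (h := h) (T := T) (Δ := T / M) (by positivity)
      (div_le_self hT.le hM1)
    rw [riskBound]
    have hTp : 0 ≤ T ^ (3 / 2 : ℝ) := by positivity
    gcongr
    · exact le_mul_of_one_le_right hK.le (by linarith)
    -- The bound holds without `√(T C_R)`, which enters only as a nonnegative summand.
    · exact le_add_of_nonneg_right (Real.sqrt_nonneg _)
  have hboundVar : ∀ p : ℝ, 1 ≤ p → pVariation p h T ≠ ∞ → ∀ M : ℕ, 1 ≤ M →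
      discreteStabilityConst L ν b h T M ≤ ρ' →
      MeanSkorokhodErrorLE.{u} ν h ψ b T M (riskBoundPVar (K * (2 + H)) p h T M) := by
    intro p hp hfin M hM hd
    refine hKbound ψ hψ hψ0 hψe T hT hstab' M hM hd _ ?_
    have hp0 : 0 < p := by linarith
    have hR := kernelRegularity_le_pVariation hp hh_meas hH hT hM hfin
    have hTp : T * T ^ ((p - 1) / p) = T ^ ((2 * p - 1) / p) := by
      nth_rewrite 1 [← Real.rpow_one T]
      rw [← Real.rpow_add hT]
      congr 1
      field_simp
      ring
    rw [riskBoundPVar, ← hTp]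
    set V := (pVariation p h T).toReal with hV
    set q := T ^ ((p - 1) / p) with hq
    set r := (T / (M : ℝ)) ^ (1 / p) with hr
    have hV0 : 0 ≤ V := ENNReal.toReal_nonneg
    have hq0 : 0 ≤ q := by positivity
    have hr0 : 0 ≤ r := by positivity
    set A := √(T / M) * (1 + T ^ (3 / 2 : ℝ)) with hA
    have hA0 : 0 ≤ A := by positivity
    have hTR : T * kernelRegularity h T (T / M) ≤ H * (T * (T / M)) + 2 * (V * (T * q) * r) := by
      calc _ ≤ T * (H * (T / M) + 2 * (V * (q * r))) := by gcongr
        _ = _ := by ring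
    have hX : 0 ≤ V * (T * q) * r := by positivity
    have hY : 0 ≤ T * (T / M) := by positivity
    rw [mul_assoc]
    refine mul_le_mul_of_nonneg_left ?_ hK.le
    -- Here too the square root, and with it the supremum norm, is only a nonnegative summand.
    have hsq := Real.sqrt_nonneg (V * (T * q) * r + T * (T / M) * supNormOn h T)
    nlinarith [mul_nonneg hH0 hA0, mul_nonneg hH0 hX, mul_nonneg hH0 hY, mul_nonneg hH0 hsq]
  have hsmall : GridErrorTendsToZero h T → ∃ Δ₀ : ℝ, 0 < Δ₀ ∧ ∀ M : ℕ, 1 ≤ M → T / M ≤ Δ₀ →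
      discreteStabilityConst L ν b h T M ≤ ρ' :=
    exists_discreteStabilityConst_le hb_nonneg hh_meas hH hT hρρ' hstab
  refine ⟨fun M hM hd => hbound M hM (hd.trans hρρ'.le), fun hgrid => ?_, fun p hp hfin => ?_⟩
  · obtain ⟨Δ₀, hΔ₀, hd⟩ := hsmall hgrid
    exact ⟨Δ₀, hΔ₀, fun M hM hle => hbound M hM (hd M hM hle)⟩
  · have hgrid := gridErrorTendsToZero_of_pVariation hp hh_meas hH hT hfin
    refine ⟨hgrid, fun M hM hd => hboundVar p hp hfin M hM (hd.trans hρρ'.le), ?_⟩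
    obtain ⟨Δ₀, hΔ₀, hd⟩ := hsmall hgrid
    exact ⟨Δ₀, hΔ₀, fun M hM hle => hboundVar p hp hfin M hM (hd M hM hle)⟩
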